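/- Let $G$ be a group, let $\mathcal P=\{P_i\}$ be a finite nonempty family of subgroups such that $(G,\mathcal P)$ is of type $F_\infty$ ($G$ and every $P_i$ have classifying spaces with finitely many cells in each dimension), let $N\ge 0$, and let $A$ be a ring. **The cusped space.** Let $B_G$ and $B_P$ ($P\in\mathcal P$) be $(N+1)$-skeleta of such classifying spaces of $G$ and of the $P\in\mathcal P$, and let $E_G\to B_G$ and $E_P\to B_P$ be their preimages in the universal covers of these classifying spaces (for $N\ge1$, the universal covers of $B_G$ and $B_P$). They are assumed to be chosen so that $E_G$ and the $E_P$ are simplicial complexes with simplicial deck actions, and so that there are inclusions $\iota_P\colon B_P\to B_G$ inducing $P\hookrightarrow G$ which lift to $P$-equivariant inclusions of subcomplexes $E_P\subset E_G$. Thus $E_G$ is an $N$-connected simplicial complex of dimension at most $N+1$ with a free simplicial $G$-action with finitely many orbits of simplices, $E_P$ is an $N$-connected $P$-invariant subcomplex, and $gE_P\cap E_P=\emptyset$ for $g\notin P$. Let $\mathrm{Cyl}=\bigl(B_G\sqcup[0,\infty)\times\bigsqcup_P B_P\bigr)/\bigl((0,x)\sim\iota_P(x)\bigr)$ be the open mapping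 cylinder. The $N$-connected cusped space $\mathcal X(N)$ is the cover of $\mathrm{Cyl}$ with deck group $G$ (the universal cover for $N\ge 1$), that is, the union of $E_G$ and, for each $P\in\mathcal P$ and each coset $gP$, of a horoball $[0,\infty)\times gE_P$, glued along $\{0\}\times gE_P=gE_P$. It carries the $G$-invariant simplicial structure whose vertices are those of $E_G$ and the points $(n,v)$, $n\in\mathbb Z_{\ge0}$, $v$ a vertex of $gE_P$, where each $[n,n+1]\times\sigma$ is given the standard subdivision of a prism determined by a $G$-invariant choice of linear orderings of the vertices of the simplices of the $gE_P$ (the same for all $n$; such a choice is assumed to exist and to be fixed). This is a locally finite complex. **The cohomology groups.** $H^k_c(\mathcal X(N);A)$ is the simplicial cohomology with compact support, i.e. the cohomology of the complex of simplicial cochains with values in $A$ that vanish on all but finitely many simplices. Let $\Delta_{G/\mathcal P}$ be the kernel of the augmentation $\bigoplus_{P\in\mathcal P}\mathbb Z[G/P]\to\mathbb Z$; for a $\mathbb ZG$-module $M$, $H^k(G,\mathcal P;M)=\operatorname{Ext}^{k-1}_{\mathbb ZG}(\Delta_{G/\mathcal P},M)$, which is $0$ for $k=0$. The group ring $AG$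 is a left $\mathbb ZG$-module, and right multiplication makes $H^k(G,\mathcal P;AG)$ a right $AG$-module; $H_c^k(\mathcal X(N);A)$ is a right $AG$-module by $(\varphi\cdot ag)(x)=\varphi(gx)\,a$. **Proposition.** For every such choice of $\mathcal X(N)$ and every $0\le k\le N$ there is an isomorphism of right $AG$-modules $$H^k(G,\mathcal P;AG)\;\cong\;H^k_c(\mathcal X(N);A).$$ -/

import Mathlib

open CategoryTheory

universe u v w

noncomputable section

/-! ### Simplicial complexes: realization, connectivity, group actions -/

namespace PreAbstractSimplicialComplex

variable {W : Type w} (K : PreAbstractSimplicialComplex W)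

/-- The points of the geometric realization `|K|`, in barycentric coordinates. -/
def Realization : Type w :=
  {x : W → ℝ // ∃ σ ∈ K.faces, (∀ v, 0 ≤ x v) ∧ (∀ v, v ∉ σ → x v = 0) ∧ ∑ v ∈ σ, x v = 1}

open Classical in
/-- The inclusion of a closed simplex in the geometric realization. -/
def simplexInclusion (σ : K.faces) (t : stdSimplex ℝ {v // v ∈ σ.1}) : K.Realization :=
  ⟨fun v => if h : v ∈ σ.1 then t.1 ⟨v, h⟩ else 0, σ.1, σ.2, by
    refine ⟨fun v => ?_, fun v hv => by simp [hv], ?_⟩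
    · by_cases h : v ∈ σ.1
      · simpa [h] using t.2.1 ⟨v, h⟩
      · simp [h]
    · rw [← Finset.sum_attach]
      simpa using t.2.2⟩

/-- The weak topology: a set is open (closed) iff its trace on every closed simplex is. -/
instance : TopologicalSpace K.Realization :=
  ⨆ σ : K.faces, TopologicalSpace.coinduced (K.simplexInclusion σ) inferInstance

/-- `K` is `N`-connected: it is nonempty, and for all `i ≤ N` every map from the `i`-sphere
to `|K|` is null-homotopic. -/
def IsNConnected (N : ℕ) : Prop :=
  Nonempty K.Realization ∧
    ∀ i ≤ N, ∀ f : C(Metric.sphere (0 : EuclideanSpace ℝ (Fin (i + 1))) 1, K.Realization),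
      f.Nullhomotopic

end PreAbstractSimplicialComplex

/-- The translate `g σ` of a finite set of vertices. -/
def translateFace {G : Type u} [Group G] {W : Type w} [MulAction G W] (g : G) (σ : Finset W) :
    Finset W :=
  σ.map (MulAction.toPerm g).toEmbedding

lemma mem_translateFace {G : Type u} [Group G] {W : Type w} [MulAction G W] {g : G} {σ : Finset W}
    {x : W} : x ∈ translateFace g σ ↔ ∃ v ∈ σ, g • v = x := by
  simp only [translateFace, Finset.mem_map]
  rfl

/-- `G` acts on `K` by simplicial automorphisms. -/
def PreAbstractSimplicialComplex.IsInvariant (G : Type u) [Group G] {W : Type w} [MulAction G W]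
    (K : PreAbstractSimplicialComplex W) : Prop :=
  ∀ (g : G), ∀ σ ∈ K.faces, translateFace g σ ∈ K.faces

/-! ### Simplicial cohomology with compact support -/

namespace CompactCohomology

variable {W : Type w} (K : PreAbstractSimplicialComplex W) (A : Type v)

/-- `x` lists the vertices of a simplex of `K`, without repetition. -/
def IsOrderedSimplex {n : ℕ} (x : Fin n → W) : Prop :=
  Function.Injective x ∧ ∃ σ ∈ K.faces, Set.range x = (σ : Set W)

/-- Simplicial (oriented, that is alternating) `k`-cochains with compact support: cochains
which vanish on all but finitely many simplices. -/
def cochains [AddCommGroup A] (k : ℕ) : AddSubgroup ((Fin (k + 1) → W) → A) where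
  carrier := {φ | (∀ x, ¬ IsOrderedSimplex K x → φ x = 0) ∧
    (∀ x (π : Equiv.Perm (Fin (k + 1))), φ (x ∘ π) = (Equiv.Perm.sign π : ℤ) • φ x) ∧
    φ.support.Finite}
  zero_mem' := by simp
  add_mem' := by
    rintro φ ψ ⟨h1, h2, h3⟩ ⟨h1', h2', h3'⟩
    refine ⟨fun x hx => by simp [h1 x hx, h1' x hx], fun x π => ?_,
      (h3.union h3').subset (Function.support_add _ _)⟩
    simp [h2 x π, h2' x π]
  neg_mem' := by
    rintro φ ⟨h1, h2, h3⟩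
    refine ⟨fun x hx => by simp [h1 x hx], fun x π => by simp [h2 x π], ?_⟩
    rwa [Function.support_neg]

open Classical in
/-- The simplicial coboundary. -/
def coboundary [AddCommGroup A] (k : ℕ) :
    ((Fin (k + 1) → W) → A) →+ ((Fin (k + 2) → W) → A) where
  toFun φ x := if IsOrderedSimplex K x then
    ∑ j : Fin (k + 2), ((-1 : ℤ) ^ (j : ℕ)) • φ (x ∘ j.succAbove) else 0
  map_zero' := by ext x; simp
  map_add' φ ψ := by
    ext x
    by_cases h : IsOrderedSimplex K x <;> simp [h, Finset.sum_add_distrib]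

/-- The compactly supported cocycles. -/
def cocycles [AddCommGroup A] (k : ℕ) : AddSubgroup ((Fin (k + 1) → W) → A) :=
  cochains K A k ⊓ (coboundary K A k).ker

/-- The coboundaries of compactly supported cochains. -/
def coboundaries [AddCommGroup A] : (k : ℕ) → AddSubgroup ((Fin (k + 1) → W) → A)
  | 0 => ⊥
  | k + 1 => (cochains K A k).map (coboundary K A k)

/-- The simplicial cohomology with compact support `H_c^k(K; A)` of a locally finite simplicial
complex `K`. (Local finiteness makes all coboundaries of compactly supported cochains
compactly supported.) -/
abbrev Hc [AddCommGroup A] (k : ℕ) : Type (max v w) :=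
  cocycles K A k ⧸ (coboundaries K A k).addSubgroupOf (cocycles K A k)

section Action

variable {G : Type u} [Group G] [MulAction G W] {A} [Ring A]

/-- The right action of the element `a g` of `A G` on cochains:
`(φ · a g)(x) = φ(g x) a`. -/
def actCochain (g : G) (a : A) (n : ℕ) : ((Fin n → W) → A) →+ ((Fin n → W) → A) where
  toFun φ x := φ (fun j => g • x j) * a
  map_zero' := by ext x; simp
  map_add' φ ψ := by ext x; simp [add_mul]

variable {K}

lemma isOrderedSimplex_smul (hK : K.IsInvariant G) (g : G) {n : ℕ} (x : Fin n → W) :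
    IsOrderedSimplex K (fun j => g • x j) ↔ IsOrderedSimplex K x := by
  have key : ∀ (g : G) (x : Fin n → W), IsOrderedSimplex K x →
      IsOrderedSimplex K (fun j => g • x j) := by
    rintro g x ⟨hx, σ, hσ, h⟩
    refine ⟨fun i j hij => hx (MulAction.injective g hij), translateFace g σ, hK g σ hσ, ?_⟩
    ext y
    have hm : ∀ v, v ∈ σ ↔ ∃ j, x j = v := fun v => by
      rw [← Finset.mem_coe, ← h, Set.mem_range]
    simp only [Set.mem_range, Finset.mem_coe, mem_translateFace, hm]
    constructor
    · rintro ⟨j, rfl⟩; exact ⟨_, ⟨j, rfl⟩, rfl⟩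
    · rintro ⟨_, ⟨j, rfl⟩, rfl⟩; exact ⟨j, rfl⟩
  refine ⟨fun h => ?_, key g x⟩
  simpa using key g⁻¹ _ h

lemma actCochain_mem (hK : K.IsInvariant G) (g : G) (a : A) {k : ℕ}
    {φ : (Fin (k + 1) → W) → A} (hφ : φ ∈ cochains K A k) :
    actCochain g a (k + 1) φ ∈ cochains K A k := by
  obtain ⟨h1, h2, h3⟩ := hφ
  refine ⟨fun x hx => ?_, fun x π => ?_, ?_⟩
  · have := h1 (fun j => g • x j) (by rwa [isOrderedSimplex_smul hK])
    simp [actCochain, this]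
  · have := h2 (fun j => g • x j) π
    simp only [actCochain, AddMonoidHom.coe_mk, ZeroHom.coe_mk]
    rw [← smul_mul_assoc, ← this]
    rfl
  · have hinj : Function.Injective (fun (x : Fin (k + 1) → W) j => g • x j) := fun x y h =>
      funext fun j => MulAction.injective g (congrFun h j)
    refine (h3.preimage (hinj.injOn)).subset fun x hx => ?_
    simp only [actCochain, AddMonoidHom.coe_mk, ZeroHom.coe_mk, Function.mem_support] at hx
    exact left_ne_zero_of_mul hx

lemma coboundary_act (hK : K.IsInvariant G) (g : G) (a : A) {k : ℕ}
    (φ : (Fin (k + 1) → W) → A) :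
    coboundary K A k (actCochain g a (k + 1) φ) =
      actCochain g a (k + 2) (coboundary K A k φ) := by
  ext x
  have hx := isOrderedSimplex_smul hK g x
  simp only [coboundary, actCochain, AddMonoidHom.coe_mk, ZeroHom.coe_mk]
  by_cases h : IsOrderedSimplex K x
  · rw [if_pos h, if_pos (hx.2 h), Finset.sum_mul]
    refine Finset.sum_congr rfl fun j _ => ?_
    rw [smul_mul_assoc]
    rfl
  · rw [if_neg h, if_neg (fun h' => h (hx.1 h')), zero_mul]

lemma act_mem_cocycles (hK : K.IsInvariant G) (g : G) (a : A) {k : ℕ}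
    {φ : (Fin (k + 1) → W) → A} (hφ : φ ∈ cocycles K A k) :
    actCochain g a (k + 1) φ ∈ cocycles K A k := by
  refine ⟨actCochain_mem hK g a hφ.1, ?_⟩
  have h0 : coboundary K A k φ = 0 := hφ.2
  change coboundary K A k _ = 0
  rw [coboundary_act hK, h0, map_zero]

lemma act_mem_coboundaries (hK : K.IsInvariant G) (g : G) (a : A) {k : ℕ}
    {φ : (Fin (k + 1) → W) → A} (hφ : φ ∈ coboundaries K A k) :
    actCochain g a (k + 1) φ ∈ coboundaries K A k := by
  cases k with
  | zero =>
    have h0 : φ = 0 := hφ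
    rw [h0, map_zero]
    exact zero_mem _
  | succ k =>
    obtain ⟨ψ, hψ, rfl⟩ := hφ
    exact ⟨actCochain g a (k + 1) ψ, actCochain_mem hK g a hψ, coboundary_act hK g a ψ⟩

/-- The right action of `a g ∈ A G` on compactly supported cohomology. -/
def actHc (hK : K.IsInvariant G) (g : G) (a : A) (k : ℕ) : Hc K A k →+ Hc K A k :=
  QuotientAddGroup.map _ _
    (((actCochain g a (k + 1)).comp (cocycles K A k).subtype).codRestrict (cocycles K A k)
      fun φ => act_mem_cocycles hK g a φ.2)
    fun _ hφ => act_mem_coboundaries hK g a hφ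

end Action

end CompactCohomology

/-! ### Relative group cohomology -/

namespace RelativeCohomology

variable {G : Type u} [Group G] {ι : Type} (P : ι → Subgroup G) (A : Type v) [Ring A]

/-- The `ℤG`-module `ℤG/𝒫 = ⨁ᵢ ℤ[G/Pᵢ]`, as the permutation module on `⊔ᵢ G/Pᵢ`. -/
abbrev cosetRep : Representation ℤ G (MonoidAlgebra ℤ (Σ i, G ⧸ P i)) :=
  Representation.ofMulAction ℤ G (Σ i, G ⧸ P i)

/-- The augmentation `ℤG/𝒫 → ℤ`, sending each coset to `1`. -/
def augmentation : MonoidAlgebra ℤ (Σ i, G ⧸ P i) →ₗ[ℤ] ℤ :=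
  Finsupp.linearCombination ℤ (fun _ => (1 : ℤ)) ∘ₗ
    (MonoidAlgebra.coeffLinearEquiv ℤ).toLinearMap

lemma augmentation_single (c : Σ i, G ⧸ P i) (r : ℤ) :
    augmentation P (MonoidAlgebra.single c r) = r := by
  simp [augmentation]

/-- The augmentation as a map of `G`-representations, `ℤ` being the trivial one. -/
def augmentationIntertwining :
    (cosetRep P).IntertwiningMap (Representation.trivial ℤ G ℤ) where
  toLinearMap := augmentation P
  isIntertwining' g := by
    ext c
    simp [augmentation_single]

/-- `Δ_{G/𝒫}`: the kernel of the augmentation, a `ℤG`-module. -/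
def Delta : Submodule (MonoidAlgebra ℤ G) (cosetRep P).asModule :=
  LinearMap.ker (Representation.IntertwiningMap.equivLinearMapAsModule
    (cosetRep P) (Representation.trivial ℤ G ℤ) (augmentationIntertwining P))

/-- `Δ_{G/𝒫}` as an object of the category of `ℤG`-modules. -/
def deltaModule : ModuleCat.{max u v} (MonoidAlgebra ℤ G) :=
  ModuleCat.of _ (ULift.{v} (Delta P))

variable (G) in
/-- `A G` as a left `ℤG`-module. -/
def coefficients : ModuleCat.{max u v} (MonoidAlgebra ℤ G) :=
  (ModuleCat.restrictScalars (MonoidAlgebra.mapRingHom G (Int.castRingHom A))).obj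
    (ModuleCat.of (MonoidAlgebra A G) (MonoidAlgebra A G))

variable (G) {A} in
/-- Right multiplication by `b ∈ A G`, an endomorphism of the left `ℤG`-module `A G`. -/
def rightMul (b : MonoidAlgebra A G) : coefficients G A ⟶ coefficients G A :=
  (ModuleCat.restrictScalars (MonoidAlgebra.mapRingHom G (Int.castRingHom A))).map
    (ModuleCat.ofHom (LinearMap.toSpanSingleton (MonoidAlgebra A G) (MonoidAlgebra A G) b))

variable {P}

/-- `H^k(G, 𝒫; M) = Ext_G^{k-1}(Δ_{G/𝒫}, M)`, which is zero for `k = 0`. -/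
def H (P : ι → Subgroup G) (M : ModuleCat.{max u v} (MonoidAlgebra ℤ G)) :
    ℕ → AddCommGrpCat.{max u v}
  | 0 => AddCommGrpCat.of PUnit
  | k + 1 => AddCommGrpCat.of (Abelian.Ext.{max u v} (deltaModule.{u, v} P) M k)

/-- Functoriality of `H^k(G, 𝒫; M)` in the coefficient module. -/
def mapH {M M' : ModuleCat.{max u v} (MonoidAlgebra ℤ G)} (f : M ⟶ M') :
    (k : ℕ) → (H.{u, v} P M k →+ H.{u, v} P M' k)
  | 0 => 0
  | k + 1 => (Abelian.Ext.mk₀ f).postcomp (deltaModule.{u, v} P) (add_zero k)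

end RelativeCohomology

/-! ### The cusped space -/

/-- The vertices of the cusped space: those of `E_G`, at depth `0`, and the vertices
at depth `n + 1` above `v ∈ E_G` in the horoballs belonging to the index `i`. -/
inductive CuspVertex (ι : Type) (V : Type w) : Type w
  | base (v : V) : CuspVertex ι V
  | horo (i : ι) (n : ℕ) (v : V) : CuspVertex ι V

namespace CuspVertex

variable {ι : Type} {V : Type w}

/-- The vertex `(n, v)` of the horoballs belonging to `i`; `(0, v)` is glued to `v`. -/
def at_depth (i : ι) : ℕ → V → CuspVertex ι V
  | 0, v => base v
  | n + 1, v => horo i n v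

instance {G : Type u} [Group G] [MulAction G V] : MulAction G (CuspVertex ι V) where
  smul g
    | base v => base (g • v)
    | horo i n v => horo i n (g • v)
  one_smul x := by
    cases x
    · exact congrArg base (one_smul G _)
    · exact congrArg (horo _ _) (one_smul G _)
  mul_smul g h x := by
    cases x
    · exact congrArg base (mul_smul g h _)
    · exact congrArg (horo _ _) (mul_smul g h _)

lemma smul_base {G : Type u} [Group G] [MulAction G V] (g : G) (v : V) :
    g • (base v : CuspVertex ι V) = base (g • v) := rfl

lemma smul_at_depth {G : Type u} [Group G] [MulAction G V] (g : G) (i : ι) (n : ℕ) (v : V) :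
    g • at_depth i n v = at_depth i n (g • v) := by
  cases n <;> rfl

end CuspVertex

/-- The choices made in the construction of the `N`-connected cusped space of the pair
`(G, 𝒫)`, `𝒫 = {P i}`, in terms of the covers `E_G` and `E_P` of the `(N+1)`-skeleta
`B_G = E_G / G` and `B_P = E_P / P` of classifying spaces:
* `E_G` is a simplicial complex of dimension at most `N + 1`, `N`-connected, with a free simplicial
  action of `G` with finitely many orbits of simplices (these are exactly the complexes
  arising as the preimage of the finite `(N+1)`-skeleton of a `K(G,1)` in its universal cover);
* `E_P` is a `P`-invariant `N`-connected subcomplex of `E_G`; that `v` and `g v` lie in `E_P` only if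
  `g ∈ P` says that `B_P = E_P / P → E_G / G = B_G` is injective;
* an equivariant choice of orderings of the vertices of the simplices of `E_P`, which fixes the
  standard subdivision of the products of an interval and a simplex. -/
structure CuspedSpaceData {G : Type u} [Group G] {ι : Type} (P : ι → Subgroup G) (N : ℕ) where
  V : Type w
  [action : MulAction G V]
  EG : PreAbstractSimplicialComplex V
  EG_invariant : EG.IsInvariant G
  EG_free : ∀ g : G, ∀ σ ∈ EG.faces, translateFace g σ = σ → g = 1
  EG_finite : ∃ T : Set (Finset V), T.Finite ∧
    ∀ σ ∈ EG.faces, ∃ g : G, ∃ τ ∈ T, σ = translateFace g τ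
  EG_dim : ∀ σ ∈ EG.faces, σ.card ≤ N + 2
  EG_connected : EG.IsNConnected N
  EP : ι → PreAbstractSimplicialComplex V
  EP_le : ∀ i, EP i ≤ EG
  EP_invariant : ∀ i, ∀ p ∈ P i, ∀ σ ∈ (EP i).faces, translateFace p σ ∈ (EP i).faces
  EP_connected : ∀ i, (EP i).IsNConnected N
  EP_separated : ∀ i (g : G) (v : V), {v} ∈ (EP i).faces → {g • v} ∈ (EP i).faces → g ∈ P i
  /-- the ordering `lt i` of the vertices of the simplices of `EP i` and its translates -/
  lt : ι → V → V → Prop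
  lt_invariant : ∀ i (g : G) (v w : V), lt i v w → lt i (g • v) (g • w)
  lt_irrefl : ∀ i, ∀ σ ∈ (EP i).faces, ∀ a ∈ σ, ¬ lt i a a
  lt_trans : ∀ i, ∀ σ ∈ (EP i).faces, ∀ a ∈ σ, ∀ b ∈ σ, ∀ c ∈ σ,
    lt i a b → lt i b c → lt i a c
  lt_total : ∀ i, ∀ σ ∈ (EP i).faces, ∀ a ∈ σ, ∀ b ∈ σ, a = b ∨ lt i a b ∨ lt i b a

namespace CuspedSpaceData

attribute [instance] CuspedSpaceData.action

variable {G : Type u} [Group G] {ι : Type} {P : ι → Subgroup G} {N : ℕ}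
  (D : CuspedSpaceData.{u, w} P N)

/-- The simplices of the preimage of `B_P` in `E_G`, the disjoint union of the `g E_P`, `g P ∈ G/P`. -/
def peripheralFaces (i : ι) : Set (Finset D.V) :=
  {τ | ∃ g : G, ∃ σ ∈ (D.EP i).faces, τ = translateFace g σ}

/-- `s` is a simplex in the layer `[n, n+1] × g E_P` of a horoball, subdivided in the
standard way: it lies over a simplex `τ` of `g E_P`, and its vertices of depth `n` come before
(or over the same vertex as) its vertices of depth `n + 1` in the ordering of `τ`. -/
def IsHoroballSimplex (i : ι) (n : ℕ) (s : Finset (CuspVertex ι D.V)) : Prop :=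
  ∃ τ ∈ D.peripheralFaces i,
    (∀ x ∈ s, ∃ v ∈ τ, x = .at_depth i n v ∨ x = .at_depth i (n + 1) v) ∧
    ∀ a b, .at_depth i n a ∈ s → .at_depth i (n + 1) b ∈ s → a = b ∨ D.lt i a b

/-- The `N`-connected cusped space `𝒳(N)`, as a simplicial complex: the union of `E_G` and
of the horoballs `[0, ∞) × g E_P`, glued along `{0} × g E_P = g E_P`. It is the cover with
group `G` of the open mapping cylinder of `⊔ B_P → B_G`. -/
def cuspedSpace : PreAbstractSimplicialComplex (CuspVertex ι D.V) where
  faces := {s | s.Nonempty ∧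
    ((∃ σ ∈ D.EG.faces, ∀ x ∈ s, ∃ v ∈ σ, x = .base v) ∨ ∃ i n, D.IsHoroballSimplex i n s)}
  isRelLowerSet_faces := by
    rintro s ⟨hs, h⟩
    refine ⟨hs, fun t hts ht => ⟨ht, ?_⟩⟩
    rcases h with ⟨σ, hσ, h⟩ | ⟨i, n, τ, hτ, h1, h2⟩
    · exact Or.inl ⟨σ, hσ, fun x hx => h x (hts hx)⟩
    · exact Or.inr ⟨i, n, τ, hτ, fun x hx => h1 x (hts hx),
        fun a b ha hb => h2 a b (hts ha) (hts hb)⟩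

lemma cuspedSpace_invariant : D.cuspedSpace.IsInvariant G := by
  rintro g s ⟨hs, h⟩
  refine ⟨by simpa [translateFace] using hs, ?_⟩
  rcases h with ⟨σ, hσ, h⟩ | ⟨i, n, τ, ⟨g', σ, hσ, rfl⟩, h1, h2⟩
  · refine Or.inl ⟨translateFace g σ, D.EG_invariant g σ hσ, fun x hx => ?_⟩
    obtain ⟨y, hy, rfl⟩ := mem_translateFace.1 hx
    obtain ⟨v, hv, rfl⟩ := h y hy
    exact ⟨g • v, mem_translateFace.2 ⟨v, hv, rfl⟩, rfl⟩
  · refine Or.inr ⟨i, n, translateFace (g * g') σ, ⟨g * g', σ, hσ, rfl⟩, fun x hx => ?_,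
      fun a b ha hb => ?_⟩
    · obtain ⟨y, hy, rfl⟩ := mem_translateFace.1 hx
      obtain ⟨v, hv, hyv⟩ := h1 y hy
      obtain ⟨z, hz, rfl⟩ := mem_translateFace.1 hv
      refine ⟨g • g' • z, mem_translateFace.2 ⟨z, hz, mul_smul _ _ _⟩, ?_⟩
      rw [← CuspVertex.smul_at_depth g i n, ← CuspVertex.smul_at_depth g i (n + 1)]
      rcases hyv with rfl | rfl
      · exact Or.inl rfl
      · exact Or.inr rfl
    · have key : ∀ m c, CuspVertex.at_depth i m c ∈ translateFace g s →
          CuspVertex.at_depth i m (g⁻¹ • c) ∈ s := by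
        intro m c hc
        obtain ⟨y, hy, hyc⟩ := mem_translateFace.1 hc
        rw [← CuspVertex.smul_at_depth, ← hyc, inv_smul_smul]
        exact hy
      rcases h2 _ _ (key _ a ha) (key _ b hb) with h | h
      · exact Or.inl (MulAction.injective g⁻¹ h)
      · right
        simpa using D.lt_invariant i g _ _ h

end CuspedSpaceData

end

noncomputable section

/-! ### The alternating sum of faces -/

section Delta

variable {W W' M M' : Type*} [AddCommGroup M] [AddCommGroup M']

/-! Both groups are cohomology groups of the same complex of pairs of cochains.

Algebraic side. The relative chains `RelChain` form the mapping cone of `C_*(⊔ gE_P) → C_*(E_G)`, a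
complex of finitely generated projective `ℤG`-modules. Since `E_G` and the `E_P` are `N`-connected,
its homology is zero in degree 0 and in degrees 2 to `N`, and for `N ≥ 1` its homology in degree 1
is the kernel of `H_0(⊔ gE_P) = ℤG/𝒫 → H_0(E_G) = ℤ`, that is `Δ`. So it is a partial projective
resolution of `Δ`, shifted by one, and dimension shifting (`exists_ext_presentation`) presents
`Ext^k(Δ, M)` as cocycles modulo coboundaries of `Hom(RelChain, M)` in degree `k + 1 ≤ N`.

For `M = AG`, taking the coefficient at `1` identifies equivariant homomorphisms with finitely
supported cochains (`toCochain`): finitely many orbits give finite support, and freeness gives the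
converse. A relative cocycle becomes a pair `(α, β)` of finitely supported cochains on `E_G` and on
`⊔ gE_P` with `δα = 0` and `α| = δβ`.

Topological side. A cochain on the cusped space is a pair of cochains on `E_G` and on the horoballs
which agree on the overlap. Pushing towards infinity shows that horoballs have no compactly
supported cohomology (`exists_coboundary_eq_of_horoball`). Let `β~` be the extension of `β` by zero
to the horoballs. Gluing `α` to `δβ~` (`relGlue`) turns relative cocycles into compactly supported
cocycles. Acyclicity of the horoballs implies that every class arises in this way, and that a pair
becomes a coboundary only if it is a relative coboundary. The group of relative cocycles thus
surjects onto both sides with the same kernel, compatibly with the right action. In degree 0 both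
sides vanish.

The topological input `exists_bdry_eq_of_isNConnected` turns null-homotopies of spheres into
exactness of simplicial chains. Cones over the simplices of a cycle are built as singular simplices.
They are sampled along a very fine chain in the standard simplex, and every sample is rounded to a
vertex with a large barycentric coordinate. This yields a simplicial chain whose boundary is the
rounded cycle; the rounded cycle is homologous to the original one simplex by simplex.

Two conventions matter. Chain indices count vertices: ordered chains include the empty tuple and so
are augmented, while oriented chains are not. The peripheral complex uses a separate copy of the
vertices for every index `i`, because translates of `E_P` for different indices may meet in `E_G`.
-/

/-- The alternating sum of the values of a function on the faces of a tuple. -/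
def faceSum (n : ℕ) : ((Fin n → W) → M) →+ ((Fin (n + 1) → W) → M) where
  toFun φ x := ∑ j : Fin (n + 1), ((-1 : ℤ) ^ (j : ℕ)) • φ (x ∘ j.succAbove)
  map_zero' := by ext x; simp
  map_add' φ ψ := by ext x; simp [Finset.sum_add_distrib]

lemma faceSum_apply {n : ℕ} (φ : (Fin n → W) → M) (x : Fin (n + 1) → W) :
    faceSum n φ x = ∑ j : Fin (n + 1), ((-1 : ℤ) ^ (j : ℕ)) • φ (x ∘ j.succAbove) := rfl

lemma faceSum_comp_tuple {n : ℕ} (φ : (Fin n → W') → M) (f : W → W') (x : Fin (n + 1) → W) :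
    faceSum n (fun y => φ (f ∘ y)) x = faceSum n φ (f ∘ x) := rfl

lemma map_faceSum {F : Type*} [FunLike F M M'] [AddMonoidHomClass F M M'] (h : F) {n : ℕ}
    (φ : (Fin n → W) → M) (x : Fin (n + 1) → W) :
    h (faceSum n φ x) = faceSum n (fun y => h (φ y)) x := by
  simp only [faceSum_apply, map_sum, map_zsmul]

lemma cons_comp_succAbove_succ {n : ℕ} (a : W) (x : Fin (n + 1) → W) (j : Fin (n + 1)) :
    (Fin.cons a x : Fin (n + 2) → W) ∘ j.succ.succAbove = Fin.cons a (x ∘ j.succAbove) := by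
  ext i
  cases i using Fin.cases <;> simp

lemma cons_comp_succAbove_zero {n : ℕ} (a : W) (x : Fin n → W) :
    (Fin.cons a x : Fin (n + 1) → W) ∘ (0 : Fin (n + 1)).succAbove = x := by
  ext i; simp

lemma faceSum_cons {n : ℕ} (φ : (Fin (n + 1) → W) → M) (a : W) (x : Fin (n + 1) → W) :
    faceSum (n + 1) φ (Fin.cons a x) =
      φ x - faceSum n (fun y => φ (Fin.cons a y)) x := by
  rw [faceSum_apply, Fin.sum_univ_succ, faceSum_apply]
  simp only [cons_comp_succAbove_succ, cons_comp_succAbove_zero, Fin.val_zero, pow_zero, one_smul,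
    Fin.val_succ, pow_succ, mul_neg, mul_one, neg_smul, Finset.sum_neg_distrib, sub_eq_add_neg]

lemma faceSum_cons_zero (φ : (Fin 0 → W) → M) (a : W) (x : Fin 0 → W) :
    faceSum 0 φ (Fin.cons a x) = φ x := by
  simp [faceSum_apply, Subsingleton.elim _ x]

lemma exists_eq_cons {n : ℕ} (x : Fin (n + 1) → W) :
    ∃ (a : W) (y : Fin n → W), x = Fin.cons a y :=
  ⟨x 0, Fin.tail x, (Fin.cons_self_tail x).symm⟩

lemma faceSum_faceSum : ∀ {n : ℕ} (φ : (Fin n → W) → M), faceSum (n + 1) (faceSum n φ) = 0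
  | 0, φ => by
    ext x
    obtain ⟨a, y, rfl⟩ := exists_eq_cons x
    obtain ⟨b, z, rfl⟩ := exists_eq_cons y
    rw [faceSum_cons]
    have : (fun y => faceSum 0 φ (Fin.cons a y)) = φ := funext fun y => faceSum_cons_zero _ _ _
    rw [this, sub_self, Pi.zero_apply]
  | n + 1, φ => by
    ext x
    obtain ⟨a, y, rfl⟩ := exists_eq_cons x
    rw [faceSum_cons]
    have : (fun y => faceSum (n + 1) φ (Fin.cons a y)) =
        φ - faceSum n (fun y => φ (Fin.cons a y)) := funext fun y => faceSum_cons _ _ _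
    rw [this, map_sub, faceSum_faceSum, sub_zero, sub_self, Pi.zero_apply]

/-- Alternating functions on tuples. -/
structure IsAlternating {n : ℕ} (φ : (Fin n → W) → M) : Prop where
  perm : ∀ x (π : Equiv.Perm (Fin n)), φ (x ∘ π) = (Equiv.Perm.sign π : ℤ) • φ x
  degenerate : ∀ x, ¬ Function.Injective x → φ x = 0

lemma neg_one_pow_smul_eq_sign {n : ℕ} (i : Fin (n + 1)) (m : M) :
    ((-1 : ℤ) ^ (i : ℕ)) • m = (Equiv.Perm.sign (i.cycleRange.symm) : ℤ) • m := by
  rw [Equiv.Perm.sign_symm, Fin.sign_cycleRange]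
  simp

/-- Cycles that bring the omitted positions `i` and `π i` to the front turn `π` into a permutation
fixing `0`. Its restriction to the remaining positions is `ρ`, and the two cycles account for the
signs. -/
lemma face_comp_perm {n : ℕ} (π : Equiv.Perm (Fin (n + 1))) (i : Fin (n + 1)) :
    ∃ ρ : Equiv.Perm (Fin n), π ∘ i.succAbove = (π i).succAbove ∘ ρ ∧
      (-1 : ℤ) ^ (i : ℕ) * (Equiv.Perm.sign ρ : ℤ) =
        Equiv.Perm.sign π * (-1 : ℤ) ^ (π i : ℕ) := by
  set τ : Equiv.Perm (Fin (n + 1)) := (π i).cycleRange * π * i.cycleRange⁻¹ with hτ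
  have h0 : τ 0 = 0 := by
    simp [hτ]
  obtain ⟨⟨p, ρ⟩, hρ⟩ := Equiv.Perm.decomposeFin.symm.surjective τ
  have hp : p = 0 := by
    rw [← hρ] at h0
    simpa using h0
  subst hp
  refine ⟨ρ, ?_, ?_⟩
  · ext1 j
    have h1 : τ j.succ = (ρ j).succ := by rw [← hρ]; simp
    have h2 : (π i).cycleRange (π (i.succAbove j)) = (ρ j).succ := by
      rw [← h1, hτ]
      simp
    have h3 := congrArg (π i).cycleRange.symm h2
    simpa using h3
  · have hs : Equiv.Perm.sign τ = Equiv.Perm.sign ρ := by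
      rw [← hρ]; simp [Equiv.Perm.decomposeFin.symm_sign]
    have hs' : Equiv.Perm.sign ρ = (-1) ^ (π i : ℕ) * Equiv.Perm.sign π * (-1) ^ (i : ℕ) := by
      rw [← hs, hτ]
      simp [Fin.sign_cycleRange]
    rw [hs']
    push_cast
    have : ((-1 : ℤ) ^ (i : ℕ)) * (-1) ^ (i : ℕ) = 1 := by rw [← mul_pow]; simp
    linear_combination ((-1 : ℤ) ^ (π i : ℕ) * Equiv.Perm.sign π) * this

lemma faceSum_perm {n : ℕ} {φ : (Fin n → W) → M}
    (h : ∀ x (π : Equiv.Perm (Fin n)), φ (x ∘ π) = (Equiv.Perm.sign π : ℤ) • φ x)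
    (x : Fin (n + 1) → W) (π : Equiv.Perm (Fin (n + 1))) :
    faceSum n φ (x ∘ π) = (Equiv.Perm.sign π : ℤ) • faceSum n φ x := by
  rw [faceSum_apply, faceSum_apply, Finset.smul_sum]
  refine Eq.trans ?_ (Equiv.sum_comp π _)
  refine Finset.sum_congr rfl fun i _ => ?_
  obtain ⟨ρ, hρ, hs⟩ := face_comp_perm π i
  rw [Function.comp_assoc, hρ, ← Function.comp_assoc, h, smul_smul, smul_smul, hs]

lemma exists_perm_zero_one {n : ℕ} {a b : Fin (n + 2)} (h : a ≠ b) :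
    ∃ π : Equiv.Perm (Fin (n + 2)), π 0 = a ∧ π 1 = b := by
  have hb : (Equiv.swap 0 a) b ≠ 0 := by
    intro h'
    rw [Equiv.swap_apply_eq_iff, Equiv.swap_apply_left] at h'
    exact h h'.symm
  refine ⟨Equiv.swap 0 a * Equiv.swap 1 (Equiv.swap 0 a b), ?_, ?_⟩
  · rw [Equiv.Perm.mul_apply, Equiv.swap_apply_of_ne_of_ne (by simp) hb.symm]
    simp
  · simp

/-- Vanishing on degenerate tuples does not follow from the sign rule when there is 2-torsion, so it
is proved separately. After a permutation the repeated entries stand in positions 0 and 1; the two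
faces omitting one of them cancel, and all others are still degenerate. -/
lemma IsAlternating.faceSum {n : ℕ} {φ : (Fin n → W) → M} (h : IsAlternating φ) :
    IsAlternating (faceSum n φ) where
  perm := faceSum_perm h.perm
  degenerate := by
    intro x hx
    obtain ⟨a, b, hab, hne⟩ : ∃ a b, x a = x b ∧ a ≠ b := by
      simpa [Function.Injective] using hx
    match n with
    | 0 => exact (hne (Subsingleton.elim (α := Fin 1) _ _)).elim
    | n + 1 =>
      obtain ⟨π, h0, h1⟩ := exists_perm_zero_one hne
      have key : _root_.faceSum (n + 1) φ (x ∘ π) = 0 := by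
        have e : (x ∘ π) 0 = (x ∘ π) 1 := by simp [h0, h1, hab]
        obtain ⟨c, y, hy⟩ := exists_eq_cons (x ∘ π)
        obtain ⟨d, z, rfl⟩ := exists_eq_cons y
        rw [hy] at e ⊢
        have hcd : c = d := e
        subst hcd
        have hd : ∀ z : Fin n → W, φ (Fin.cons c z) = φ (Fin.cons c z) := fun _ => rfl
        rw [faceSum_cons]
        match n with
        | 0 => rw [faceSum_cons_zero, sub_self]
        | n + 1 =>
          rw [faceSum_cons]
          have : (fun y => φ (Fin.cons c (Fin.cons c y))) = 0 := by
            funext y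
            refine h.degenerate _ fun hi => ?_
            have := @hi 0 1 rfl
            simp at this
          rw [this, map_zero]
          simp
      rw [faceSum_perm h.perm] at key
      rcases Int.units_eq_one_or (Equiv.Perm.sign π) with hs | hs <;> simpa [hs] using key

end Delta

/-! ### Ordered chains -/

section OrderedChains

variable {Y Y' Y'' : Type*}

/-- Ordered chains, generated by all tuples; the empty tuple is in degree `-1`. -/
abbrev OrdChain (Y : Type*) (n : ℕ) := (Fin n → Y) →₀ ℤ

namespace OrdChain

/-- The generators. -/
def of {n : ℕ} (x : Fin n → Y) : OrdChain Y n := Finsupp.single x 1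

/-- Linear extension of a function on tuples. -/
abbrev lift {n : ℕ} {M : Type*} [AddCommGroup M] (F : (Fin n → Y) → M) : OrdChain Y n →ₗ[ℤ] M :=
  Finsupp.linearCombination ℤ F

@[simp] lemma lift_of {n : ℕ} {M : Type*} [AddCommGroup M] (F : (Fin n → Y) → M) (x : Fin n → Y) :
    lift F (of x) = F x := by simp [of]

lemma hom_ext {n : ℕ} {M : Type*} [AddCommGroup M] {f g : OrdChain Y n →ₗ[ℤ] M}
    (h : ∀ x, f (of x) = g (of x)) : f = g := by
  ext x; exact h x

/-- The boundary. -/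
def bdry (n : ℕ) : OrdChain Y (n + 1) →ₗ[ℤ] OrdChain Y n := lift (faceSum n of)

lemma bdry_of {n : ℕ} (x : Fin (n + 1) → Y) : bdry n (of x) = faceSum n of x := lift_of _ _

lemma lift_bdry {n : ℕ} {M : Type*} [AddCommGroup M] (F : (Fin n → Y) → M)
    (z : OrdChain Y (n + 1)) : lift F (bdry n z) = lift (faceSum n F) z := by
  revert z
  refine LinearMap.congr_fun (f := lift F ∘ₗ bdry n) (hom_ext fun x => ?_)
  rw [LinearMap.comp_apply, bdry_of, map_faceSum, lift_of]
  simp only [lift_of]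

lemma bdry_bdry {n : ℕ} (z : OrdChain Y (n + 2)) : bdry n (bdry (n + 1) z) = 0 := by
  rw [bdry, lift_bdry, faceSum_faceSum]
  exact Finsupp.linearCombination_zero_apply ℤ z

/-- The map induced by a map of vertices. -/
def map (f : Y → Y') (n : ℕ) : OrdChain Y n →ₗ[ℤ] OrdChain Y' n := lift fun x => of (f ∘ x)

@[simp] lemma map_of (f : Y → Y') {n : ℕ} (x : Fin n → Y) : map f n (of x) = of (f ∘ x) :=
  lift_of _ _

lemma map_bdry (f : Y → Y') {n : ℕ} (z : OrdChain Y (n + 1)) :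
    map f n (bdry n z) = bdry n (map f (n + 1) z) := by
  rw [map, lift_bdry]
  revert z
  refine LinearMap.congr_fun (g := bdry n ∘ₗ map f (n + 1)) (hom_ext fun x => ?_)
  rw [lift_of, LinearMap.comp_apply, map_of, bdry_of]
  rfl

lemma map_map (g : Y' → Y'') (f : Y → Y') {n : ℕ} (z : OrdChain Y n) :
    map g n (map f n z) = map (g ∘ f) n z := by
  revert z
  refine LinearMap.congr_fun (f := map g n ∘ₗ map f n) (hom_ext fun x => ?_)
  simp [Function.comp_assoc]

/-- The cone with a given apex. -/
def cone (a : Y) (n : ℕ) : OrdChain Y n →ₗ[ℤ] OrdChain Y (n + 1) :=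
  lift fun x => of (Fin.cons a x)

@[simp] lemma cone_of (a : Y) {n : ℕ} (x : Fin n → Y) : cone a n (of x) = of (Fin.cons a x) :=
  lift_of _ _

lemma bdry_cone (a : Y) {n : ℕ} (z : OrdChain Y (n + 1)) :
    bdry (n + 1) (cone a (n + 1) z) = z - cone a n (bdry n z) := by
  revert z
  refine LinearMap.congr_fun (f := bdry (n + 1) ∘ₗ cone a (n + 1))
    (g := LinearMap.id - cone a n ∘ₗ bdry n) (hom_ext fun x => ?_)
  simp only [LinearMap.comp_apply, LinearMap.sub_apply, LinearMap.id_apply, cone_of, bdry_of,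
    faceSum_cons, map_faceSum]

lemma bdry_cone_zero (a : Y) (z : OrdChain Y 0) : bdry 0 (cone a 0 z) = z := by
  revert z
  refine LinearMap.congr_fun (f := bdry 0 ∘ₗ cone a 0) (g := LinearMap.id) (hom_ext fun x => ?_)
  simp only [LinearMap.comp_apply, LinearMap.id_apply, cone_of, bdry_of, faceSum_cons_zero]

lemma map_cone (f : Y → Y') (a : Y) {n : ℕ} (z : OrdChain Y n) :
    map f (n + 1) (cone a n z) = cone (f a) n (map f n z) := by
  revert z
  refine LinearMap.congr_fun (f := map f (n + 1) ∘ₗ cone a n) (g := cone (f a) n ∘ₗ map f n)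
    (hom_ext fun x => ?_)
  simp only [LinearMap.comp_apply, cone_of, map_of]
  congr 1
  ext i
  cases i using Fin.cases <;> simp

/-- The prism operator of two maps. -/
def prism (f g : Y → Y') : (n : ℕ) → OrdChain Y n →ₗ[ℤ] OrdChain Y' (n + 1)
  | 0 => 0
  | n + 1 => lift fun x => of (Fin.cons (f (x 0)) (g ∘ x)) -
      cone (f (x 0)) (n + 1) (prism f g n (of (Fin.tail x)))

lemma prism_cone (f g : Y → Y') {n : ℕ} (a : Y) (z : OrdChain Y n) :
    prism f g (n + 1) (cone a n z) = cone (f a) (n + 1) (cone (g a) n (map g n z)) -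
      cone (f a) (n + 1) (prism f g n z) := by
  revert z
  refine LinearMap.congr_fun (f := prism f g (n + 1) ∘ₗ cone a n)
    (g := cone (f a) (n + 1) ∘ₗ cone (g a) n ∘ₗ map g n - cone (f a) (n + 1) ∘ₗ prism f g n)
    (hom_ext fun x => ?_)
  simp only [LinearMap.comp_apply, LinearMap.sub_apply, cone_of, map_of]
  rw [prism, lift_of]
  congr 2
  simp only [Fin.cons_zero]
  congr 1
  ext i
  cases i using Fin.cases <;> simp

/-- A tuple is the cone over its tail, and both the boundary and the prism of a cone reduce to the
tail. The induction starts at the empty tuple, whose prism is zero. -/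
lemma bdry_prism (f g : Y → Y') : ∀ {n : ℕ} (z : OrdChain Y (n + 1)),
    bdry (n + 1) (prism f g (n + 1) z) = map g (n + 1) z - map f (n + 1) z -
      prism f g n (bdry n z)
  | 0, z => by
    revert z
    refine LinearMap.congr_fun (f := bdry 1 ∘ₗ prism f g 1)
      (g := map g 1 - map f 1 - prism f g 0 ∘ₗ bdry 0) (hom_ext fun x => ?_)
    obtain ⟨a, y, rfl⟩ := exists_eq_cons x
    simp only [LinearMap.comp_apply, LinearMap.sub_apply]
    rw [← cone_of, prism_cone, map_cone, map_cone]
    simp only [prism, LinearMap.zero_apply, map_zero, sub_zero]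
    rw [bdry_cone, bdry_cone_zero]
    simp only [map_of, sub_right_inj]
    congr 2
    exact Subsingleton.elim _ _
  | n + 1, z => by
    revert z
    refine LinearMap.congr_fun (f := bdry (n + 2) ∘ₗ prism f g (n + 2))
      (g := map g (n + 2) - map f (n + 2) - prism f g (n + 1) ∘ₗ bdry (n + 1))
      (hom_ext fun x => ?_)
    obtain ⟨a, y, rfl⟩ := exists_eq_cons x
    simp only [LinearMap.comp_apply, LinearMap.sub_apply]
    rw [← cone_of, prism_cone, map_cone, map_cone]
    simp only [map_sub, bdry_cone, prism_cone, bdry_prism, map_bdry]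
    abel

/-- The chains all of whose tuples lie in a given set. -/
abbrev inside {n : ℕ} (s : Set (Fin n → Y)) : Submodule ℤ (OrdChain Y n) :=
  Finsupp.supported ℤ ℤ s

lemma of_mem_inside {n : ℕ} {s : Set (Fin n → Y)} {x : Fin n → Y} (h : x ∈ s) :
    of x ∈ inside s := Finsupp.single_mem_supported ℤ 1 h

lemma map_mem_of_inside {n : ℕ} {s : Set (Fin n → Y)} {M : Type*} [AddCommGroup M]
    {f : OrdChain Y n →ₗ[ℤ] M} {N : Submodule ℤ M} (h : ∀ x ∈ s, f (of x) ∈ N)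
    {z : OrdChain Y n} (hz : z ∈ inside s) : f z ∈ N := by
  rw [inside, Finsupp.supported_eq_span_single] at hz
  have : Submodule.span ℤ ((fun i => Finsupp.single i (1 : ℤ)) '' s) ≤ N.comap f := by
    rw [Submodule.span_le]
    rintro _ ⟨x, hx, rfl⟩
    exact h x hx
  exact this hz

lemma eqOn_inside {n : ℕ} {s : Set (Fin n → Y)} {M : Type*} [AddCommGroup M]
    {f g : OrdChain Y n →ₗ[ℤ] M} (h : ∀ x ∈ s, f (of x) = g (of x))
    {z : OrdChain Y n} (hz : z ∈ inside s) : f z = g z := by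
  have := map_mem_of_inside (f := f - g) (N := ⊥) (fun x hx => by simp [h x hx]) hz
  simpa [sub_eq_zero] using this

lemma faceSum_mem {n : ℕ} {M : Type*} [AddCommGroup M] {F : (Fin n → Y) → M}
    {N : Submodule ℤ M} {x : Fin (n + 1) → Y} (h : ∀ j : Fin (n + 1), F (x ∘ j.succAbove) ∈ N) :
    faceSum n F x ∈ N :=
  show ∑ j : Fin (n + 1), ((-1 : ℤ) ^ (j : ℕ)) • F (x ∘ j.succAbove) ∈ N from
    N.sum_mem fun j _ => N.smul_mem _ (h j)

lemma bdry_mem_inside {n : ℕ} {s : Set (Fin (n + 1) → Y)} {t : Set (Fin n → Y)}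
    (h : ∀ x ∈ s, ∀ j : Fin (n + 1), x ∘ j.succAbove ∈ t) {z : OrdChain Y (n + 1)}
    (hz : z ∈ inside s) : bdry n z ∈ inside t :=
  map_mem_of_inside (fun x hx => by
    rw [bdry_of]; exact faceSum_mem fun j => of_mem_inside (h x hx j)) hz

lemma map_mem_inside {n : ℕ} {f : Y → Y'} {s : Set (Fin n → Y)} {t : Set (Fin n → Y')}
    (h : ∀ x ∈ s, f ∘ x ∈ t) {z : OrdChain Y n} (hz : z ∈ inside s) : map f n z ∈ inside t :=
  map_mem_of_inside (fun x hx => by rw [map_of]; exact of_mem_inside (h x hx)) hz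

lemma cone_mem_inside {n : ℕ} {a : Y} {s : Set (Fin n → Y)} {t : Set (Fin (n + 1) → Y)}
    (h : ∀ x ∈ s, (Fin.cons a x : Fin (n + 1) → Y) ∈ t) {z : OrdChain Y n} (hz : z ∈ inside s) :
    cone a n z ∈ inside t :=
  map_mem_of_inside (fun x hx => by rw [cone_of]; exact of_mem_inside (h x hx)) hz

/-- This control of the vertices lets smallness of a prism be checked on pairs of points. -/
lemma prism_of_mem (f g : Y → Y') : ∀ {n : ℕ} (x : Fin n → Y),
    prism f g n (of x) ∈ inside {y | ∀ i, ∃ l, y i = f (x l) ∨ y i = g (x l)}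
  | 0, x => by simp [prism]
  | n + 1, x => by
    rw [prism, lift_of]
    refine Submodule.sub_mem _ (of_mem_inside fun i => ?_) (cone_mem_inside ?_ (prism_of_mem f g _))
    · cases i using Fin.cases with
      | zero => exact ⟨0, Or.inl rfl⟩
      | succ i => exact ⟨i, Or.inr rfl⟩
    · intro y hy i
      cases i using Fin.cases with
      | zero => exact ⟨0, Or.inl rfl⟩
      | succ i =>
        obtain ⟨l, hl⟩ := hy i
        exact ⟨l.succ, hl⟩

end OrdChain

end OrderedChains

/-! ### Small chains in simplices -/

namespace stdSimplex

variable {X Y : Type*} [Fintype X] [Fintype Y]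

lemma map_apply_sum [DecidableEq Y] (f : X → Y) (s : stdSimplex ℝ X) (y : Y) :
    map f s y = ∑ x with f x = y, s x := by
  rw [map_coe, FunOnFinite.linearMap_apply_apply]

lemma map_apply_of_injective {f : X → Y} (hf : Function.Injective f) (s : stdSimplex ℝ X) (x : X) :
    map f s (f x) = s x := by
  classical
  rw [map_apply_sum, Finset.sum_eq_single x]
  · intro b hb hbx
    exact (hbx (hf (Finset.mem_filter.1 hb).2)).elim
  · simp

lemma map_apply_of_notMem_range {f : X → Y} (s : stdSimplex ℝ X) {y : Y} (hy : y ∉ Set.range f) :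
    map f s y = 0 := by
  classical
  rw [map_apply_sum]
  refine Finset.sum_eq_zero fun x hx => (hy ⟨x, (Finset.mem_filter.1 hx).2⟩).elim

lemma dist_map_le {f : X → Y} (hf : Function.Injective f) (s t : stdSimplex ℝ X) :
    dist (map f s) (map f t) ≤ dist s t := by
  change dist (map f s).1 (map f t).1 ≤ _
  rw [dist_pi_le_iff dist_nonneg]
  intro y
  change dist (map f s y) (map f t y) ≤ _
  by_cases hy : y ∈ Set.range f
  · obtain ⟨x, rfl⟩ := hy
    rw [map_apply_of_injective hf, map_apply_of_injective hf]
    exact dist_le_pi_dist s.1 t.1 x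
  · rw [map_apply_of_notMem_range s hy, map_apply_of_notMem_range t hy, dist_self]
    exact dist_nonneg

/-- The point dividing the segment from `s` to `t` in the ratio `c : 1 - c`. -/
def segmentPoint (t : stdSimplex ℝ X) (c : unitInterval) (s : stdSimplex ℝ X) : stdSimplex ℝ X :=
  ⟨(1 - c.1) • s.1 + c.1 • t.1, convex_stdSimplex ℝ X s.2 t.2 (sub_nonneg.2 c.2.2) c.2.1 (by ring)⟩

lemma segmentPoint_zero (t : stdSimplex ℝ X) : segmentPoint t 0 = id := by
  ext s x; simp [segmentPoint]

lemma segmentPoint_one (t s : stdSimplex ℝ X) : segmentPoint t 1 s = t := by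
  apply Subtype.ext
  simp [segmentPoint]

lemma dist_segmentPoint_le (t : stdSimplex ℝ X) (c : unitInterval) (s s' : stdSimplex ℝ X) :
    dist (segmentPoint t c s) (segmentPoint t c s') ≤ dist s s' := by
  change dist ((1 - c.1) • s.1 + c.1 • t.1) ((1 - c.1) • s'.1 + c.1 • t.1) ≤ dist s.1 s'.1
  rw [dist_add_right, dist_smul₀, Real.norm_of_nonneg (sub_nonneg.2 c.2.2)]
  nlinarith [dist_nonneg (x := s.1) (y := s'.1), c.2.1]

lemma dist_le_one (s t : stdSimplex ℝ X) : dist s t ≤ 1 :=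
  (Metric.dist_le_diam_of_mem (bounded_stdSimplex X) s.2 t.2).trans (diam_stdSimplex_le)

lemma dist_segmentPoint_param (t : stdSimplex ℝ X) (c c' : unitInterval) (s : stdSimplex ℝ X) :
    dist (segmentPoint t c s) (segmentPoint t c' s) ≤ |c.1 - c'.1| := by
  change dist ((1 - c.1) • s.1 + c.1 • t.1) ((1 - c'.1) • s.1 + c'.1 • t.1) ≤ _
  have : ((1 - c.1) • s.1 + c.1 • t.1) - ((1 - c'.1) • s.1 + c'.1 • t.1) =
      (c.1 - c'.1) • (t.1 - s.1) := by module
  rw [dist_eq_norm, this, norm_smul, Real.norm_eq_abs, ← dist_eq_norm]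
  exact mul_le_of_le_one_right (abs_nonneg _) (dist_le_one t s)

end stdSimplex

namespace OrdChain

/-- Tuples of points whose mutual distances are less than `ε`. -/
def smallTuples (Y : Type*) [PseudoMetricSpace Y] (n : ℕ) (ε : ℝ) : Set (Fin n → Y) :=
  {x | ∀ i j, dist (x i) (x j) < ε}

/-- Cycles (in degree `-1`, where there is no boundary, all chains are cycles). -/
def IsCycle {Y : Type*} : {n : ℕ} → OrdChain Y n → Prop
  | 0, _ => True
  | n + 1, z => bdry n z = 0

/-- The point `j / m` of the unit interval (or `1` if `m ≤ j`). -/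
def gridPoint (m j : ℕ) : unitInterval :=
  ⟨min (j / m : ℝ) 1, le_min (by positivity) zero_le_one, min_le_right _ _⟩

lemma gridPoint_zero (m : ℕ) : gridPoint m 0 = 0 := Subtype.ext (by simp [gridPoint])

lemma gridPoint_self {m : ℕ} (hm : m ≠ 0) : gridPoint m m = 1 := by
  have : (m : ℝ) ≠ 0 := by exact_mod_cast hm
  exact Subtype.ext (by simp [gridPoint, this])

lemma abs_gridPoint_sub_le (m j : ℕ) :
    |(gridPoint m (j + 1)).1 - (gridPoint m j).1| ≤ 1 / m := by
  refine (abs_min_sub_min_le_max _ _ _ _).trans ?_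
  have : ((j + 1 : ℕ) / m : ℝ) - j / m = 1 / m := by push_cast; ring
  rw [this, sub_self, abs_zero, abs_of_nonneg (by positivity)]
  exact max_le le_rfl (by positivity)

/-- In a simplex, cycles of small tuples are boundaries of chains of small tuples. -/
lemma exists_bdry_eq_of_small {X : Type*} [Fintype X] [Nonempty X] {ε : ℝ} (hε : 0 < ε) :
    ∀ {n : ℕ} {z : OrdChain (stdSimplex ℝ X) n}
      (_ : z ∈ inside (smallTuples (stdSimplex ℝ X) n ε))
      (_ : IsCycle z),
      ∃ w ∈ inside (smallTuples (stdSimplex ℝ X) (n + 1) ε), bdry n w = z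
  | 0, z, _, _ => by
    let y₀ : stdSimplex ℝ X := Classical.arbitrary _
    refine ⟨cone y₀ 0 z, cone_mem_inside (s := Set.univ) (fun x _ i j => ?_) (by simp),
      bdry_cone_zero y₀ z⟩
    rw [Subsingleton.elim (α := Fin 1) i j, dist_self]
    exact hε
  | n + 1, z, hz, hcyc => by
    change bdry n z = 0 at hcyc
    let y₀ : stdSimplex ℝ X := Classical.arbitrary _
    -- Only finitely many tuples occur in `z`, so one step size `1 / m` fits into the slack left by
    -- all the strict inequalities.
    have hev : ∀ᶠ m : ℕ in Filter.atTop, ∀ x ∈ z.support, ∀ i j,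
        dist (x i) (x j) + 1 / m < ε := by
      rw [Filter.eventually_all_finset]
      intro x hx
      rw [Filter.eventually_all]
      intro i
      rw [Filter.eventually_all]
      intro j
      have h1 : dist (x i) (x j) + 0 < ε := by
        rw [add_zero]
        exact hz hx i j
      exact (tendsto_const_nhds.add tendsto_one_div_atTop_nhds_zero_nat).eventually_lt_const h1
    obtain ⟨m, hm, hm0⟩ := (hev.and (Filter.eventually_ne_atTop 0)).exists
    let h : ℕ → stdSimplex ℝ X → stdSimplex ℝ X := fun j => stdSimplex.segmentPoint y₀ (gridPoint m j)
    have hzs : z ∈ inside (z.support : Set (Fin (n + 1) → stdSimplex ℝ X)) :=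
      Finsupp.mem_supported ℤ z |>.2 subset_rfl
    have hstep : ∀ j s, dist (h j s) (h (j + 1) s) ≤ 1 / m := fun j s => by
      refine (stdSimplex.dist_segmentPoint_param _ _ _ _).trans ?_
      rw [abs_sub_comm]
      exact abs_gridPoint_sub_le m j
    have hcon : ∀ j s s', dist (h j s) (h j s') ≤ dist s s' := fun j s s' =>
      stdSimplex.dist_segmentPoint_le _ _ _ _
    have hm1 : (0 : ℝ) ≤ 1 / m := by positivity
    have hP : ∀ j, prism (h j) (h (j + 1)) (n + 1) z ∈
        inside (smallTuples (stdSimplex ℝ X) (n + 2) ε) := by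
      intro j
      refine map_mem_of_inside (fun x hx => ?_) hzs
      refine Finsupp.supported_mono (fun y hy => ?_) (prism_of_mem (h j) (h (j + 1)) x)
      intro a b
      obtain ⟨l, hl⟩ := hy a
      obtain ⟨l', hl'⟩ := hy b
      have hd := hm x hx l l'
      rcases hl with hl | hl <;> rcases hl' with hl' | hl' <;> rw [hl, hl']
      · linarith [hcon j (x l) (x l')]
      · linarith [dist_triangle (h j (x l)) (h j (x l')) (h (j + 1) (x l')), hstep j (x l'),
          hcon j (x l) (x l')]
      · linarith [dist_triangle (h (j + 1) (x l)) (h j (x l)) (h j (x l')), hstep j (x l),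
          hcon j (x l) (x l'), dist_comm (h (j + 1) (x l)) (h j (x l))]
      · linarith [hcon (j + 1) (x l) (x l')]
    -- The straight-line contraction to `y₀` is cut into `m` short stages; since `z` is a cycle, the
    -- boundaries of the prisms telescope.
    have hsum : bdry (n + 1) (∑ j ∈ Finset.range m, prism (h j) (h (j + 1)) (n + 1) z) =
        map (h m) (n + 1) z - z := by
      rw [map_sum]
      simp only [bdry_prism, hcyc, map_zero, sub_zero]
      rw [Finset.sum_range_sub (fun j => map (h j) (n + 1) z)]
      have : h 0 = id := by
        simp only [h, gridPoint_zero]; exact stdSimplex.segmentPoint_zero _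
      have hid : map (id : stdSimplex ℝ X → stdSimplex ℝ X) (n + 1) = LinearMap.id :=
        hom_ext fun x => by simp
      rw [this, hid, LinearMap.id_apply]
    -- At the end of the contraction all points are equal to `y₀`, so the cone with apex `y₀` is
    -- small for trivial reasons.
    refine ⟨cone y₀ (n + 1) (map (h m) (n + 1) z) -
      ∑ j ∈ Finset.range m, prism (h j) (h (j + 1)) (n + 1) z,
      Submodule.sub_mem _ ?_ (Submodule.sum_mem _ fun j _ => hP j), ?_⟩
    · have hc : ∀ s, h m s = y₀ := fun s => by
        simp only [h, gridPoint_self hm0]; exact stdSimplex.segmentPoint_one _ _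
      refine cone_mem_inside (s := {x | ∀ i, x i = y₀}) (fun x hx => ?_)
        (map_mem_inside (f := h m) (t := {x | ∀ i, x i = y₀}) (fun x _ i => hc (x i)) hz)
      have : ∀ i, (Fin.cons y₀ x : Fin (n + 2) → stdSimplex ℝ X) i = y₀ := fun i => by
        cases i using Fin.cases with
        | zero => rfl
        | succ i => exact hx i
      intro i j
      rw [this, this, dist_self]
      exact hε
    · rw [map_sub, hsum, bdry_cone, ← map_bdry, hcyc]
      simp

lemma faceSum_map_map {X Y Z : Type*} [Fintype X] [Fintype Y] [Fintype Z] {n : ℕ} (g : Y → Z)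
    (f : X → Y) (z : OrdChain (stdSimplex ℝ X) n) :
    map (stdSimplex.map g) n (map (stdSimplex.map f) n z) = map (stdSimplex.map (g ∘ f)) n z := by
  rw [map_map]
  congr 2
  funext s
  exact stdSimplex.map_comp_apply f g s

/-- The alternating sum of the images of a chain in the faces of a simplex. -/
def simplexFaces (n : ℕ) (T : OrdChain (stdSimplex ℝ (Fin n)) n) :
    OrdChain (stdSimplex ℝ (Fin (n + 1))) n :=
  faceSum n (fun y => map (stdSimplex.map y) n T) id

/-- Chains of small tuples which represent the fundamental classes of the standard simplices. -/
lemma exists_fundamental_chains {ε : ℝ} (hε : 0 < ε) :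
    ∃ T : ∀ n, OrdChain (stdSimplex ℝ (Fin n)) n, T 0 = of (fun i => i.elim0) ∧
      (∀ n, T n ∈ inside (smallTuples _ n ε)) ∧
      ∀ n, bdry n (T (n + 1)) = simplexFaces n (T n) := by
  -- The recursion carries the cycle condition on the faces, since this is what makes the next
  -- filling possible.
  let R : ∀ n, OrdChain (stdSimplex ℝ (Fin n)) n → Prop := fun n T =>
    T ∈ inside (smallTuples _ n ε) ∧ IsCycle (simplexFaces n T)
  have hstep : ∀ n (T : OrdChain (stdSimplex ℝ (Fin n)) n), R n T →
      ∃ T' : OrdChain (stdSimplex ℝ (Fin (n + 1))) (n + 1), R (n + 1) T' ∧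
        bdry n T' = simplexFaces n T := by
    intro n T hT
    have hsm : simplexFaces n T ∈ inside (smallTuples (stdSimplex ℝ (Fin (n + 1))) n ε) := by
      refine faceSum_mem fun j => map_mem_inside (fun x hx a b => ?_) hT.1
      refine (stdSimplex.dist_map_le ?_ _ _).trans_lt (hx a b)
      exact (Fin.succAbove_right_injective (p := j))
    obtain ⟨T', hT', hb⟩ := exists_bdry_eq_of_small hε hsm hT.2
    refine ⟨T', ⟨hT', ?_⟩, hb⟩
    change bdry n (simplexFaces (n + 1) T') = 0
    rw [simplexFaces, map_faceSum]
    simp only [← map_bdry, hb]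
    simp only [simplexFaces, map_faceSum, faceSum_map_map]
    -- The images of `T` in the faces form a function on tuples of vertices of the simplex, so the
    -- claim is an instance of `faceSum_faceSum`.
    have h1 : ∀ y : Fin (n + 1) → Fin (n + 2),
        faceSum n (fun x => map (stdSimplex.map (y ∘ x)) n T) id =
          faceSum n (fun x => map (stdSimplex.map x) n T) y := fun y => by
      rw [faceSum_comp_tuple (fun x => map (stdSimplex.map x) n T) y]
      rfl
    simp only [h1]
    exact congrFun (faceSum_faceSum _) _
  have h0 : R 0 (of fun i => i.elim0) :=
    ⟨of_mem_inside fun i => i.elim0, trivial⟩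
  choose! next hnext using hstep
  let T : ∀ n, {T : OrdChain (stdSimplex ℝ (Fin n)) n // R n T} := fun n =>
    Nat.rec ⟨_, h0⟩ (fun n T => ⟨next n T.1, (hnext n T.1 T.2).1⟩) n
  exact ⟨fun n => (T n).1, rfl, fun n => (T n).2.1, fun n => (hnext n _ (T n).2).2⟩

end OrdChain

/-! ### Filling simplices -/

namespace SimplexFilling

open stdSimplex

/-! ### Polar coordinates on a simplex, centred at the barycenter. -/

section Radial

variable {n : ℕ}

/-- An isomorphism of Euclidean space with the hyperplane of vectors of coordinate sum zero. -/
def hyperplaneVector (u : EuclideanSpace ℝ (Fin n)) : Fin (n + 1) → ℝ :=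
  Fin.cons (-∑ i, u i) (fun i => u i)

lemma hyperplaneVector_sum (u : EuclideanSpace ℝ (Fin n)) : ∑ j, hyperplaneVector u j = 0 := by
  simp [hyperplaneVector, Fin.sum_univ_succ]

lemma hyperplaneVector_succ (u : EuclideanSpace ℝ (Fin n)) (i : Fin n) :
    hyperplaneVector u i.succ = u i := rfl

lemma hyperplaneVector_smul (r : ℝ) (u : EuclideanSpace ℝ (Fin n)) :
    hyperplaneVector (r • u) = r • hyperplaneVector u := by
  ext j
  cases j using Fin.cases <;> simp [hyperplaneVector, Finset.mul_sum]

lemma continuous_hyperplaneVector (j : Fin (n + 1)) :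
    Continuous fun u : EuclideanSpace ℝ (Fin n) => hyperplaneVector u j := by
  cases j using Fin.cases <;> simp only [hyperplaneVector, Fin.cons_zero, Fin.cons_succ] <;> fun_prop

/-- The gauge of the simplex, with the barycenter as origin. -/
def simplexGauge (u : EuclideanSpace ℝ (Fin n)) : ℝ :=
  Finset.univ.sup' Finset.univ_nonempty fun j => -hyperplaneVector u j

lemma neg_le_simplexGauge (u : EuclideanSpace ℝ (Fin n)) (j : Fin (n + 1)) :
    -hyperplaneVector u j ≤ simplexGauge u :=
  Finset.le_sup' (fun j => -hyperplaneVector u j) (Finset.mem_univ j)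

lemma exists_simplexGauge_eq (u : EuclideanSpace ℝ (Fin n)) :
    ∃ j, simplexGauge u = -hyperplaneVector u j := by
  obtain ⟨j, -, hj⟩ := Finset.exists_mem_eq_sup' Finset.univ_nonempty
    fun j => -hyperplaneVector u j
  exact ⟨j, hj⟩

lemma continuous_simplexGauge : Continuous (simplexGauge (n := n)) :=
  Continuous.finset_sup'_apply _ fun j _ => (continuous_hyperplaneVector j).neg

lemma simplexGauge_pos {u : EuclideanSpace ℝ (Fin n)} (hu : u ≠ 0) : 0 < simplexGauge u := by
  by_contra h
  have h0 : ∀ j, 0 ≤ hyperplaneVector u j := fun j => by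
    linarith [neg_le_simplexGauge u j, not_lt.1 h]
  have h1 := (Finset.sum_eq_zero_iff_of_nonneg fun j _ => h0 j).1 (hyperplaneVector_sum u)
  apply hu
  ext i
  exact h1 i.succ (Finset.mem_univ _)

lemma simplexGauge_smul {r : ℝ} (hr : 0 ≤ r) (u : EuclideanSpace ℝ (Fin n)) :
    simplexGauge (r • u) = r * simplexGauge u := by
  apply le_antisymm
  · refine Finset.sup'_le _ _ fun j _ => ?_
    rw [hyperplaneVector_smul, Pi.smul_apply, smul_eq_mul, ← mul_neg]
    exact mul_le_mul_of_nonneg_left (neg_le_simplexGauge u j) hr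
  · obtain ⟨j, hj⟩ := exists_simplexGauge_eq u
    rw [hj, mul_neg, ← smul_eq_mul, ← Pi.smul_apply, ← hyperplaneVector_smul]
    exact neg_le_simplexGauge _ j

/-- The coordinates of the barycenter. -/
def baryCoord (n : ℕ) : ℝ := ((n : ℝ) + 1)⁻¹

lemma baryCoord_pos (n : ℕ) : 0 < baryCoord n := by unfold baryCoord; positivity

lemma sphere_ne_zero (u : Metric.sphere (0 : EuclideanSpace ℝ (Fin n)) 1) :
    (u : EuclideanSpace ℝ (Fin n)) ≠ 0 := ne_zero_of_mem_unit_sphere u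

/-- Polar coordinates on the simplex; `s = 0` gives the boundary and `s = 1` the barycenter. -/
def polar (p : unitInterval × Metric.sphere (0 : EuclideanSpace ℝ (Fin n)) 1) :
    stdSimplex ℝ (Fin (n + 1)) :=
  ⟨fun j => baryCoord n + (1 - p.1.1) * baryCoord n *
      (hyperplaneVector p.2.1 j / simplexGauge p.2.1), by
    constructor
    · intro j
      have h1 : -1 ≤ hyperplaneVector p.2.1 j / simplexGauge p.2.1 := by
        rw [le_div_iff₀ (simplexGauge_pos (sphere_ne_zero p.2))]
        linarith [neg_le_simplexGauge p.2.1 j]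
      have h2 : 0 ≤ (1 - p.1.1) * baryCoord n :=
        mul_nonneg (sub_nonneg.2 p.1.2.2) (baryCoord_pos n).le
      nlinarith [mul_nonneg p.1.2.1 (baryCoord_pos n).le]
    · rw [Finset.sum_add_distrib, ← Finset.mul_sum, ← Finset.sum_div, hyperplaneVector_sum]
      simp only [Finset.sum_const, Finset.card_univ, Fintype.card_fin, nsmul_eq_mul, zero_div,
        mul_zero, add_zero, baryCoord]
      push_cast
      field_simp⟩

lemma polar_apply (p : unitInterval × Metric.sphere (0 : EuclideanSpace ℝ (Fin n)) 1)
    (j : Fin (n + 1)) : polar p j = baryCoord n + (1 - p.1.1) * baryCoord n *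
      (hyperplaneVector p.2.1 j / simplexGauge p.2.1) := rfl

lemma continuous_polar : Continuous (polar (n := n)) := by
  refine Continuous.subtype_mk (continuous_pi fun j => ?_) _
  refine continuous_const.add (Continuous.mul (by fun_prop) ?_)
  refine Continuous.div ((continuous_hyperplaneVector j).comp (by fun_prop))
    (continuous_simplexGauge.comp (by fun_prop)) fun p => ?_
  exact (simplexGauge_pos (sphere_ne_zero p.2)).ne'

lemma exists_polar_eq_zero (u : Metric.sphere (0 : EuclideanSpace ℝ (Fin n)) 1) :
    ∃ j, polar (0, u) j = 0 := by
  obtain ⟨j, hj⟩ := exists_simplexGauge_eq u.1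
  refine ⟨j, ?_⟩
  have hp := (simplexGauge_pos (sphere_ne_zero u)).ne'
  rw [polar_apply]
  have : hyperplaneVector u.1 j / simplexGauge u.1 = -1 := by
    rw [div_eq_iff hp, hj]; ring
  simp [this]

/-- The coordinates determine the vector `((1 - s) / gauge u) • u`. As `u` is a unit vector, its
norm recovers the factor, and the direction too unless the factor is zero, which is the barycenter.
-/
lemma polar_injective {p q : unitInterval × Metric.sphere (0 : EuclideanSpace ℝ (Fin n)) 1}
    (h : polar p = polar q) : p = q ∨ (p.1 = 1 ∧ q.1 = 1) := by
  have hp := simplexGauge_pos (sphere_ne_zero p.2)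
  have hq := simplexGauge_pos (sphere_ne_zero q.2)
  have hb := baryCoord_pos n
  have h1 : ((1 - p.1.1) / simplexGauge p.2.1) • p.2.1 =
      ((1 - q.1.1) / simplexGauge q.2.1) • q.2.1 := by
    ext i
    have := DFunLike.congr_fun h i.succ
    rw [polar_apply, polar_apply, hyperplaneVector_succ, hyperplaneVector_succ,
      add_right_inj] at this
    have h2 : baryCoord n * ((1 - p.1.1) / simplexGauge p.2.1 * p.2.1 i) =
        baryCoord n * ((1 - q.1.1) / simplexGauge q.2.1 * q.2.1 i) := by
      calc _ = (1 - p.1.1) * baryCoord n * (p.2.1 i / simplexGauge p.2.1) := by ring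
        _ = _ := this
        _ = _ := by ring
    exact mul_left_cancel₀ hb.ne' h2
  have hpn : ‖p.2.1‖ = 1 := by simp
  have hqn : ‖q.2.1‖ = 1 := by simp
  have hp0 : 0 ≤ (1 - p.1.1) / simplexGauge p.2.1 :=
    div_nonneg (sub_nonneg.2 p.1.2.2) hp.le
  have hq0 : 0 ≤ (1 - q.1.1) / simplexGauge q.2.1 :=
    div_nonneg (sub_nonneg.2 q.1.2.2) hq.le
  have h2 : (1 - p.1.1) / simplexGauge p.2.1 = (1 - q.1.1) / simplexGauge q.2.1 := by
    have := congrArg norm h1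
    rwa [norm_smul, norm_smul, hpn, hqn, mul_one, mul_one, Real.norm_of_nonneg hp0,
      Real.norm_of_nonneg hq0] at this
  by_cases h0 : (1 - p.1.1) / simplexGauge p.2.1 = 0
  · right
    have h0' := h2 ▸ h0
    rw [div_eq_zero_iff, or_iff_left hp.ne', sub_eq_zero] at h0
    rw [div_eq_zero_iff, or_iff_left hq.ne', sub_eq_zero] at h0'
    exact ⟨Subtype.ext h0.symm, Subtype.ext h0'.symm⟩
  · left
    rw [← h2] at h1
    have hu : p.2 = q.2 := Subtype.ext (smul_right_injective _ h0 h1)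
    rw [hu, div_left_inj' hq.ne', sub_right_inj] at h2
    exact Prod.ext (Subtype.ext h2) hu

lemma polar_surjective : Function.Surjective (polar (n := n + 1)) := by
  intro t
  have hb := baryCoord_pos (n + 1)
  let u₀ : EuclideanSpace ℝ (Fin (n + 1)) := WithLp.toLp 2 fun i => t i.succ - baryCoord (n + 1)
  have hu₀ : ∀ j, hyperplaneVector u₀ j = t j - baryCoord (n + 1) := by
    intro j
    cases j using Fin.cases with
    | zero =>
      have h1 := stdSimplex.sum_eq_one t
      rw [Fin.sum_univ_succ] at h1
      have h2 : ((n + 1 : ℕ) : ℝ) * baryCoord (n + 1) + baryCoord (n + 1) = 1 := by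
        unfold baryCoord; push_cast; field_simp
      simp only [hyperplaneVector, Fin.cons_zero, u₀, Finset.sum_sub_distrib, Finset.sum_const,
        Finset.card_univ, Fintype.card_fin, nsmul_eq_mul]
      linarith
    | succ i => rfl
  by_cases h0 : u₀ = 0
  -- The barycenter is reached along any direction, but some direction is needed. This is why the
  -- sphere is taken in positive-dimensional space.
  · obtain ⟨u, hu⟩ := NormedSpace.sphere_nonempty (E := EuclideanSpace ℝ (Fin (n + 1)))
      (x := 0) (r := 1) |>.2 zero_le_one
    refine ⟨(1, ⟨u, hu⟩), stdSimplex.ext (funext fun j => ?_)⟩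
    rw [polar_apply]
    have := hu₀ j
    rw [h0] at this
    have h1 : hyperplaneVector (0 : EuclideanSpace ℝ (Fin (n + 1))) j = 0 := by
      cases j using Fin.cases <;> simp [hyperplaneVector]
    rw [h1] at this
    simp only [Set.Icc.coe_one, sub_self, zero_mul]
    linarith
  · have hn : 0 < ‖u₀‖ := norm_pos_iff.2 h0
    have hg := simplexGauge_pos h0
    have hg1 : simplexGauge u₀ ≤ baryCoord (n + 1) := by
      obtain ⟨j, hj⟩ := exists_simplexGauge_eq u₀
      rw [hj, hu₀]
      linarith [stdSimplex.zero_le t j]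
    have hs : simplexGauge u₀ / baryCoord (n + 1) ∈ unitInterval :=
      ⟨by positivity, (div_le_one hb).2 hg1⟩
    -- The gauge of `u₀` equals `baryCoord` exactly on the boundary, so the quotient measures the
    -- distance from the barycenter on the scale where the boundary is 1.
    refine ⟨(⟨1 - simplexGauge u₀ / baryCoord (n + 1), by
        constructor <;> linarith [hs.1, hs.2]⟩, ⟨‖u₀‖⁻¹ • u₀, by
        simp [norm_smul, hn.ne']⟩), stdSimplex.ext (funext fun j => ?_)⟩
    rw [polar_apply, simplexGauge_smul (by positivity), hyperplaneVector_smul, Pi.smul_apply, hu₀]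
    simp only [smul_eq_mul]
    field_simp
    ring

end Radial

/-! ### Extending maps from the boundary of a simplex. -/

variable {X : Type*} [TopologicalSpace X]

lemma exists_map_succAbove_eq {n : ℕ} {j : Fin (n + 1)} {t : stdSimplex ℝ (Fin (n + 1))}
    (h : t j = 0) : ∃ s, map j.succAbove s = t := by
  have hsum := stdSimplex.sum_eq_one t
  rw [Fin.sum_univ_succAbove _ j, h, zero_add] at hsum
  refine ⟨⟨fun i => t (j.succAbove i), fun i => stdSimplex.zero_le t _, hsum⟩,
    stdSimplex.ext (funext fun l => ?_)⟩
  rcases Fin.eq_self_or_eq_succAbove j l with rfl | ⟨i, rfl⟩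
  · rw [map_apply_of_notMem_range _ (by simp), h]
  · rw [map_apply_of_injective Fin.succAbove_right_injective]
    rfl

lemma map_injective {X Y : Type*} [Fintype X] [Fintype Y] {f : X → Y}
    (hf : Function.Injective f) : Function.Injective (map (S := ℝ) f) := fun s t h =>
  stdSimplex.ext (funext fun x => by
    change s x = t x
    rw [← map_apply_of_injective hf, h, map_apply_of_injective hf])

lemma map_succAbove_self {n : ℕ} (j : Fin (n + 1)) (s : stdSimplex ℝ (Fin n)) :
    map j.succAbove s j = 0 := map_apply_of_notMem_range _ (by simp)

/-- Compatible maps of the facets of a simplex agree on the common faces. -/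
lemma facet_compat {m : ℕ} {h : Fin (m + 2) → C(stdSimplex ℝ (Fin (m + 1)), X)}
    (hc : ∀ j i r, h j (map (Fin.succAbove i) r) =
      h (Fin.succAbove j i) (map (Fin.predAbove i j).succAbove r))
    {j l : Fin (m + 2)} {s s' : stdSimplex ℝ (Fin (m + 1))}
    (hs : map j.succAbove s = map l.succAbove s') : h j s = h l s' := by
  rcases Fin.eq_self_or_eq_succAbove j l with rfl | ⟨i, rfl⟩
  · rw [map_injective Fin.succAbove_right_injective hs]
  · have hi : s i = 0 := by
      rw [← map_apply_of_injective Fin.succAbove_right_injective s i, hs, map_succAbove_self]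
    obtain ⟨r, rfl⟩ := exists_map_succAbove_eq hi
    have hcomp : j.succAbove ∘ i.succAbove =
        (j.succAbove i).succAbove ∘ (i.predAbove j).succAbove := by
      ext k
      exact congrArg Fin.val (Fin.succAbove_succAbove_succAbove_predAbove j i k).symm
    rw [map_comp_apply] at hs
    have hs' : s' = map (i.predAbove j).succAbove r := by
      apply map_injective (Fin.succAbove_right_injective (p := j.succAbove i))
      rw [← hs, map_comp_apply]
      exact congrArg (fun f => map f r) hcomp
    rw [hs']
    exact hc j i r

/-- The boundary of a simplex. -/
abbrev BoundaryPoint (n : ℕ) := {t : stdSimplex ℝ (Fin (n + 1)) // ∃ j, t j = 0}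

/-- A compatible family of maps of the facets of a simplex extends to the boundary. -/
lemma exists_boundary_map {n : ℕ} {h : Fin (n + 1) → C(stdSimplex ℝ (Fin n), X)}
    (hc : ∀ j l s s', stdSimplex.map (Fin.succAbove j) s = stdSimplex.map (Fin.succAbove l) s' →
      h j s = h l s') :
    ∃ b : C(BoundaryPoint n, X),
      ∀ j s, b ⟨stdSimplex.map (Fin.succAbove j) s, j, map_succAbove_self _ _⟩ = h j s := by
  have hqc : Continuous fun p : (Σ _ : Fin (n + 1), stdSimplex ℝ (Fin n)) =>
      stdSimplex.map (Fin.succAbove p.1) p.2 := by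
    rw [continuous_sigma_iff]
    exact fun j => continuous_map (S := ℝ) (Fin.succAbove j)
  let q : C((Σ _ : Fin (n + 1), stdSimplex ℝ (Fin n)), BoundaryPoint n) :=
    ⟨fun p => ⟨stdSimplex.map (Fin.succAbove p.1) p.2, p.1, map_succAbove_self _ _⟩,
      hqc.subtype_mk _⟩
  -- A continuous surjection from a compact space to a Hausdorff space is a quotient map.
  have hq : Topology.IsQuotientMap q := by
    refine Topology.IsQuotientMap.of_surjective_continuous ?_ q.continuous
    rintro ⟨t, j, hj⟩
    obtain ⟨s, hs⟩ := exists_map_succAbove_eq hj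
    exact ⟨⟨j, s⟩, Subtype.ext hs⟩
  let k : C((Σ _ : Fin (n + 1), stdSimplex ℝ (Fin n)), X) :=
    ⟨fun p => h p.1 p.2, continuous_sigma fun j => (h j).continuous⟩
  have hk : Function.FactorsThrough k q := by
    rintro ⟨j, s⟩ ⟨j', s'⟩ hp
    exact hc j j' s s' (congrArg Subtype.val hp)
  refine ⟨hq.lift k hk, fun j s => ?_⟩
  have h1 : (hq.lift k hk) (q ⟨j, s⟩) = k ⟨j, s⟩ := by
    rw [← ContinuousMap.comp_apply, hq.lift_comp]
  exact h1

lemma eq_zero_of_polar_eq_zero {n : ℕ}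
    {p : unitInterval × Metric.sphere (0 : EuclideanSpace ℝ (Fin n)) 1} {j : Fin (n + 1)}
    (h0 : polar p j = 0) : p.1 = 0 := by
  rw [polar_apply] at h0
  have hg := simplexGauge_pos (sphere_ne_zero p.2)
  have h1 : -1 ≤ hyperplaneVector p.2.1 j / simplexGauge p.2.1 := by
    rw [le_div_iff₀ hg]
    linarith [neg_le_simplexGauge p.2.1 j]
  have h2 := baryCoord_pos n
  have h3 : 0 ≤ (1 - p.1.1) * baryCoord n := mul_nonneg (sub_nonneg.2 p.1.2.2) h2.le
  have h4 : p.1.1 * baryCoord n ≤ 0 := by nlinarith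
  exact Subtype.ext (le_antisymm (nonpos_of_mul_nonpos_left h4 h2) p.1.2.1)

/-- A map of the boundary of a simplex whose pullback to the sphere is null-homotopic extends to
the simplex. -/
lemma exists_extension_of_nullhomotopic {m : ℕ} (b : C(BoundaryPoint (m + 1), X))
    (hb : (b.comp ⟨fun u => ⟨polar (0, u), exists_polar_eq_zero u⟩,
      Continuous.subtype_mk (continuous_polar.comp (by fun_prop)) _⟩ :
        C(Metric.sphere (0 : EuclideanSpace ℝ (Fin (m + 1))) 1, X)).Nullhomotopic) :
    ∃ H : C(stdSimplex ℝ (Fin (m + 2)), X), ∀ t : BoundaryPoint (m + 1), H t.1 = b t := by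
  obtain ⟨p, ⟨F⟩⟩ := hb
  let pol : C(unitInterval × Metric.sphere (0 : EuclideanSpace ℝ (Fin (m + 1))) 1,
    stdSimplex ℝ (Fin (m + 2))) := ⟨polar, continuous_polar⟩
  have hpol : Topology.IsQuotientMap pol :=
    Topology.IsQuotientMap.of_surjective_continuous polar_surjective pol.continuous
  -- Polar coordinates identify points only at the barycenter, where the null-homotopy has become
  -- constant.
  have hF : Function.FactorsThrough F.toContinuousMap pol := by
    intro a a' ha
    rcases polar_injective ha with rfl | ⟨h1, h2⟩
    · rfl
    · obtain ⟨s, u⟩ := a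
      obtain ⟨s', u'⟩ := a'
      obtain rfl : s = 1 := h1
      obtain rfl : s' = 1 := h2
      exact (F.apply_one u).trans (F.apply_one u').symm
  refine ⟨hpol.lift F.toContinuousMap hF, ?_⟩
  rintro ⟨t, j, hj⟩
  obtain ⟨⟨c, u⟩, rfl⟩ := polar_surjective t
  obtain rfl : c = 0 := eq_zero_of_polar_eq_zero hj
  exact (DFunLike.congr_fun (hpol.lift_comp F.toContinuousMap hF) (0, u)).trans (F.apply_zero u)

/-- A compatible family of maps of the facets of a simplex extends to the simplex, provided that
maps of the sphere of the right dimension are null-homotopic. -/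
lemma exists_extension {n : ℕ} [Nonempty X]
    (hX : ∀ m, n = m + 1 →
      ∀ f : C(Metric.sphere (0 : EuclideanSpace ℝ (Fin (m + 1))) 1, X), f.Nullhomotopic)
    {h : Fin (n + 1) → C(stdSimplex ℝ (Fin n), X)}
    (hc : ∀ j l s s', stdSimplex.map (Fin.succAbove j) s = stdSimplex.map (Fin.succAbove l) s' →
      h j s = h l s') :
    ∃ H : C(stdSimplex ℝ (Fin (n + 1)), X), ∀ j s, H (stdSimplex.map (Fin.succAbove j) s) = h j s := by
  match n with
  | 0 =>
    refine ⟨ContinuousMap.const _ (Classical.arbitrary X), fun j s => ?_⟩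
    -- The facets of a point are empty: no coordinates can sum to one.
    have := stdSimplex.sum_eq_one s
    simp at this
  | m + 1 =>
    obtain ⟨b, hb⟩ := exists_boundary_map hc
    obtain ⟨H, hH⟩ := exists_extension_of_nullhomotopic b (hX m rfl _)
    exact ⟨H, fun j s => (hH ⟨_, j, map_succAbove_self _ _⟩).trans (hb j s)⟩

end SimplexFilling

/-! ### Vanishing of the homology of highly connected simplicial complexes -/

namespace PreAbstractSimplicialComplex

variable {W : Type w} (K : PreAbstractSimplicialComplex W)

/-- The tuples of vertices (possibly with repetitions) of simplices of `K`. -/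
def tuples (n : ℕ) : Set (Fin n → W) := {x | ∃ σ ∈ K.faces, ∀ i, x i ∈ σ}

variable {K}

lemma comp_mem_tuples {m n : ℕ} {x : Fin n → W} (hx : x ∈ K.tuples n) (y : Fin m → Fin n) :
    x ∘ y ∈ K.tuples m := by
  obtain ⟨σ, hσ, h⟩ := hx
  exact ⟨σ, hσ, fun i => h _⟩

/-- The restriction of a tuple of vertices. -/
def tupleComp {m n : ℕ} (x : K.tuples n) (y : Fin m → Fin n) : K.tuples m :=
  ⟨x.1 ∘ y, comp_mem_tuples x.2 y⟩

lemma continuous_simplexInclusion (σ : K.faces) : Continuous (K.simplexInclusion σ) := by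
  rw [continuous_iff_coinduced_le]
  exact le_iSup (fun σ : K.faces =>
    TopologicalSpace.coinduced (K.simplexInclusion σ) inferInstance) σ

lemma continuous_of_simplices {Z : Type*} [TopologicalSpace Z] {f : K.Realization → Z}
    (h : ∀ σ, Continuous (f ∘ K.simplexInclusion σ)) : Continuous f := by
  rw [continuous_iSup_dom]
  intro σ
  rw [continuous_coinduced_dom]
  exact h σ

/-- The affine singular simplex with given vertices. -/
def affineSimplex {n : ℕ} (x : K.tuples n) : C(stdSimplex ℝ (Fin n), K.Realization) where
  toFun t := K.simplexInclusion ⟨x.2.choose, x.2.choose_spec.1⟩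
    (stdSimplex.map (fun i => ⟨x.1 i, x.2.choose_spec.2 i⟩) t)
  continuous_toFun := (continuous_simplexInclusion _).comp (stdSimplex.continuous_map _)

open Classical in
lemma affineSimplex_apply {n : ℕ} (x : K.tuples n) (t : stdSimplex ℝ (Fin n)) (v : W) :
    (affineSimplex x t).1 v = ∑ i with x.1 i = v, t i := by
  change (if h : v ∈ x.2.choose then _ else _) = _
  split_ifs with h
  · refine (stdSimplex.map_apply_sum _ t _).trans ?_
    refine Finset.sum_congr ?_ fun _ _ => rfl
    ext i
    simp
  · refine (Finset.sum_eq_zero fun i hi => ?_).symm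
    exact (h ((Finset.mem_filter.1 hi).2 ▸ x.2.choose_spec.2 i)).elim

lemma affineSimplex_map {m n : ℕ} (x : K.tuples n) (y : Fin m → Fin n)
    (t : stdSimplex ℝ (Fin m)) :
    affineSimplex x (stdSimplex.map y t) = affineSimplex (tupleComp x y) t := by
  classical
  apply Subtype.ext
  funext v
  rw [affineSimplex_apply, affineSimplex_apply]
  simp only [stdSimplex.map_apply_sum]
  rw [Finset.sum_sigma']
  refine Finset.sum_bij' (fun p _ => p.2) (fun i _ => ⟨y i, i⟩) ?_ ?_ ?_ ?_ ?_
  · rintro ⟨a, b⟩ h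
    simp only [Finset.mem_sigma, Finset.mem_filter, Finset.mem_univ, true_and] at h
    obtain ⟨h, rfl⟩ := h
    exact Finset.mem_filter.2 ⟨Finset.mem_univ _, h⟩
  · intro i hi
    have : x.1 (y i) = v := (Finset.mem_filter.1 hi).2
    simpa using this
  · rintro ⟨a, b⟩ h
    simp only [Finset.mem_sigma, Finset.mem_filter, Finset.mem_univ, true_and] at h
    obtain ⟨-, rfl⟩ := h
    rfl
  · exact fun _ _ => rfl
  · exact fun _ _ => rfl

lemma mem_of_affineSimplex_ne_zero {n : ℕ} {x : K.tuples n} {t : stdSimplex ℝ (Fin n)} {v : W}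
    (h : (affineSimplex x t).1 v ≠ 0) : ∃ i, x.1 i = v := by
  classical
  rw [affineSimplex_apply] at h
  obtain ⟨i, hi, -⟩ := Finset.exists_ne_zero_of_sum_ne_zero h
  exact ⟨i, (Finset.mem_filter.1 hi).2⟩

lemma face_of_realization (p : K.Realization) : ∃ σ ∈ K.faces, ∀ v, p.1 v ≠ 0 → v ∈ σ := by
  obtain ⟨σ, hσ, -, h, -⟩ := p.2
  exact ⟨σ, hσ, fun v hv => by_contra fun h' => hv (h v h')⟩

/-- Coordinates summing to one are spread over at most `d` vertices. This is what the bound on the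
dimension is for. -/
lemma exists_large_coordinate {d : ℕ} (hd : ∀ σ ∈ K.faces, σ.card ≤ d) (p : K.Realization) :
    ∃ v, 1 / (d : ℝ) ≤ p.1 v := by
  obtain ⟨σ, hσ, h0, -, hs⟩ := p.2
  by_contra! h
  have hne : σ.Nonempty := (K.isRelLowerSet_faces hσ).1
  have hpos : 0 < d := (Finset.card_pos.2 hne).trans_le (hd σ hσ)
  have h1 : ∑ v ∈ σ, p.1 v < ∑ v ∈ σ, 1 / (d : ℝ) :=
    Finset.sum_lt_sum_of_nonempty hne fun v _ => h v
  rw [hs, Finset.sum_const, nsmul_eq_mul, mul_one_div, lt_div_iff₀ (by positivity), one_mul] at h1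
  exact absurd (hd σ hσ) (not_le.2 (by exact_mod_cast h1))

lemma abs_realization_le_one (p : K.Realization) (v : W) : ‖p.1 v‖ ≤ 1 := by
  obtain ⟨σ, hσ, h0, hz, hs⟩ := p.2
  rw [Real.norm_of_nonneg (h0 v)]
  by_cases hv : v ∈ σ
  · exact (Finset.single_le_sum (f := p.1) (fun i _ => h0 i) hv).trans_eq hs
  · rw [hz v hv]; exact zero_le_one

/-- With `W` discrete, the coordinates define a map from the realization to the bounded functions on
`W` with the sup metric. It is 1-Lipschitz on each closed simplex, hence continuous for the weak
topology; compactness of the standard simplex then gives uniform continuity. -/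
lemma exists_modulus {n : ℕ} (f : C(stdSimplex ℝ (Fin n), K.Realization)) {η : ℝ} (hη : 0 < η) :
    ∃ ε > 0, ∀ s t, dist s t < ε → ∀ v, |(f s).1 v - (f t).1 v| < η := by
  classical
  let _ : TopologicalSpace W := ⊥
  have : DiscreteTopology W := ⟨rfl⟩
  let coord : K.Realization → BoundedContinuousFunction W ℝ := fun p =>
    BoundedContinuousFunction.ofNormedAddCommGroupDiscrete p.1 1 (abs_realization_le_one p)
  have hc : Continuous coord := by
    refine continuous_of_simplices fun σ => LipschitzWith.continuous (K := 1) ?_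
    refine LipschitzWith.of_dist_le_mul fun s t => ?_
    rw [NNReal.coe_one, one_mul, BoundedContinuousFunction.dist_le dist_nonneg]
    intro v
    change dist (if h : v ∈ σ.1 then s.1 ⟨v, h⟩ else 0) (if h : v ∈ σ.1 then t.1 ⟨v, h⟩ else 0) ≤ _
    split_ifs with h
    · exact dist_le_pi_dist s.1 t.1 _
    · rw [dist_self]; exact dist_nonneg
  have hu := CompactSpace.uniformContinuous_of_continuous (hc.comp f.continuous)
  obtain ⟨ε, hε, h⟩ := Metric.uniformContinuous_iff.1 hu η hη
  refine ⟨ε, hε, fun s t hst v => ?_⟩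
  exact (BoundedContinuousFunction.dist_coe_le_dist (f := coord (f s)) (g := coord (f t)) v).trans_lt
    (h hst)

/-- Singular cones over the affine simplices, in a highly connected complex. -/
lemma exists_cones {N : ℕ} (hK : K.IsNConnected N) :
    ∃ g : ∀ n, K.tuples n → C(stdSimplex ℝ (Fin (n + 1)), K.Realization),
      (∀ n ≤ N + 1, ∀ x s, g n x (stdSimplex.map (Fin.succAbove 0) s) = affineSimplex x s) ∧
      ∀ n ≤ N, ∀ (x : K.tuples (n + 1)) (j : Fin (n + 1)) s,
        g (n + 1) x (stdSimplex.map (Fin.succAbove j.succ) s) = g n (tupleComp x j.succAbove) s := by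
  have : Nonempty K.Realization := hK.1
  -- The second condition says that the prescribed facets of the next cones fit together. Beyond the
  -- range of connectivity nothing is required, and constant maps serve as default values.
  let R : ∀ n, (K.tuples n → C(stdSimplex ℝ (Fin (n + 1)), K.Realization)) → Prop := fun n g =>
    n ≤ N + 1 → (∀ x s, g x (stdSimplex.map (Fin.succAbove 0) s) = affineSimplex x s) ∧
      ∀ (y : K.tuples (n + 1)) (j : Fin (n + 1)) (i : Fin n) r,
        g (tupleComp y j.succAbove) (stdSimplex.map (Fin.succAbove i.succ) r) =
        g (tupleComp y (j.succAbove i).succAbove)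
          (stdSimplex.map (Fin.succAbove (i.predAbove j).succ) r)
  -- The cone over the empty simplex is an arbitrary point, the common apex of all the cones.
  have h0 : R 0 fun _ => ContinuousMap.const _ (Classical.arbitrary _) := by
    refine fun _ => ⟨fun x s => ?_, fun y j i => i.elim0⟩
    have := stdSimplex.sum_eq_one s
    simp at this
  have hstep : ∀ n g, R n g → ∃ g' : K.tuples (n + 1) → C(stdSimplex ℝ (Fin (n + 2)), K.Realization),
      R (n + 1) g' ∧ (n ≤ N → ∀ x (j : Fin (n + 1)) s,
        g' x (stdSimplex.map (Fin.succAbove j.succ) s) = g (tupleComp x j.succAbove) s) := by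
    intro n g hg
    by_cases hn : n ≤ N
    swap
    · exact ⟨fun _ => ContinuousMap.const _ (Classical.arbitrary _), fun h => (hn (by omega)).elim,
        fun h => (hn h).elim⟩
    obtain ⟨ha, hb⟩ := hg (by omega)
    have hext : ∀ x : K.tuples (n + 1), ∃ H : C(stdSimplex ℝ (Fin (n + 2)), K.Realization),
        ∀ (j : Fin (n + 2)) s, H (stdSimplex.map (Fin.succAbove j) s) =
          (Fin.cons (affineSimplex x) fun j : Fin (n + 1) => g (tupleComp x j.succAbove) :
            Fin (n + 2) → C(stdSimplex ℝ (Fin (n + 1)), K.Realization)) j s := by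
      intro x
      refine SimplexFilling.exists_extension (fun m hm f => ?_) fun j l s s' h =>
        SimplexFilling.facet_compat (fun j i r => ?_) h
      · exact hK.2 m (by omega) f
      -- Facet 0 is the base and the others are cones over the faces of the base. Two facets meet
      -- either inside the base, where `ha` applies, or in a smaller cone, where `hb` does.
      · cases j using Fin.cases with
        | zero =>
          have e1 : (0 : Fin (n + 2)).succAbove i = i.succ := rfl
          have e2 : Fin.predAbove i (0 : Fin (n + 2)) = 0 := Fin.predAbove_right_zero
          rw [e1, e2, Fin.cons_zero, Fin.cons_succ, ha, affineSimplex_map]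
        | succ j =>
          cases i using Fin.cases with
          | zero =>
            rw [Fin.succ_succAbove_zero, Fin.cons_zero, Fin.cons_succ, ha, Fin.predAbove_zero_succ,
              affineSimplex_map]
          | succ i =>
            rw [Fin.succ_succAbove_succ, Fin.cons_succ, Fin.cons_succ, Fin.succ_predAbove_succ, hb]
    choose g' hg' using hext
    refine ⟨g', fun _ => ⟨fun x s => by rw [hg', Fin.cons_zero], fun y j i r => ?_⟩,
      fun _ x j s => by rw [hg', Fin.cons_succ]⟩
    rw [hg', hg', Fin.cons_succ, Fin.cons_succ]
    have : tupleComp (tupleComp y j.succAbove) i.succAbove =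
        tupleComp (tupleComp y (j.succAbove i).succAbove) (i.predAbove j).succAbove := by
      apply Subtype.ext
      funext k
      change y.1 _ = y.1 _
      rw [Fin.succAbove_succAbove_succAbove_predAbove]
    rw [this]
  have hne : ∀ n, Nonempty (K.tuples (n + 1) → C(stdSimplex ℝ (Fin (n + 2)), K.Realization)) :=
    fun n => ⟨fun _ => ContinuousMap.const _ (Classical.arbitrary _)⟩
  choose! next hnext using hstep
  let g : ∀ n, {g : K.tuples n → C(stdSimplex ℝ (Fin (n + 1)), K.Realization) // R n g} := fun n =>
    Nat.rec ⟨_, h0⟩ (fun n g => ⟨next n g.1, (hnext n g.1 g.2).1⟩) n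
  exact ⟨fun n => (g n).1, fun n hn => ((g n).2 hn).1,
    fun n hn => (hnext n (g n).1 (g n).2).2 hn⟩

open OrdChain Classical in
/-- Ordered simplicial chains obtained from ordered chains in the standard simplices. -/
def pushChain {m n : ℕ} (f : K.tuples m → stdSimplex ℝ (Fin n) → W)
    (T : OrdChain (stdSimplex ℝ (Fin n)) n) : OrdChain W m →ₗ[ℤ] OrdChain W n :=
  lift fun x => if h : x ∈ K.tuples m then OrdChain.map (f ⟨x, h⟩) n T else 0

open OrdChain in
lemma pushChain_of {m n : ℕ} (f : K.tuples m → stdSimplex ℝ (Fin n) → W)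
    (T : OrdChain (stdSimplex ℝ (Fin n)) n) (x : K.tuples m) :
    pushChain f T (of x.1) = OrdChain.map (f x) n T := by
  rw [pushChain, lift_of, dif_pos x.2]

open OrdChain in
/-- A homotopy from the identity to `A`, if `A` preserves simplices. -/
def carrierHomotopy (A : ∀ n, OrdChain W n →ₗ[ℤ] OrdChain W n) :
    ∀ n, OrdChain W n →ₗ[ℤ] OrdChain W (n + 1)
  | 0 => 0
  | n + 1 => lift fun x => cone (x 0) (n + 1)
      (A (n + 1) (of x) - of x - carrierHomotopy A n (bdry n (of x)))

-- An acyclic carrier argument: if `A` stays within a simplex, then so do the cones with apex the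
-- first vertex.
open OrdChain in
lemma carrierHomotopy_mem {A : ∀ n, OrdChain W n →ₗ[ℤ] OrdChain W n} {σ : Finset W}
    (hA : ∀ n (x : Fin n → W), (∀ i, x i ∈ σ) → A n (of x) ∈ inside {y | ∀ i, y i ∈ σ}) :
    ∀ n (x : Fin n → W), (∀ i, x i ∈ σ) →
      carrierHomotopy A n (of x) ∈ inside {y | ∀ i, y i ∈ σ}
  | 0, x, _ => by simp [carrierHomotopy]
  | n + 1, x, hx => by
    rw [carrierHomotopy, lift_of]
    refine cone_mem_inside (s := {y | ∀ i, y i ∈ σ}) (fun y hy i => ?_) ?_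
    · cases i using Fin.cases with
      | zero => exact hx 0
      | succ i => exact hy i
    · refine Submodule.sub_mem _ (Submodule.sub_mem _ (hA _ x hx) (of_mem_inside hx)) ?_
      refine map_mem_of_inside (s := {y | ∀ i, y i ∈ σ})
        (fun y hy => carrierHomotopy_mem hA n y hy) ?_
      exact bdry_mem_inside (s := {y | ∀ i, y i ∈ σ}) (t := {y | ∀ i, y i ∈ σ}) (fun y hy j i => hy _) (of_mem_inside hx)

-- The chain-map property of `A` is available only on tuples of `K`, so the induction runs over
-- chains inside `K`. The correction coned off in the definition is a cycle by the previous degree;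
-- coning it fills it.
open OrdChain in
lemma bdry_carrierHomotopy {A : ∀ n, OrdChain W n →ₗ[ℤ] OrdChain W n}
    (hA0 : A 0 = LinearMap.id)
    (hA : ∀ n, ∀ x ∈ K.tuples (n + 1), bdry n (A (n + 1) (of x)) = A n (bdry n (of x))) :
    ∀ n (z : OrdChain W n), z ∈ inside (K.tuples n) → IsCycle z →
      bdry n (carrierHomotopy A n z) = A n z - z
  | 0, z, _, _ => by simp [carrierHomotopy, hA0]
  | n + 1, z, hz, hc => by
    have key : bdry (n + 1) (carrierHomotopy A (n + 1) z) =
        (A (n + 1) - LinearMap.id - carrierHomotopy A n ∘ₗ bdry n :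
          OrdChain W (n + 1) →ₗ[ℤ] OrdChain W (n + 1)) z := by
      refine eqOn_inside (f := bdry (n + 1) ∘ₗ carrierHomotopy A (n + 1)) (fun x hx => ?_) hz
      rw [LinearMap.comp_apply, carrierHomotopy, lift_of, bdry_cone]
      have hcyc : ∀ {n : ℕ} (x : Fin (n + 1) → W), IsCycle (bdry n (of x)) := by
        intro n x
        match n with
        | 0 => trivial
        | n + 1 => exact bdry_bdry _
      have hb := bdry_carrierHomotopy hA0 hA n (bdry n (of x))
        (bdry_mem_inside (s := K.tuples (n + 1)) (fun y hy j => comp_mem_tuples hy _)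
          (of_mem_inside hx)) (hcyc x)
      simp only [map_sub, hb, hA n x hx]
      simp
    rw [key]
    have hc' : bdry n z = 0 := hc
    simp [hc']

open OrdChain in
/-- The (augmented, ordered) simplicial chain complex of an `N`-connected finite-dimensional
complex is exact up to dimension `N`. -/
theorem exists_bdry_eq_of_isNConnected {N d : ℕ} (hd : ∀ σ ∈ K.faces, σ.card ≤ d)
    (hK : K.IsNConnected N) {n : ℕ} (hn : n ≤ N + 1) {z : OrdChain W n}
    (hz : z ∈ inside (K.tuples n)) (hc : IsCycle z) :
    ∃ w ∈ inside (K.tuples (n + 1)), bdry n w = z := by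
  -- `vert` rounds a point of the realization to a vertex of its carrier with coordinate at least `1
  -- / d`.
  choose vert hvert using exists_large_coordinate hd
  obtain ⟨g, hg0, hg⟩ := exists_cones hK
  obtain ⟨p₀⟩ := hK.1
  obtain ⟨σ₀, hσ₀, -⟩ := face_of_realization p₀
  have hdpos : (0 : ℝ) < 1 / d := by
    have : 0 < d := (Finset.card_pos.2 (K.isRelLowerSet_faces hσ₀).1).trans_le (hd σ₀ hσ₀)
    positivity
  -- For `ε` small enough, moving by less than `ε` in any of the finitely many cones over simplices
  -- of `z` changes coordinates by less than `1 / d`.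
  have hev : ∀ᶠ ε : ℝ in nhdsWithin 0 (Set.Ioi 0), ∀ x ∈ z.support, ∀ hx : x ∈ K.tuples n,
      ∀ s t, dist s t < ε → ∀ v, |(g n ⟨x, hx⟩ s).1 v - (g n ⟨x, hx⟩ t).1 v| < 1 / d := by
    rw [Filter.eventually_all_finset]
    intro x hx
    obtain ⟨ε, hε, h⟩ := exists_modulus (g n ⟨x, hz hx⟩) hdpos
    filter_upwards [Ioo_mem_nhdsGT hε] with ε' hε' _ s t hst
    exact h s t (hst.trans hε'.2)
  obtain ⟨ε, hεx, hε⟩ := (hev.and self_mem_nhdsWithin).exists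
  obtain ⟨T, hT0, hTs, hTb⟩ := exists_fundamental_chains hε
  -- `A` samples and rounds the affine simplices, and `B` the cones over them. The fine chains `T`
  -- are compatible with faces, so `A` commutes with the boundary on tuples of `K` and `B` contracts
  -- it in the range needed.
  let A : ∀ n, OrdChain W n →ₗ[ℤ] OrdChain W n := fun n =>
    pushChain (K := K) (fun x t => vert (affineSimplex x t)) (T n)
  let B : ∀ n, OrdChain W n →ₗ[ℤ] OrdChain W (n + 1) := fun n =>
    pushChain (K := K) (fun x t => vert (g n x t)) (T (n + 1))
  have hbdry : ∀ {n : ℕ} (x : K.tuples (n + 1)), bdry n (of x.1) =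
      ∑ j : Fin (n + 1), ((-1 : ℤ) ^ (j : ℕ)) • of (tupleComp x j.succAbove).1 :=
    fun x => bdry_of x.1
  have hfaces : ∀ {n : ℕ} (f : stdSimplex ℝ (Fin (n + 1)) → W),
      bdry n (OrdChain.map f (n + 1) (T (n + 1))) =
        ∑ j : Fin (n + 1), ((-1 : ℤ) ^ (j : ℕ)) •
          OrdChain.map (f ∘ stdSimplex.map (Fin.succAbove j)) n (T n) := by
    intro n f
    rw [← map_bdry, hTb, simplexFaces, map_faceSum, faceSum_apply]
    simp only [map_map]
    rfl
  have hA0 : A 0 = LinearMap.id := by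
    refine hom_ext fun x => ?_
    have hx : x ∈ K.tuples 0 := ⟨σ₀, hσ₀, fun i => i.elim0⟩
    rw [show A 0 (of x) = _ from pushChain_of _ _ ⟨x, hx⟩, hT0, map_of, LinearMap.id_apply]
    congr 1
    exact Subsingleton.elim _ _
  have hA : ∀ n, ∀ x ∈ K.tuples (n + 1), bdry n (A (n + 1) (of x)) = A n (bdry n (of x)) := by
    intro n x hx
    rw [show A (n + 1) (of x) = _ from pushChain_of _ _ ⟨x, hx⟩, hfaces, hbdry ⟨x, hx⟩, map_sum]
    refine Finset.sum_congr rfl fun j _ => ?_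
    rw [map_zsmul, show A n (of _) = _ from pushChain_of _ _ (tupleComp ⟨x, hx⟩ _)]
    congr 3
    funext t
    exact congrArg vert (affineSimplex_map _ _ _)
  -- Facet 0 of a cone gives `A` and the other facets give `B` of the boundary, which is zero for a
  -- cycle.
  have hB : bdry n (B n z) = A n z := by
    match n with
    | 0 =>
      refine eqOn_inside (f := bdry 0 ∘ₗ B 0) (fun x hx => ?_) hz
      rw [LinearMap.comp_apply, show B 0 (of x) = _ from pushChain_of _ _ ⟨x, hx⟩, hfaces,
        show A 0 (of x) = _ from pushChain_of _ _ ⟨x, hx⟩, Fin.sum_univ_one, hT0, map_of, map_of]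
      simp [Subsingleton.elim (α := Fin 0 → W) _ x]
    | n + 1 =>
      have key : bdry (n + 1) (B (n + 1) z) = (A (n + 1) - B n ∘ₗ bdry n : OrdChain W (n + 1) →ₗ[ℤ] _) z := by
        refine eqOn_inside (f := bdry (n + 1) ∘ₗ B (n + 1)) (fun x hx => ?_) hz
        rw [LinearMap.comp_apply, show B (n + 1) (of x) = _ from pushChain_of _ _ ⟨x, hx⟩, hfaces,
          LinearMap.sub_apply, LinearMap.comp_apply,
          show A (n + 1) (of x) = _ from pushChain_of _ _ ⟨x, hx⟩, hbdry ⟨x, hx⟩,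
          Fin.sum_univ_succ, map_sum, sub_eq_add_neg, ← Finset.sum_neg_distrib]
        congr 1
        · rw [Fin.val_zero, pow_zero, one_smul]
          congr 2
          funext t
          exact congrArg vert (hg0 _ hn _ _)
        · refine Finset.sum_congr rfl fun j _ => ?_
          rw [map_zsmul, show B n (of _) = _ from pushChain_of _ _ (tupleComp ⟨x, hx⟩ _),
            Fin.val_succ, pow_succ, mul_neg_one, neg_smul]
          congr 4
          funext t
          exact congrArg vert (hg n (by omega) ⟨x, hx⟩ j t)
      have hc' : bdry n z = 0 := hc
      rw [key, LinearMap.sub_apply, LinearMap.comp_apply, hc', map_zero, sub_zero]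
  refine ⟨B n z - carrierHomotopy A n z, Submodule.sub_mem _ ?_ ?_, ?_⟩
  · refine map_mem_of_inside (s := (z.support : Set (Fin n → W))) (fun x hx => ?_)
      ((Finsupp.mem_supported ℤ z).2 subset_rfl)
    rw [show B n (of x) = _ from pushChain_of _ _ ⟨x, hz hx⟩]
    refine map_mem_inside (fun y hy => ?_) (hTs (n + 1))
    -- All rounded vertices lie in the carrier of the first sample: a coordinate that is at least `1
    -- / d` at one sample cannot vanish at another one of the same small tuple.
    obtain ⟨σ, hσ, h⟩ := face_of_realization (g n ⟨x, hz hx⟩ (y 0))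
    refine ⟨σ, hσ, fun i => h _ fun h0 => ?_⟩
    have h1 := hεx x hx (hz hx) (y i) (y 0) (hy i 0) (vert (g n ⟨x, hz hx⟩ (y i)))
    have h2 := hvert (g n ⟨x, hz hx⟩ (y i))
    change (g n ⟨x, hz hx⟩ (y 0)).1 (vert (g n ⟨x, hz hx⟩ (y i))) = 0 at h0
    rw [h0, sub_zero] at h1
    exact absurd (le_abs_self _) (not_le.2 (h1.trans_le h2))
  · refine map_mem_of_inside (fun x hx => ?_) hz
    obtain ⟨σ, hσ, hxσ⟩ := hx
    -- Points of an affine simplex have nonzero coordinates only at its own vertices, so rounding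
    -- preserves each simplex and the carrier argument applies.
    have hsub : {y : Fin (n + 1) → W | ∀ i, y i ∈ σ} ⊆ K.tuples (n + 1) := fun y hy => ⟨σ, hσ, hy⟩
    refine Finsupp.supported_mono hsub
      (carrierHomotopy_mem (σ := σ) (fun n x hx => ?_) n x hxσ)
    have hxt : x ∈ K.tuples n := ⟨σ, hσ, hx⟩
    rw [show A n (of x) = _ from pushChain_of _ _ ⟨x, hxt⟩]
    refine map_mem_inside (s := Set.univ) (fun y _ i => ?_) (by simp)
    have h2 := hvert (affineSimplex ⟨x, hxt⟩ (y i))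
    obtain ⟨l, hl⟩ := mem_of_affineSimplex_ne_zero (hdpos.trans_le h2).ne'
    change vert _ ∈ σ
    rw [← hl]
    exact hx l
  · rw [map_sub, hB, bdry_carrierHomotopy hA0 hA n z hz hc, sub_sub_cancel]

end PreAbstractSimplicialComplex

/-! ### Oriented simplicial chains -/

open CompactCohomology

section Oriented

variable {W W' : Type*} (K : PreAbstractSimplicialComplex W) {M M' : Type*} [AddCommGroup M]
  [AddCommGroup M']

/-- Oriented simplicial cochains, considered as functions on all tuples of vertices. -/
structure IsCochain {n : ℕ} (φ : (Fin n → W) → M) : Prop where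
  eq_zero : ∀ x, ¬ IsOrderedSimplex K x → φ x = 0
  perm : ∀ x (π : Equiv.Perm (Fin n)), φ (x ∘ π) = (Equiv.Perm.sign π : ℤ) • φ x

variable {K}

lemma isOrderedSimplex_perm {n : ℕ} {x : Fin n → W} (π : Equiv.Perm (Fin n)) :
    IsOrderedSimplex K (x ∘ π) ↔ IsOrderedSimplex K x := by
  rw [IsOrderedSimplex, IsOrderedSimplex, EquivLike.range_comp, EquivLike.injective_comp]

lemma CompactCohomology.IsOrderedSimplex.mem_tuples {n : ℕ} {x : Fin n → W} (h : IsOrderedSimplex K x) :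
    x ∈ K.tuples n := by
  obtain ⟨-, σ, hσ, hr⟩ := h
  exact ⟨σ, hσ, fun i => by rw [← Finset.mem_coe, ← hr]; exact ⟨i, rfl⟩⟩

lemma isOrderedSimplex_of_mem_tuples {n : ℕ} {x : Fin (n + 1) → W} (hx : x ∈ K.tuples (n + 1))
    (hi : Function.Injective x) : IsOrderedSimplex K x := by
  classical
  obtain ⟨σ, hσ, h⟩ := hx
  refine ⟨hi, Finset.univ.image x, (K.isRelLowerSet_faces hσ).2 ?_ ?_, by simp⟩
  · intro v hv
    obtain ⟨i, -, rfl⟩ := Finset.mem_image.1 hv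
    exact h i
  · exact ⟨x 0, Finset.mem_image_of_mem _ (Finset.mem_univ _)⟩

lemma CompactCohomology.IsOrderedSimplex.pos {n : ℕ} {x : Fin n → W} (h : IsOrderedSimplex K x) : 0 < n := by
  obtain ⟨-, σ, hσ, hr⟩ := h
  obtain ⟨v, hv⟩ := (K.isRelLowerSet_faces hσ).1
  rw [← Finset.mem_coe, ← hr] at hv
  obtain ⟨i, -⟩ := hv
  exact i.pos

lemma CompactCohomology.IsOrderedSimplex.face {n : ℕ} {x : Fin (n + 2) → W} (h : IsOrderedSimplex K x)
    (j : Fin (n + 2)) : IsOrderedSimplex K (x ∘ j.succAbove) :=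
  isOrderedSimplex_of_mem_tuples (PreAbstractSimplicialComplex.comp_mem_tuples h.mem_tuples _)
    (h.1.comp Fin.succAbove_right_injective)

lemma IsCochain.isAlternating {n : ℕ} {φ : (Fin n → W) → M} (h : IsCochain K φ) :
    IsAlternating φ := ⟨h.perm, fun x hx => h.eq_zero x fun h' => hx h'.1⟩

/-- Faces are nonempty, so the empty tuple is not a simplex: the oriented complex carries no
augmentation. -/
lemma IsCochain.of_isEmpty {φ : (Fin 0 → W) → M} (h : IsCochain K φ) : φ = 0 :=
  funext fun x => h.eq_zero x fun h' => h'.pos.ne rfl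

variable (K) in
open Classical in
/-- The simplicial coboundary. -/
def simplicialCoboundary (n : ℕ) (φ : (Fin n → W) → M) (x : Fin (n + 1) → W) : M :=
  if IsOrderedSimplex K x then faceSum n φ x else 0

lemma simplicialCoboundary_of_isOrderedSimplex {n : ℕ} (φ : (Fin n → W) → M)
    {x : Fin (n + 1) → W} (h : IsOrderedSimplex K x) :
    simplicialCoboundary K n φ x = faceSum n φ x := if_pos h

lemma simplicialCoboundary_of_not {n : ℕ} (φ : (Fin n → W) → M)
    {x : Fin (n + 1) → W} (h : ¬ IsOrderedSimplex K x) :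
    simplicialCoboundary K n φ x = 0 := if_neg h

lemma IsCochain.coboundary {n : ℕ} {φ : (Fin n → W) → M} (h : IsCochain K φ) :
    IsCochain K (simplicialCoboundary K n φ) where
  eq_zero x hx := if_neg hx
  perm x π := by
    by_cases hx : IsOrderedSimplex K x
    · rw [simplicialCoboundary_of_isOrderedSimplex _ hx,
        simplicialCoboundary_of_isOrderedSimplex _ ((isOrderedSimplex_perm π).2 hx),
        h.isAlternating.faceSum.perm]
    · rw [simplicialCoboundary_of_not _ hx,
        simplicialCoboundary_of_not _ (mt (isOrderedSimplex_perm π).1 hx), smul_zero]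

/-- On a degenerate tuple both sides vanish, because alternation passes to the coboundary. The usual
formula may therefore be used on tuples with repetitions, as in the comparison with ordered chains.
-/
lemma IsCochain.coboundary_of_mem_tuples {n : ℕ} {φ : (Fin n → W) → M} (h : IsCochain K φ)
    {x : Fin (n + 1) → W} (hx : x ∈ K.tuples (n + 1)) :
    simplicialCoboundary K n φ x = faceSum n φ x := by
  by_cases hi : Function.Injective x
  · exact if_pos (isOrderedSimplex_of_mem_tuples hx hi)
  · rw [simplicialCoboundary_of_not _ fun h => hi h.1, h.isAlternating.faceSum.degenerate x hi]

lemma simplicialCoboundary_simplicialCoboundary {n : ℕ} {φ : (Fin n → W) → M} :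
    simplicialCoboundary K (n + 1) (simplicialCoboundary K n φ) = 0 := by
  ext x
  by_cases hx : IsOrderedSimplex K x
  · rw [simplicialCoboundary_of_isOrderedSimplex _ hx, ← congrFun (faceSum_faceSum φ) x,
      faceSum_apply, faceSum_apply]
    refine Finset.sum_congr rfl fun j _ => ?_
    rw [simplicialCoboundary_of_isOrderedSimplex _ (hx.face j)]
  · exact simplicialCoboundary_of_not _ hx

variable (K)

/-- The relations between ordered simplices in the group of oriented chains. -/
def orientationRelations (n : ℕ) : Submodule ℤ (OrdChain W n) :=
  Submodule.span ℤ ({z : OrdChain W n | ∃ x, ¬ IsOrderedSimplex K x ∧ z = OrdChain.of x} ∪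
    {z : OrdChain W n | ∃ x, ∃ π : Equiv.Perm (Fin n),
      z = OrdChain.of (x ∘ π) - (Equiv.Perm.sign π : ℤ) • OrdChain.of x})

/-- Oriented simplicial chains; `n` is the number of vertices. -/
abbrev OrientedChain (n : ℕ) := OrdChain W n ⧸ orientationRelations K n

namespace OrientedChain

/-- The projection from ordered to oriented chains. -/
abbrev proj (n : ℕ) : OrdChain W n →ₗ[ℤ] OrientedChain K n := (orientationRelations K n).mkQ

/-- The class of an ordered simplex; zero for tuples that are not ordered simplices. -/
def cls {n : ℕ} (x : Fin n → W) : OrientedChain K n := proj K n (OrdChain.of x)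

lemma isCochain_cls {n : ℕ} : IsCochain K (cls K (n := n)) where
  eq_zero x hx := (Submodule.Quotient.mk_eq_zero _).2 (Submodule.subset_span (Or.inl ⟨x, hx, rfl⟩))
  perm x π := by
    rw [← sub_eq_zero, cls, cls, ← map_zsmul, ← map_sub]
    exact (Submodule.Quotient.mk_eq_zero _).2 (Submodule.subset_span (Or.inr ⟨x, π, rfl⟩))

variable {K}

/-- The homomorphism on oriented chains given by a cochain. -/
def lift {n : ℕ} {F : (Fin n → W) → M} (hF : IsCochain K F) : OrientedChain K n →ₗ[ℤ] M :=
  (orientationRelations K n).liftQ (OrdChain.lift F) (by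
    rw [orientationRelations, Submodule.span_le]
    rintro z (⟨x, hx, rfl⟩ | ⟨x, π, rfl⟩)
    · simp [hF.eq_zero x hx]
    · simp [hF.perm x π])

@[simp] lemma lift_cls {n : ℕ} {F : (Fin n → W) → M} (hF : IsCochain K F) (x : Fin n → W) :
    lift hF (cls K x) = F x := by
  rw [cls, lift]
  simp

lemma induction {n : ℕ} {motive : OrientedChain K n → Prop}
    (zero : motive 0) (add : ∀ a b, motive a → motive b → motive (a + b))
    (smul : ∀ (r : ℤ) a, motive a → motive (r • a)) 
    (cls : ∀ x, IsOrderedSimplex K x → motive (cls K x)) (c : OrientedChain K n) : motive c := by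
  obtain ⟨z, rfl⟩ := Submodule.mkQ_surjective _ c
  induction z using Finsupp.induction_linear with
  | zero => rwa [map_zero]
  | add a b ha hb => rw [map_add]; exact add _ _ ha hb
  | single x r =>
    have : Finsupp.single x r = r • (OrdChain.of x : OrdChain W n) := by simp [OrdChain.of]
    rw [this, map_zsmul]
    by_cases hx : IsOrderedSimplex K x
    · exact smul _ _ (cls x hx)
    · have h0 : proj K n (OrdChain.of x) = 0 := (isCochain_cls K).eq_zero x hx
      rw [h0, smul_zero]
      exact zero

lemma addHom_ext {n : ℕ} {F : Type*} [FunLike F (OrientedChain K n) M]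
    [AddMonoidHomClass F (OrientedChain K n) M] {f g : F}
    (h : ∀ x, IsOrderedSimplex K x → f (cls K x) = g (cls K x)) (c : OrientedChain K n) :
    f c = g c :=
  induction (motive := fun c => f c = g c) (by simp) (fun a b ha hb => by simp [ha, hb])
    (fun r a ha => by simp [ha]) h c

variable (K) in
/-- The boundary of oriented chains. -/
def bdry (n : ℕ) : OrientedChain K (n + 1) →ₗ[ℤ] OrientedChain K n :=
  lift (isCochain_cls K).coboundary

lemma bdry_cls {n : ℕ} {x : Fin (n + 1) → W} (hx : x ∈ K.tuples (n + 1)) :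
    bdry K n (cls K x) = faceSum n (cls K) x := by
  rw [bdry, lift_cls, (isCochain_cls K).coboundary_of_mem_tuples hx]

lemma map_bdry_cls {F : Type*} {n : ℕ} [FunLike F (OrientedChain K n) M]
    [AddMonoidHomClass F (OrientedChain K n) M] (f : F) (x : Fin (n + 1) → W) :
    f (bdry K n (cls K x)) = simplicialCoboundary K n (fun y => f (cls K y)) x := by
  rw [bdry, lift_cls, simplicialCoboundary, simplicialCoboundary]
  split_ifs
  · rw [map_faceSum]
  · rw [map_zero]

lemma bdry_bdry {n : ℕ} (c : OrientedChain K (n + 2)) : bdry K n (bdry K (n + 1) c) = 0 := by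
  refine addHom_ext (f := bdry K n ∘ₗ bdry K (n + 1)) (g := 0) (fun x _ => ?_) c
  rw [LinearMap.comp_apply, map_bdry_cls]
  have : (fun y => bdry K n (cls K y)) = simplicialCoboundary K n (cls K) :=
    funext fun y => lift_cls _ _
  rw [this, simplicialCoboundary_simplicialCoboundary]
  rfl

lemma bdry_proj {n : ℕ} {z : OrdChain W (n + 1)} (hz : z ∈ OrdChain.inside (K.tuples (n + 1))) :
    bdry K n (proj K (n + 1) z) = proj K n (OrdChain.bdry n z) := by
  refine OrdChain.eqOn_inside (f := bdry K n ∘ₗ proj K (n + 1)) (g := proj K n ∘ₗ OrdChain.bdry n)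
    (fun x hx => ?_) hz
  rw [LinearMap.comp_apply, LinearMap.comp_apply, OrdChain.bdry_of, map_faceSum]
  exact bdry_cls hx

open Classical in
/-- The value on tuples of the map of oriented chains induced by a simplicial map. -/
def mapTuple (K : PreAbstractSimplicialComplex W) (K' : PreAbstractSimplicialComplex W')
    (f : W → W') {n : ℕ} (x : Fin n → W) : OrientedChain K' n :=
  if IsOrderedSimplex K x then cls K' (f ∘ x) else 0

lemma isCochain_mapTuple (K' : PreAbstractSimplicialComplex W') (f : W → W') (n : ℕ) :
    IsCochain K (mapTuple K K' f (n := n)) where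
  eq_zero x hx := if_neg hx
  perm x π := by
    rw [mapTuple, mapTuple, isOrderedSimplex_perm]
    split_ifs
    · exact (isCochain_cls K').perm (f ∘ x) π
    · rw [smul_zero]

/-- The map of oriented chains induced by a simplicial map. -/
def map (K' : PreAbstractSimplicialComplex W') (f : W → W') (n : ℕ) :
    OrientedChain K n →ₗ[ℤ] OrientedChain K' n :=
  lift (isCochain_mapTuple K' f n)

lemma map_cls {K' : PreAbstractSimplicialComplex W'} {f : W → W'} {n : ℕ} {x : Fin n → W}
    (hx : IsOrderedSimplex K x) : map K' f n (cls K x) = cls K' (f ∘ x) := by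
  rw [map, lift_cls, mapTuple, if_pos hx]

lemma map_bdry {K' : PreAbstractSimplicialComplex W'} {f : W → W'}
    (hf : ∀ σ ∈ K.faces, ∃ τ ∈ K'.faces, ∀ v ∈ σ, f v ∈ τ) {n : ℕ} (c : OrientedChain K (n + 2)) :
    map K' f (n + 1) (bdry K (n + 1) c) = bdry K' (n + 1) (map K' f (n + 2) c) := by
  refine addHom_ext (f := map K' f (n + 1) ∘ₗ bdry K (n + 1))
    (g := bdry K' (n + 1) ∘ₗ map K' f (n + 2)) (fun x hx => ?_) c
  rw [LinearMap.comp_apply, LinearMap.comp_apply, map_cls hx, bdry_cls hx.mem_tuples]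
  obtain ⟨σ, hσ, hx'⟩ := hx.mem_tuples
  obtain ⟨τ, hτ, h⟩ := hf σ hσ
  have hfx : f ∘ x ∈ K'.tuples (n + 2) := ⟨τ, hτ, fun i => h _ (hx' i)⟩
  rw [bdry_cls hfx, map_faceSum, faceSum_apply, faceSum_apply]
  refine Finset.sum_congr rfl fun j _ => ?_
  rw [map_cls (hx.face j)]
  rfl

instance : Subsingleton (OrientedChain K 0) :=
  ⟨fun a b => by
    refine addHom_ext (f := LinearMap.id) (g := (0 : OrientedChain K 0 →ₗ[ℤ] OrientedChain K 0))
      (fun x hx => (hx.pos.ne rfl).elim) a |>.trans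
      (addHom_ext (f := LinearMap.id) (g := (0 : OrientedChain K 0 →ₗ[ℤ] OrientedChain K 0))
      (fun x hx => (hx.pos.ne rfl).elim) b).symm⟩

/-! ### Oriented chains as a retract of ordered chains. -/

section Sorting

variable [LinearOrder W]

variable (K) in
open Classical in
/-- Sort an ordered simplex, with sign. -/
def sortTuple {n : ℕ} (x : Fin n → W) : OrdChain W n :=
  if IsOrderedSimplex K x then
    (Equiv.Perm.sign (Tuple.sort x) : ℤ) • OrdChain.of (x ∘ Tuple.sort x) else 0

/-- The entries are distinct, so there is only one sorting permutation; permuting the tuple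
multiplies it by the inverse permutation and changes the sign accordingly. -/
lemma isCochain_sortTuple (n : ℕ) : IsCochain K (sortTuple K (n := n)) where
  eq_zero x hx := if_neg hx
  perm x π := by
    rw [sortTuple, sortTuple, isOrderedSimplex_perm]
    split_ifs with h
    · have h1 : (x ∘ π) ∘ Tuple.sort (x ∘ π) = x ∘ Tuple.sort x :=
        Tuple.comp_perm_comp_sort_eq_comp_sort
      have h2 : π * Tuple.sort (x ∘ π) = Tuple.sort x := by
        ext i
        exact congrArg Fin.val (h.1 (congrFun h1 i))
      rw [h1, ← h2, Equiv.Perm.sign_mul, smul_smul]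
      congr 1
      push_cast
      rw [← mul_assoc, ← Units.val_mul, Int.units_mul_self]
      simp
    · rw [smul_zero]

variable (K) in
/-- A section of the projection from ordered to oriented chains. -/
def sort (n : ℕ) : OrientedChain K n →ₗ[ℤ] OrdChain W n := lift (isCochain_sortTuple n)

lemma sort_cls {n : ℕ} {x : Fin n → W} (hx : IsOrderedSimplex K x) (hm : Monotone x) :
    sort K n (cls K x) = OrdChain.of x := by
  rw [sort, lift_cls, sortTuple, if_pos hx, Tuple.sort_eq_refl_iff_monotone.2 hm]
  simp

lemma hom_ext_monotone {n : ℕ} {f g : OrientedChain K n →ₗ[ℤ] M}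
    (h : ∀ x, IsOrderedSimplex K x → Monotone x → f (cls K x) = g (cls K x)) : f = g := by
  refine LinearMap.ext fun c => addHom_ext (fun x hx => ?_) c
  have h1 := h (x ∘ Tuple.sort x) ((isOrderedSimplex_perm _).2 hx) (Tuple.monotone_sort x)
  rw [(isCochain_cls K).perm, map_zsmul, map_zsmul] at h1
  rcases Int.units_eq_one_or (Equiv.Perm.sign (Tuple.sort x)) with hs | hs <;>
    simpa [hs] using h1

lemma proj_sort {n : ℕ} (c : OrientedChain K n) : proj K n (sort K n c) = c :=
  LinearMap.congr_fun (f := proj K n ∘ₗ sort K n) (g := LinearMap.id)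
    (hom_ext_monotone fun x hx hm => by
      rw [LinearMap.comp_apply, sort_cls hx hm]; rfl) c

/-- Faces of increasing tuples are increasing. The index starts at two vertices: below that, the
ordered boundary would hit the empty tuple, which is absent from the oriented complex. -/
lemma bdry_sort {n : ℕ} (c : OrientedChain K (n + 2)) :
    OrdChain.bdry (n + 1) (sort K (n + 2) c) = sort K (n + 1) (bdry K (n + 1) c) :=
  LinearMap.congr_fun (f := OrdChain.bdry (n + 1) ∘ₗ sort K (n + 2))
    (g := sort K (n + 1) ∘ₗ bdry K (n + 1))
    (hom_ext_monotone fun x hx hm => by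
      rw [LinearMap.comp_apply, LinearMap.comp_apply, sort_cls hx hm, bdry_cls hx.mem_tuples,
        OrdChain.bdry_of, map_faceSum, faceSum_apply, faceSum_apply]
      refine Finset.sum_congr rfl fun j _ => ?_
      rw [sort_cls (hx.face j) (hm.comp (Fin.strictMono_succAbove j).monotone)]) c

lemma sort_mem {n : ℕ} (c : OrientedChain K n) : sort K n c ∈ OrdChain.inside (K.tuples n) := by
  refine induction (motive := fun c => sort K n c ∈ OrdChain.inside (K.tuples n))
    (by simp) (fun a b ha hb => by rw [map_add]; exact Submodule.add_mem _ ha hb)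
    (fun r a ha => by rw [map_zsmul]; exact Submodule.smul_mem _ r ha) (fun x hx => ?_) c
  rw [sort, lift_cls, sortTuple, if_pos hx]
  exact Submodule.smul_mem _ _ (OrdChain.of_mem_inside
    (PreAbstractSimplicialComplex.comp_mem_tuples hx.mem_tuples _))

end Sorting

/-- Exactness for ordered chains implies exactness for oriented chains. -/
lemma exists_bdry_eq {n : ℕ}
    (h : ∀ z ∈ OrdChain.inside (K.tuples (n + 2)), OrdChain.bdry (n + 1) z = 0 →
      ∃ w ∈ OrdChain.inside (K.tuples (n + 3)), OrdChain.bdry (n + 2) w = z)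
    {c : OrientedChain K (n + 2)} (hc : bdry K (n + 1) c = 0) : ∃ e, bdry K (n + 2) e = c := by
  -- Any linear order will do; it is not required to be equivariant, since exactness concerns only
  -- the underlying groups.
  let _ : LinearOrder W := (exists_wellFoundedLT W).choose
  obtain ⟨w, hw, hb⟩ := h (sort K _ c) (sort_mem c) (by rw [bdry_sort, hc, map_zero])
  exact ⟨proj K _ w, by rw [bdry_proj hw, hb, proj_sort]⟩

end OrientedChain

end Oriented

/-! ### Oriented chains as modules over the group ring -/

open CompactCohomology

section GroupRing

variable {G : Type u} [Group G]

/-- Equivariant additive maps are linear over the integral group ring. -/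
def AddMonoidHom.toGroupRingLinearMap {X X' : Type*} [AddCommGroup X] [AddCommGroup X']
    [Module (MonoidAlgebra ℤ G) X] [Module (MonoidAlgebra ℤ G) X'] (f : X →+ X')
    (hf : ∀ (g : G) x, f (MonoidAlgebra.single g (1 : ℤ) • x) =
      MonoidAlgebra.single g (1 : ℤ) • f x) : X →ₗ[MonoidAlgebra ℤ G] X' where
  __ := f
  map_smul' r x := by
    change f (r • x) = r • f x
    induction r using MonoidAlgebra.induction_linear with
    | zero => simp
    | add a b ha hb => rw [add_smul, add_smul, map_add, ha, hb]
    | single g r =>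
      have : (MonoidAlgebra.single g r : MonoidAlgebra ℤ G) = r • MonoidAlgebra.single g 1 := by
        ext; simp
      rw [this, smul_assoc, smul_assoc, map_zsmul, hf]

variable {W W' : Type*} [MulAction G W] [MulAction G W'] {K : PreAbstractSimplicialComplex W}
  {K' : PreAbstractSimplicialComplex W'}

lemma isOrderedSimplex_smul_iff (hK : K.IsInvariant G) (g : G) {n : ℕ} {x : Fin n → W} :
    IsOrderedSimplex K (g • x) ↔ IsOrderedSimplex K x := isOrderedSimplex_smul hK g x

/-- The action on oriented chains. -/
def chainRep (hK : K.IsInvariant G) (n : ℕ) : Representation ℤ G (OrientedChain K n) where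
  toFun g := OrientedChain.map K (g • ·) n
  map_one' := LinearMap.ext fun c => OrientedChain.addHom_ext (fun x hx => by
    rw [OrientedChain.map_cls hx]
    have : (fun v => (1 : G) • v) ∘ x = x := funext fun i => one_smul G _
    rw [this]
    rfl) c
  map_mul' g h := LinearMap.ext fun c => OrientedChain.addHom_ext (fun x hx => by
    have h1 : IsOrderedSimplex K ((fun v => h • v) ∘ x) := (isOrderedSimplex_smul hK h x).2 hx
    rw [OrientedChain.map_cls hx, Module.End.mul_apply, OrientedChain.map_cls hx,
      OrientedChain.map_cls h1]
    congr 1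
    exact funext fun i => mul_smul g h (x i)) c

/-- Oriented chains as a module over the group ring. -/
abbrev EquivariantChain (hK : K.IsInvariant G) (n : ℕ) := (chainRep hK n).asModule

namespace EquivariantChain

/-- The class of an ordered simplex; zero for tuples that are not ordered simplices. -/
def cls (hK : K.IsInvariant G) {n : ℕ} (x : Fin n → W) : EquivariantChain hK n :=
  OrientedChain.cls K x

variable {hK : K.IsInvariant G} {hK' : K'.IsInvariant G} {X : Type*} [AddCommGroup X]
  [Module (MonoidAlgebra ℤ G) X] {n : ℕ}

lemma isCochain_cls : IsCochain K (cls hK (n := n)) := OrientedChain.isCochain_cls K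

lemma single_smul_cls (g : G) (x : Fin n → W) :
    MonoidAlgebra.single g (1 : ℤ) • cls hK x = cls hK (g • x) := by
  rw [Representation.single_smul, one_smul]
  change OrientedChain.map K (g • ·) n (OrientedChain.cls K x) = _
  by_cases hx : IsOrderedSimplex K x
  · rw [OrientedChain.map_cls hx]
    rfl
  · have h1 : OrientedChain.cls K x = 0 := (OrientedChain.isCochain_cls K).eq_zero x hx
    have h2 : cls hK (g • x) = 0 :=
      (OrientedChain.isCochain_cls K).eq_zero _ (mt (isOrderedSimplex_smul_iff hK g).1 hx)
    exact (congrArg _ h1).trans ((map_zero _).trans h2.symm)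

lemma addHom_ext {M F : Type*} [AddCommGroup M] [FunLike F (EquivariantChain hK n) M]
    [AddMonoidHomClass F (EquivariantChain hK n) M] {f g : F}
    (h : ∀ x, IsOrderedSimplex K x → f (cls hK x) = g (cls hK x)) (c : EquivariantChain hK n) :
    f c = g c :=
  OrientedChain.addHom_ext (K := K) (n := n)
    (f := (AddMonoidHomClass.toAddMonoidHom f : EquivariantChain hK n →+ M))
    (g := (AddMonoidHomClass.toAddMonoidHom g : EquivariantChain hK n →+ M)) h c

lemma hom_ext {f g : EquivariantChain hK n →ₗ[MonoidAlgebra ℤ G] X}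
    (h : ∀ x, IsOrderedSimplex K x → f (cls hK x) = g (cls hK x)) : f = g :=
  LinearMap.ext (addHom_ext h)

/-- The linear map given by an equivariant cochain. -/
def lift {F : (Fin n → W) → X} (hF : IsCochain K F)
    (hF' : ∀ (g : G) x, F (g • x) = MonoidAlgebra.single g (1 : ℤ) • F x) :
    EquivariantChain hK n →ₗ[MonoidAlgebra ℤ G] X :=
  AddMonoidHom.toGroupRingLinearMap
    (X := EquivariantChain hK n) (OrientedChain.lift hF).toAddMonoidHom fun g c =>
    addHom_ext (hK := hK)
      (f := (OrientedChain.lift hF).toAddMonoidHom.comp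
        (DistribSMul.toAddMonoidHom (EquivariantChain hK n) (MonoidAlgebra.single g (1 : ℤ))))
      (g := (DistribSMul.toAddMonoidHom X (MonoidAlgebra.single g (1 : ℤ))).comp
        (OrientedChain.lift hF).toAddMonoidHom) (fun x _ => by
      change OrientedChain.lift hF (MonoidAlgebra.single g (1 : ℤ) • cls hK x) =
        MonoidAlgebra.single g (1 : ℤ) • OrientedChain.lift hF (OrientedChain.cls K x)
      rw [single_smul_cls, OrientedChain.lift_cls, ← hF']
      exact OrientedChain.lift_cls hF _) c

@[simp] lemma lift_cls {F : (Fin n → W) → X} (hF : IsCochain K F)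
    (hF' : ∀ (g : G) x, F (g • x) = MonoidAlgebra.single g (1 : ℤ) • F x) (x : Fin n → W) :
    lift (hK := hK) hF hF' (cls hK x) = F x := OrientedChain.lift_cls hF x

variable (hK) in
/-- The boundary of oriented chains. -/
def bdry (n : ℕ) : EquivariantChain hK (n + 1) →ₗ[MonoidAlgebra ℤ G] EquivariantChain hK n :=
  lift (isCochain_cls (hK := hK)).coboundary fun g x => by
    by_cases hx : IsOrderedSimplex K x
    · rw [simplicialCoboundary_of_isOrderedSimplex _ hx,
        simplicialCoboundary_of_isOrderedSimplex _ ((isOrderedSimplex_smul_iff hK g).2 hx),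
        faceSum_apply, faceSum_apply, Finset.smul_sum]
      refine Finset.sum_congr rfl fun j _ => ?_
      rw [smul_comm, single_smul_cls]
      rfl
    · rw [simplicialCoboundary_of_not _ hx,
        simplicialCoboundary_of_not _ (mt (isOrderedSimplex_smul_iff hK g).1 hx), smul_zero]

variable (hK hK') in
/-- The map of oriented chains induced by an equivariant simplicial map. -/
def map (f : W → W') (hf : ∀ (g : G) v, f (g • v) = g • f v) (n : ℕ) :
    EquivariantChain hK n →ₗ[MonoidAlgebra ℤ G] EquivariantChain hK' n :=
  lift (OrientedChain.isCochain_mapTuple K' f n) fun g x => by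
    by_cases hx : IsOrderedSimplex K x
    · rw [OrientedChain.mapTuple, OrientedChain.mapTuple, if_pos hx,
        if_pos ((isOrderedSimplex_smul_iff hK g).2 hx)]
      have : f ∘ (g • x) = g • (f ∘ x) := funext fun i => hf g (x i)
      rw [this]
      exact (single_smul_cls (hK := hK') g (f ∘ x)).symm
    · rw [OrientedChain.mapTuple, OrientedChain.mapTuple, if_neg hx,
        if_neg (mt (isOrderedSimplex_smul_iff hK g).1 hx)]
      exact (smul_zero (A := EquivariantChain hK' n) (MonoidAlgebra.single g (1 : ℤ))).symm

lemma map_cls {f : W → W'} {hf : ∀ (g : G) v, f (g • v) = g • f v} {x : Fin n → W}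
    (hx : IsOrderedSimplex K x) : map hK hK' f hf n (cls hK x) = cls hK' (f ∘ x) :=
  OrientedChain.map_cls hx

lemma map_bdry {f : W → W'} {hf : ∀ (g : G) v, f (g • v) = g • f v}
    (hf' : ∀ σ ∈ K.faces, ∃ τ ∈ K'.faces, ∀ v ∈ σ, f v ∈ τ) (c : EquivariantChain hK (n + 2)) :
    map hK hK' f hf (n + 1) (bdry hK (n + 1) c) = bdry hK' (n + 1) (map hK hK' f hf (n + 2) c) :=
  OrientedChain.map_bdry hf' c

lemma bdry_bdry (c : EquivariantChain hK (n + 2)) : bdry hK n (bdry hK (n + 1) c) = 0 :=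
  OrientedChain.bdry_bdry c

/-! ### Finite generation and projectivity of the chain modules. -/

section Finiteness

variable (hK)

lemma exists_rep_of_finite {T : Set (Finset W)}
    (hT : ∀ σ ∈ K.faces, ∃ g : G, ∃ τ ∈ T, σ = translateFace g τ) {x : Fin n → W}
    (hx : IsOrderedSimplex K x) :
    ∃ g : G, ∃ y : Fin n → W, (∀ i, y i ∈ ⋃ τ ∈ T, (τ : Set W)) ∧ x = g • y := by
  obtain ⟨-, σ, hσ, hr⟩ := hx
  obtain ⟨g, τ, hτ, rfl⟩ := hT σ hσ
  refine ⟨g, g⁻¹ • x, fun i => ?_, (smul_inv_smul g x).symm⟩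
  have hi : x i ∈ translateFace g τ := by rw [← Finset.mem_coe, ← hr]; exact ⟨i, rfl⟩
  obtain ⟨v, hv, h⟩ := mem_translateFace.1 hi
  refine Set.mem_biUnion hτ ?_
  rw [Pi.smul_apply, ← h, inv_smul_smul]
  exact hv

lemma finite_tuples {T : Set (Finset W)} (hT : T.Finite) (n : ℕ) :
    {y : Fin n → W | ∀ i, y i ∈ ⋃ τ ∈ T, (τ : Set W)}.Finite := by
  have : (⋃ τ ∈ T, (τ : Set W)).Finite := hT.biUnion fun τ _ => τ.finite_toSet
  have h := Set.Finite.pi fun _ : Fin n => this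
  exact h.subset fun y hy i _ => hy i

lemma moduleFinite {T : Set (Finset W)} (hTf : T.Finite)
    (hT : ∀ σ ∈ K.faces, ∃ g : G, ∃ τ ∈ T, σ = translateFace g τ) (n : ℕ) :
    Module.Finite (MonoidAlgebra ℤ G) (EquivariantChain hK n) := by
  refine ⟨Submodule.fg_def.2 ⟨_, (finite_tuples hTf n).image (cls hK), ?_⟩⟩
  set S := Submodule.span (MonoidAlgebra ℤ G)
    (cls hK '' {y : Fin n → W | ∀ i, y i ∈ ⋃ τ ∈ T, (τ : Set W)}) with hS
  have h0 : S.mkQ = 0 := hom_ext fun x hx => by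
    obtain ⟨g, y, hy, rfl⟩ := exists_rep_of_finite hT hx
    rw [← single_smul_cls, map_smul, LinearMap.zero_apply, Submodule.mkQ_apply,
      (Submodule.Quotient.mk_eq_zero S).2 (Submodule.subset_span ⟨y, hy, rfl⟩), smul_zero]
  rw [← S.ker_mkQ, h0, LinearMap.ker_zero]

/-- The relation of differing by a translation and a permutation. -/
def orbitSetoid (G W : Type*) [Group G] [MulAction G W] (n : ℕ) : Setoid (Fin n → W) where
  r x y := ∃ (g : G) (π : Equiv.Perm (Fin n)), x = g • (y ∘ π)
  iseqv := {
    refl x := ⟨1, 1, by rw [one_smul]; rfl⟩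
    symm := by
      rintro x y ⟨g, π, rfl⟩
      refine ⟨g⁻¹, π⁻¹, funext fun i => ?_⟩
      simp
    trans := by
      rintro x y z ⟨g, π, rfl⟩ ⟨h, ρ, rfl⟩
      refine ⟨g * h, ρ * π, funext fun i => ?_⟩
      simp [mul_smul] }

/-- The element `g'⁻¹ g` maps the vertex set of the simplex to itself, so it is trivial by freeness
on simplices. The permutations then agree because the vertices are distinct. -/
lemma orbit_unique (hfree : ∀ g : G, ∀ σ ∈ K.faces, translateFace g σ = σ → g = 1)
    {y : Fin n → W} (hy : IsOrderedSimplex K y) {g g' : G} {π π' : Equiv.Perm (Fin n)}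
    (h : g • (y ∘ π) = g' • (y ∘ π')) : g = g' ∧ π = π' := by
  obtain ⟨hinj, σ, hσ, hr⟩ := hy
  have hm : ∀ v, v ∈ σ ↔ ∃ j, y j = v := fun v => by
    rw [← Finset.mem_coe, ← hr, Set.mem_range]
  have h1 : ∀ i, (g'⁻¹ * g) • y (π i) = y (π' i) := fun i => by
    rw [mul_smul, inv_smul_eq_iff]
    exact congrFun h i
  have hg : g'⁻¹ * g = 1 := by
    refine hfree _ σ hσ (Finset.ext fun v => ?_)
    rw [mem_translateFace, hm]
    constructor
    · rintro ⟨w, hw, rfl⟩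
      obtain ⟨j, rfl⟩ := (hm w).1 hw
      exact ⟨π' (π.symm j), by rw [← h1, Equiv.apply_symm_apply]⟩
    · rintro ⟨j, rfl⟩
      exact ⟨y (π (π'.symm j)), (hm _).2 ⟨_, rfl⟩, by rw [h1, Equiv.apply_symm_apply]⟩
  refine ⟨(inv_mul_eq_one.1 hg).symm, Equiv.ext fun i => hinj ?_⟩
  rw [← h1, hg, one_smul]

/-- Modulo `G` and reordering, every simplex has a unique expression through its orbit
representative. A section of a surjection onto the chains is therefore determined by lifting the
representatives and transporting with sign. -/
lemma projective (hfree : ∀ g : G, ∀ σ ∈ K.faces, translateFace g σ = σ → g = 1) (n : ℕ) :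
    Module.Projective (MonoidAlgebra ℤ G) (EquivariantChain hK n) := by
  classical
  refine Module.Projective.of_lifting_property'' fun p hp => ?_
  choose m hm using hp
  let q : (Fin n → W) → (Fin n → W) := fun x => (Quotient.mk (orbitSetoid G W n) x).out
  have hq : ∀ x, ∃ (g : G) (π : Equiv.Perm (Fin n)), x = g • (q x ∘ π) := fun x =>
    (orbitSetoid G W n).symm (Quotient.mk_out (s := orbitSetoid G W n) x)
  have hqq : ∀ x (g : G) (π : Equiv.Perm (Fin n)), q (g • (x ∘ π)) = q x := fun x g π =>
    congrArg Quotient.out (Quotient.sound (s := orbitSetoid G W n) ⟨g, π, rfl⟩)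
  choose a π hx using hq
  have hqo : ∀ x, IsOrderedSimplex K x → IsOrderedSimplex K (q x) := fun x h => by
    rw [hx x, isOrderedSimplex_smul_iff hK, isOrderedSimplex_perm] at h
    exact h
  -- By uniqueness, the translation and the permutation relating `x` to its representative vary
  -- equivariantly with `x`.
  have hkey : ∀ x, IsOrderedSimplex K x → ∀ (g : G) (ρ : Equiv.Perm (Fin n)),
      a (g • (x ∘ ρ)) = g * a x ∧ π (g • (x ∘ ρ)) = π x * ρ := fun x h g ρ => by
    refine orbit_unique hfree (hqo x h) ?_
    have h1 := hx (g • (x ∘ ρ))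
    rw [hqq] at h1
    rw [← h1]
    funext i
    change g • x (ρ i) = (g * a x) • q x (π x (ρ i))
    rw [mul_smul]
    exact congrArg (g • ·) (congrFun (hx x) (ρ i))
  -- `m` is a set-theoretic section of the surjection; it is used only at representatives, so it
  -- need not respect any structure.
  let F : (Fin n → W) → (EquivariantChain hK n →₀ MonoidAlgebra ℤ G) := fun x =>
    if IsOrderedSimplex K x then
      (Equiv.Perm.sign (π x) : ℤ) • MonoidAlgebra.single (a x) (1 : ℤ) • m (cls hK (q x)) else 0
  have hF : IsCochain K F := by
    refine ⟨fun x h => if_neg h, fun x ρ => ?_⟩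
    by_cases h : IsOrderedSimplex K x
    · have h1 := hkey x h 1 ρ
      have h2 := hqq x 1 ρ
      rw [one_smul] at h1 h2
      simp only [F, if_pos h, if_pos ((isOrderedSimplex_perm ρ).2 h), h1, h2, one_mul,
        Equiv.Perm.sign_mul, smul_smul]
      push_cast
      rw [mul_comm]
    · simp only [F, if_neg h, if_neg (mt (isOrderedSimplex_perm ρ).1 h), smul_zero]
  have hF' : ∀ (g : G) x, F (g • x) = MonoidAlgebra.single g (1 : ℤ) • F x := fun g x => by
    by_cases h : IsOrderedSimplex K x
    · have h1 := hkey x h g 1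
      have h2 := hqq x g 1
      have h3 : x ∘ (1 : Equiv.Perm (Fin n)) = x := rfl
      rw [h3] at h1 h2
      simp only [F, if_pos h, if_pos ((isOrderedSimplex_smul_iff hK g).2 h), h1, h2, mul_one]
      rw [smul_comm (MonoidAlgebra.single g (1 : ℤ)), smul_smul (MonoidAlgebra.single g (1 : ℤ)),
        MonoidAlgebra.single_mul_single, one_mul]
    · simp only [F, if_neg h, if_neg (mt (isOrderedSimplex_smul_iff hK g).1 h), smul_zero]
  refine ⟨lift hF hF', hom_ext fun x h => ?_⟩
  have h2 := isCochain_cls (hK := hK).perm (q x) (π x)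
  rw [LinearMap.comp_apply, lift_cls]
  simp only [F, if_pos h]
  rw [map_zsmul, map_smul, hm, smul_comm, ← h2, single_smul_cls, ← hx]
  rfl

end Finiteness

/-! ### Homomorphisms to the group ring as finitely supported cochains. -/

section Coefficients

variable (A : Type v) [Ring A]

open RelativeCohomology

lemma coeff_single_smul (g h : G) (b : coefficients G A) :
    (show MonoidAlgebra A G from MonoidAlgebra.single g (1 : ℤ) • b).coeff h =
      (show MonoidAlgebra A G from b).coeff (g⁻¹ * h) := by
  have : (MonoidAlgebra.single g (1 : ℤ) • b : coefficients G A) =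
      (MonoidAlgebra.single g (1 : A) * (show MonoidAlgebra A G from b) : MonoidAlgebra A G) := by
    refine (ModuleCat.restrictScalars.smul_def _ _ _).trans ?_
    rw [MonoidAlgebra.mapRingHom_single, map_one]
    rfl
  rw [this, MonoidAlgebra.coeff_single_mul_apply, one_mul]

variable {A}

/-- The coefficient at `1` of an element of `A G`, considered as a `ℤG`-module. -/
def coeffOne : coefficients G A →+ A where
  toFun b := (show MonoidAlgebra A G from b).coeff 1
  map_zero' := rfl
  map_add' _ _ := rfl

lemma coeffOne_single_smul (g : G) (b : coefficients G A) :
    coeffOne (MonoidAlgebra.single g (1 : ℤ) • b) = (show MonoidAlgebra A G from b).coeff g⁻¹ := by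
  refine (coeff_single_smul A g 1 b).trans ?_
  rw [mul_one]

/-- The compactly supported cochain corresponding to an equivariant cochain with values
in the group ring. -/
def toCochain (f : EquivariantChain hK n →ₗ[MonoidAlgebra ℤ G] coefficients G A) :
    (Fin n → W) → A := fun x => coeffOne (f (cls hK x))

lemma toCochain_smul (f : EquivariantChain hK n →ₗ[MonoidAlgebra ℤ G] coefficients G A) (g : G)
    (x : Fin n → W) :
    toCochain f (g • x) = (show MonoidAlgebra A G from f (cls hK x)).coeff g⁻¹ := by
  rw [toCochain, ← single_smul_cls, map_smul, coeffOne_single_smul]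

lemma toCochain_add (f f' : EquivariantChain hK n →ₗ[MonoidAlgebra ℤ G] coefficients G A) :
    toCochain (f + f') = toCochain f + toCochain f' :=
  funext fun _ => map_add coeffOne _ _

lemma toCochain_zero :
    toCochain (0 : EquivariantChain hK n →ₗ[MonoidAlgebra ℤ G] coefficients G A) = 0 :=
  funext fun _ => map_zero coeffOne

/-- By equivariance the coefficient of `f x` at `g` is the value of the cochain at `g⁻¹ x`, so no
information is lost by looking at `1` only. -/
lemma toCochain_injective : Function.Injective
    (toCochain : (EquivariantChain hK n →ₗ[MonoidAlgebra ℤ G] coefficients G A) → _) :=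
  fun f f' h => hom_ext fun x _ => by
    refine MonoidAlgebra.ext (R := A) (M := G) (Finsupp.ext fun g => ?_)
    have := congrFun h (g⁻¹ • x)
    rwa [toCochain_smul, toCochain_smul, inv_inv] at this

lemma isCochain_toCochain (f : EquivariantChain hK n →ₗ[MonoidAlgebra ℤ G] coefficients G A) :
    IsCochain K (toCochain f) where
  eq_zero x hx := by rw [toCochain, isCochain_cls.eq_zero x hx, map_zero, map_zero]
  perm x π := by rw [toCochain, isCochain_cls.perm x π, map_zsmul, map_zsmul]; rfl

lemma toCochain_comp_bdry
    (f : EquivariantChain hK n →ₗ[MonoidAlgebra ℤ G] coefficients G A) :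
    toCochain (f ∘ₗ bdry hK n) = simplicialCoboundary K n (toCochain f) :=
  funext fun x => OrientedChain.map_bdry_cls
    (f := (coeffOne.comp f.toAddMonoidHom : EquivariantChain hK n →+ A)) x

lemma toCochain_comp_map {f : W → W'} {hf : ∀ (g : G) v, f (g • v) = g • f v}
    (b : EquivariantChain hK' n →ₗ[MonoidAlgebra ℤ G] coefficients G A) {x : Fin n → W}
    (hx : IsOrderedSimplex K x) :
    toCochain (b ∘ₗ map hK hK' f hf n) x = toCochain b (f ∘ x) := by
  rw [toCochain, LinearMap.comp_apply, map_cls hx, toCochain]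

/-- Up to translation there are finitely many tuples, and for each of them the group ring element `f
x` involves only finitely many translates. -/
lemma finite_support_toCochain {T : Set (Finset W)} (hTf : T.Finite)
    (hT : ∀ σ ∈ K.faces, ∃ g : G, ∃ τ ∈ T, σ = translateFace g τ)
    (f : EquivariantChain hK n →ₗ[MonoidAlgebra ℤ G] coefficients G A) :
    (toCochain f).support.Finite := by
  refine ((finite_tuples hTf n).biUnion (t := fun y => (fun g : G => g⁻¹ • y) ''
    ((show MonoidAlgebra A G from f (cls hK y)).coeff.support : Set G)) fun y _ =>
      (Finset.finite_toSet _).image _).subset fun x hx => ?_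
  have hx' : IsOrderedSimplex K x := by
    by_contra h
    exact hx ((isCochain_toCochain f).eq_zero x h)
  obtain ⟨g, y, hy, rfl⟩ := exists_rep_of_finite hT hx'
  refine Set.mem_biUnion hy ⟨g⁻¹, ?_, by simp⟩
  rw [Function.mem_support, toCochain_smul] at hx
  exact Finset.mem_coe.2 (Finsupp.mem_support_iff.2 hx)

/-- The inverse takes `φ (g⁻¹ x)` as coefficient at `g`. Freeness makes `g ↦ g⁻¹ x` injective on
simplices, so a finitely supported cochain gives finitely many coefficients. -/
lemma exists_toCochain_eq (hK : K.IsInvariant G)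
    (hfree : ∀ g : G, ∀ σ ∈ K.faces, translateFace g σ = σ → g = 1)
    {φ : (Fin n → W) → A} (hφ : IsCochain K φ) (hfin : φ.support.Finite) :
    ∃ f : EquivariantChain hK n →ₗ[MonoidAlgebra ℤ G] coefficients G A, toCochain f = φ := by
  have hinj : ∀ x : Fin n → W, IsOrderedSimplex K x → Function.Injective fun g : G => g⁻¹ • x :=
    fun x hx g g' h => inv_injective (orbit_unique (π := 1) (π' := 1) hfree hx h).1
  have hfin' : ∀ x, (Function.support fun g : G => φ (g⁻¹ • x)).Finite := fun x => by
    by_cases hx : IsOrderedSimplex K x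
    · exact hfin.preimage (hinj x hx).injOn
    · convert Set.finite_empty
      refine Function.support_eq_empty_iff.2 (funext fun g => ?_)
      exact hφ.eq_zero _ (mt (isOrderedSimplex_smul_iff hK _).1 hx)
  let F : (Fin n → W) → coefficients G A := fun x =>
    (MonoidAlgebra.ofCoeff (Finsupp.ofSupportFinite _ (hfin' x)) : MonoidAlgebra A G)
  have hFc : ∀ x g, (show MonoidAlgebra A G from F x).coeff g = φ (g⁻¹ • x) := fun x g => rfl
  have hF : IsCochain K F := by
    refine ⟨fun x hx => MonoidAlgebra.ext (R := A) (M := G) (Finsupp.ext fun g => ?_),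
      fun x π => MonoidAlgebra.ext (R := A) (M := G) (Finsupp.ext fun g => ?_)⟩
    · exact (hFc x g).trans (hφ.eq_zero _ (mt (isOrderedSimplex_smul_iff hK _).1 hx))
    · exact hφ.perm (g⁻¹ • x) π
  have hF' : ∀ (g : G) x, F (g • x) = MonoidAlgebra.single g (1 : ℤ) • F x := fun g x =>
    MonoidAlgebra.ext (R := A) (M := G) (Finsupp.ext fun h => by
      refine Eq.trans ?_ (coeff_single_smul A g h (F x)).symm
      change φ (h⁻¹ • g • x) = φ ((g⁻¹ * h)⁻¹ • x)
      rw [smul_smul, mul_inv_rev, inv_inv])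
  refine ⟨lift hF hF', funext fun x => ?_⟩
  rw [toCochain, lift_cls]
  change φ ((1 : G)⁻¹ • x) = φ x
  rw [inv_one, one_smul]

lemma toCochain_rightMul (f : EquivariantChain hK n →ₗ[MonoidAlgebra ℤ G] coefficients G A) (g : G)
    (a : A) : toCochain ((rightMul G (MonoidAlgebra.single g a)).hom ∘ₗ f) =
      actCochain g a n (toCochain f) := by
  funext x
  change ((show MonoidAlgebra A G from f (cls hK x)) * MonoidAlgebra.single g a).coeff 1 =
    toCochain f (g • x) * a
  rw [MonoidAlgebra.coeff_mul_single_apply, toCochain_smul, one_mul]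

end Coefficients

end EquivariantChain

end GroupRing

/-! ### Low degrees and components -/

open CompactCohomology

namespace OrdChain

variable {W C : Type*} {K : PreAbstractSimplicialComplex W}

/-- Exactness can be checked on unions of components. -/
lemma exists_bdry_eq_of_components (comp : W → C)
    (hcomp : ∀ σ ∈ K.faces, ∀ v ∈ σ, ∀ w ∈ σ, comp v = comp w) {n : ℕ}
    (h : ∀ c, ∀ z ∈ inside {x | x ∈ K.tuples (n + 2) ∧ ∀ j, comp (x j) = c}, bdry (n + 1) z = 0 →
      ∃ w ∈ inside (K.tuples (n + 3)), bdry (n + 2) w = z)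
    {z : OrdChain W (n + 2)} (hz : z ∈ inside (K.tuples (n + 2))) (hb : bdry (n + 1) z = 0) :
    ∃ w ∈ inside (K.tuples (n + 3)), bdry (n + 2) w = z := by
  classical
  have hc : ∀ {m} {x : Fin (m + 1) → W}, x ∈ K.tuples (m + 1) → ∀ j, comp (x j) = comp (x 0) := by
    rintro m x ⟨σ, hσ, hx⟩ j
    exact hcomp σ hσ _ (hx j) _ (hx 0)
  -- The part of a chain over one component; simplices lie in a single component, so this commutes
  -- with the boundary. At least one vertex is needed to speak of a component.
  let pr : C → ∀ m, OrdChain W (m + 1) →ₗ[ℤ] OrdChain W (m + 1) := fun c m =>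
    lift fun x => if comp (x 0) = c then of x else 0
  have hpr : ∀ c, pr c (n + 1) z ∈ inside {x | x ∈ K.tuples (n + 2) ∧ ∀ j, comp (x j) = c} :=
    fun c => map_mem_of_inside (fun x hx => by
      rw [lift_of]
      split_ifs with hxc
      · exact of_mem_inside ⟨hx, fun j => (hc hx j).trans hxc⟩
      · exact Submodule.zero_mem _) hz
  have hprb : ∀ c, bdry (n + 1) (pr c (n + 1) z) = 0 := fun c => by
    have : bdry (n + 1) (pr c (n + 1) z) = pr c n (bdry (n + 1) z) := by
      refine eqOn_inside (f := bdry (n + 1) ∘ₗ pr c (n + 1)) (g := pr c n ∘ₗ bdry (n + 1))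
        (fun x hx => ?_) hz
      rw [LinearMap.comp_apply, LinearMap.comp_apply, lift_of, bdry_of, map_faceSum]
      simp only [pr, lift_of]
      split_ifs with hxc
      · rw [bdry_of, faceSum_apply, faceSum_apply]
        refine Finset.sum_congr rfl fun j _ => ?_
        rw [if_pos (show comp ((x ∘ j.succAbove) 0) = c from (hc hx _).trans hxc)]
      · rw [map_zero, faceSum_apply]
        refine (Finset.sum_eq_zero fun j _ => ?_).symm
        rw [if_neg (show ¬ comp ((x ∘ j.succAbove) 0) = c from
          fun h' => hxc ((hc hx _).symm.trans h')), smul_zero]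
    rw [this, hb, map_zero]
  choose w hw hwb using fun c => h c _ (hpr c) (hprb c)
  let S := z.support.image fun x => comp (x 0)
  refine ⟨∑ c ∈ S, w c, Submodule.sum_mem _ fun c _ => hw c, ?_⟩
  simp only [map_sum, hwb]
  have hz' : z ∈ inside (z.support : Set (Fin (n + 2) → W)) := Finsupp.mem_supported ℤ z |>.2 le_rfl
  refine (LinearMap.sum_apply _ _ _).symm.trans (eqOn_inside (f := ∑ c ∈ S, pr c (n + 1))
    (g := LinearMap.id) (fun x hx => ?_) hz')
  rw [LinearMap.sum_apply, LinearMap.id_apply, Finset.sum_eq_single (comp (x 0))]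
  · rw [lift_of, if_pos rfl]
  · intro c _ hne
    rw [lift_of, if_neg hne.symm]
  · exact fun h' => (h' (Finset.mem_image_of_mem _ hx)).elim

end OrdChain

namespace OrientedChain

variable {W M : Type*} [AddCommGroup M] {K : PreAbstractSimplicialComplex W}

open Classical in
/-- The value on vertices of `vertexMap`. -/
def vertexTuple (K : PreAbstractSimplicialComplex W) (t : W → M) (x : Fin 1 → W) : M :=
  if IsOrderedSimplex K x then t (x 0) else 0

lemma isCochain_vertexTuple (t : W → M) : IsCochain K (vertexTuple K t) where
  eq_zero _ hx := if_neg hx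
  perm x π := by
    rw [Subsingleton.elim π 1, Equiv.Perm.sign_one, Units.val_one, one_smul]
    rfl

/-- The homomorphism on `0`-chains given by a function on vertices. -/
def vertexMap (t : W → M) : OrientedChain K 1 →ₗ[ℤ] M := lift (isCochain_vertexTuple t)

lemma vertexMap_cls {t : W → M} {x : Fin 1 → W} (hx : IsOrderedSimplex K x) :
    vertexMap t (cls K x) = t (x 0) := by
  rw [vertexMap, lift_cls, vertexTuple, if_pos hx]

lemma vertexMap_bdry {t : W → M} (ht : ∀ σ ∈ K.faces, ∀ v ∈ σ, ∀ w ∈ σ, t v = t w)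
    (c : OrientedChain K 2) : vertexMap t (bdry K 1 c) = 0 := by
  refine addHom_ext (f := vertexMap t ∘ₗ bdry K 1) (g := (0 : OrientedChain K 2 →ₗ[ℤ] M))
    (fun x hx => ?_) c
  obtain ⟨σ, hσ, h⟩ := hx.mem_tuples
  rw [LinearMap.comp_apply, bdry_cls hx.mem_tuples, faceSum_apply, Fin.sum_univ_two, map_add,
    map_zsmul, map_zsmul, vertexMap_cls (hx.face 0), vertexMap_cls (hx.face 1),
    show t ((x ∘ Fin.succAbove 0) 0) = t ((x ∘ Fin.succAbove 1) 0) from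
      ht σ hσ _ (h (Fin.succAbove 0 0)) _ (h (Fin.succAbove 1 0))]
  simp

/-- If every vertex is homologous to the image under `s` of its value, then every 0-chain `c` is
homologous to `s (vertexMap t c)`. This computes `H_0` both for `ℤ` and for `ℤG/𝒫`. -/
lemma mem_range_bdry_of_vertexMap_eq_zero {t : W → M} (s : M →+ OrientedChain K 1)
    (h : ∀ x, IsOrderedSimplex K x → cls K x - s (t (x 0)) ∈ LinearMap.range (bdry K 1))
    {c : OrientedChain K 1} (hc : vertexMap t c = 0) : ∃ e, bdry K 1 e = c := by
  have key : ∀ c, c - s (vertexMap t c) ∈ LinearMap.range (bdry K 1) := fun c =>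
    induction (motive := fun c => c - s (vertexMap t c) ∈ LinearMap.range (bdry K 1))
      (by simp)
      (fun a b ha hb => by
        rw [map_add, map_add, add_sub_add_comm]
        exact Submodule.add_mem _ ha hb)
      (fun r a ha => by
        rw [map_zsmul, map_zsmul, ← smul_sub]
        exact Submodule.smul_mem _ r ha)
      (fun x hx => by rw [vertexMap_cls hx]; exact h x hx) c
  have := key c
  rwa [hc, map_zero, sub_zero] at this

lemma cls_sub_cls_mem_range {x y : Fin 1 → W} {w : OrdChain W 2}
    (hw : w ∈ OrdChain.inside (K.tuples 2)) (h : OrdChain.bdry 1 w = OrdChain.of x - OrdChain.of y) :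
    cls K x - cls K y ∈ LinearMap.range (bdry K 1) :=
  ⟨proj K 2 w, by rw [bdry_proj hw, h, map_sub]; rfl⟩

lemma bdry_of_sub_of (x y : Fin 1 → W) :
    OrdChain.bdry 0 (OrdChain.of x - OrdChain.of y) = 0 := by
  rw [map_sub, OrdChain.bdry_of, OrdChain.bdry_of, sub_eq_zero, faceSum_apply, faceSum_apply]
  refine Finset.sum_congr rfl fun j _ => ?_
  rw [Subsingleton.elim (x ∘ j.succAbove) (y ∘ j.succAbove)]

end OrientedChain

lemma PreAbstractSimplicialComplex.IsNConnected.exists_vertex {W : Type w}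
    {K : PreAbstractSimplicialComplex W} {N : ℕ} (h : K.IsNConnected N) : ∃ v, {v} ∈ K.faces := by
  obtain ⟨-, σ, hσ, -⟩ := h.1
  obtain ⟨v, hv⟩ := (K.isRelLowerSet_faces hσ).1
  exact ⟨v, (K.isRelLowerSet_faces hσ).2 (Finset.singleton_subset_iff.2 hv)
    (Finset.singleton_nonempty v)⟩

lemma isOrderedSimplex_of_mem_tuples_one {W : Type*} {K : PreAbstractSimplicialComplex W}
    {x : Fin 1 → W} (hx : x ∈ K.tuples 1) : IsOrderedSimplex K x :=
  isOrderedSimplex_of_mem_tuples (n := 0) hx fun a b _ => Subsingleton.elim (α := Fin 1) a b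

lemma isOrderedSimplex_const {W : Type*} {K : PreAbstractSimplicialComplex W} {v : W}
    (h : {v} ∈ K.faces) : IsOrderedSimplex K fun _ : Fin 1 => v :=
  isOrderedSimplex_of_mem_tuples_one ⟨_, h, fun _ => Finset.mem_singleton_self v⟩

/-! ### The peripheral complex, its components and their exactness. -/

namespace CuspedSpaceData

variable {G : Type u} [Group G] {ι : Type} {P : ι → Subgroup G} {N : ℕ}
  (D : CuspedSpaceData.{u, w} P N)

/-- The preimage of the `B_P` in `E_G`, as a complex on separate copies of the vertices. -/
def peripheralComplex : PreAbstractSimplicialComplex (Σ _ : ι, D.V) where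
  faces := {s | s.Nonempty ∧ ∃ i, ∃ τ ∈ D.peripheralFaces i, ∀ x ∈ s, ∃ v ∈ τ, x = ⟨i, v⟩}
  isRelLowerSet_faces := by
    rintro s ⟨hs, i, τ, hτ, h⟩
    exact ⟨hs, fun t hts ht => ⟨ht, i, τ, hτ, fun x hx => h x (hts hx)⟩⟩

variable {D}

lemma peripheralFaces_subset {i : ι} {τ : Finset D.V} (h : τ ∈ D.peripheralFaces i) :
    τ ∈ D.EG.faces := by
  obtain ⟨g, σ, hσ, rfl⟩ := h
  exact D.EG_invariant g σ (D.EP_le i hσ)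

lemma translateFace_mem_peripheralFaces {i : ι} {τ : Finset D.V} (h : τ ∈ D.peripheralFaces i)
    (g : G) : translateFace g τ ∈ D.peripheralFaces i := by
  obtain ⟨g', σ, hσ, rfl⟩ := h
  refine ⟨g * g', σ, hσ, Finset.ext fun x => ?_⟩
  simp [mem_translateFace, mul_smul]

lemma mem_peripheralComplex_tuples {n : ℕ} {x : Fin n → Σ _ : ι, D.V} :
    x ∈ D.peripheralComplex.tuples n ↔
      ∃ i, ∃ τ ∈ D.peripheralFaces i, ∀ j, ∃ v ∈ τ, x j = ⟨i, v⟩ := by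
  constructor
  · rintro ⟨s, ⟨-, i, τ, hτ, h⟩, hx⟩
    exact ⟨i, τ, hτ, fun j => h _ (hx j)⟩
  · rintro ⟨i, τ, hτ, h⟩
    refine ⟨τ.map (Function.Embedding.sigmaMk i), ⟨?_, i, τ, hτ, fun x hx => ?_⟩, fun j => ?_⟩
    · exact (D.EG.isRelLowerSet_faces (peripheralFaces_subset hτ)).1.map
    · obtain ⟨v, hv, rfl⟩ := Finset.mem_map.1 hx
      exact ⟨v, hv, rfl⟩
    · obtain ⟨v, hv, hj⟩ := h j
      exact Finset.mem_map.2 ⟨v, hv, hj.symm⟩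

variable (D)

lemma peripheralComplex_invariant : D.peripheralComplex.IsInvariant G := by
  rintro g s ⟨hs, i, τ, hτ, h⟩
  refine ⟨by simpa [translateFace] using hs, i, translateFace g τ,
    translateFace_mem_peripheralFaces hτ g, fun x hx => ?_⟩
  obtain ⟨y, hy, rfl⟩ := mem_translateFace.1 hx
  obtain ⟨v, hv, rfl⟩ := h y hy
  exact ⟨g • v, mem_translateFace.2 ⟨v, hv, rfl⟩, rfl⟩

lemma peripheralComplex_free (g : G) (s) (hs : s ∈ D.peripheralComplex.faces)
    (hg : translateFace g s = s) : g = 1 := by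
  classical
  obtain ⟨hne, i, τ, hτ, h⟩ := hs
  refine D.EG_free g (s.image Sigma.snd)
    ((D.EG.isRelLowerSet_faces (peripheralFaces_subset hτ)).2 ?_ (hne.image _)) ?_
  · intro v hv
    obtain ⟨x, hx, rfl⟩ := Finset.mem_image.1 hv
    obtain ⟨v, hv', rfl⟩ := h x hx
    exact hv'
  · ext v
    simp only [mem_translateFace, Finset.mem_image]
    constructor
    · rintro ⟨_, ⟨x, hx, rfl⟩, rfl⟩
      exact ⟨g • x, by rw [← hg]; exact mem_translateFace.2 ⟨x, hx, rfl⟩, rfl⟩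
    · rintro ⟨x, hx, rfl⟩
      rw [← hg] at hx
      obtain ⟨y, hy, rfl⟩ := mem_translateFace.1 hx
      exact ⟨_, ⟨y, hy, rfl⟩, rfl⟩

lemma peripheralComplex_finite [Finite ι] : ∃ T : Set (Finset (Σ _ : ι, D.V)), T.Finite ∧
    ∀ s ∈ D.peripheralComplex.faces, ∃ g : G, ∃ t ∈ T, s = translateFace g t := by
  classical
  obtain ⟨T, hT, h⟩ := D.EG_finite
  refine ⟨Set.image2 (fun (i : ι) τ => τ.map (Function.Embedding.sigmaMk i)) Set.univ T,
    Set.Finite.image2 _ Set.finite_univ hT, ?_⟩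
  rintro s ⟨hne, i, τ, hτ, hs⟩
  have hsub : s.image Sigma.snd ∈ D.EG.faces := by
    refine (D.EG.isRelLowerSet_faces (peripheralFaces_subset hτ)).2 ?_ (hne.image _)
    intro v hv
    obtain ⟨x, hx, rfl⟩ := Finset.mem_image.1 hv
    obtain ⟨v, hv', rfl⟩ := hs x hx
    exact hv'
  obtain ⟨g, ρ, hρ, hg⟩ := h _ hsub
  refine ⟨g, _, ⟨i, Set.mem_univ i, ρ, hρ, rfl⟩, Finset.ext fun x => ?_⟩
  have hmem : ∀ v, v ∈ s.image Sigma.snd ↔ ∃ y ∈ ρ, g • y = v := fun v => by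
    rw [hg, mem_translateFace]
  rw [mem_translateFace]
  constructor
  · intro hx
    obtain ⟨v, hv, rfl⟩ := hs x hx
    obtain ⟨y, hy, rfl⟩ := (hmem v).1 (Finset.mem_image_of_mem _ hx)
    exact ⟨⟨i, y⟩, Finset.mem_map_of_mem _ hy, rfl⟩
  · rintro ⟨z, hz, rfl⟩
    obtain ⟨y, hy, rfl⟩ := Finset.mem_map.1 hz
    obtain ⟨x, hx, hxy⟩ := Finset.mem_image.1 ((hmem (g • y)).2 ⟨y, hy, rfl⟩)
    obtain ⟨v, hv, rfl⟩ := hs x hx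
    have : v = g • y := hxy
    rwa [this] at hx

lemma exists_mem_faces_of_mem_peripheralComplex {s} (hs : s ∈ D.peripheralComplex.faces) :
    ∃ τ ∈ D.EG.faces, ∀ x ∈ s, x.2 ∈ τ := by
  obtain ⟨-, i, τ, hτ, h⟩ := hs
  refine ⟨τ, peripheralFaces_subset hτ, fun x hx => ?_⟩
  obtain ⟨v, hv, rfl⟩ := h x hx
  exact hv

open Classical in
/-- The component of a vertex of the peripheral complex. -/
def component (x : Σ _ : ι, D.V) : Σ i, G ⧸ P i :=
  ⟨x.1, if h : ∃ g : G, {g⁻¹ • x.2} ∈ (D.EP x.1).faces then (h.choose : G ⧸ P x.1)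
    -- A default value for vertices outside all translates of `E_P`; these are not vertices of the
    -- peripheral complex.
    else ((1 : G) : G ⧸ P x.1)⟩

/-- Any two elements moving the vertex back into `E_P` differ by an element of `P i`, by
`EP_separated`; the chosen one therefore gives the right coset. -/
lemma component_smul {i : ι} {v : D.V} (hv : {v} ∈ (D.EP i).faces) (g : G) :
    D.component ⟨i, g • v⟩ = ⟨i, (g : G ⧸ P i)⟩ := by
  have h : ∃ h : G, {h⁻¹ • g • v} ∈ (D.EP i).faces := ⟨g, by rwa [inv_smul_smul]⟩
  refine Sigma.ext rfl (heq_of_eq ?_)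
  simp only [component]
  rw [dif_pos h, eq_comm, QuotientGroup.eq, ← inv_mem_iff]
  have h2 := h.choose_spec
  rw [smul_smul] at h2
  simpa using D.EP_separated i _ v hv h2

lemma component_of_mem {i : ι} {σ : Finset D.V} (hσ : σ ∈ (D.EP i).faces) {v : D.V} (hv : v ∈ σ)
    (g : G) : D.component ⟨i, g • v⟩ = ⟨i, (g : G ⧸ P i)⟩ :=
  D.component_smul (((D.EP i).isRelLowerSet_faces hσ).2 (Finset.singleton_subset_iff.2 hv)
    (Finset.singleton_nonempty v)) g

lemma component_eq (s) (hs : s ∈ D.peripheralComplex.faces) (x) (hx : x ∈ s) (y) (hy : y ∈ s) :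
    D.component x = D.component y := by
  obtain ⟨-, i, τ, ⟨g, σ, hσ, rfl⟩, h⟩ := hs
  have key : ∀ z ∈ s, D.component z = ⟨i, (g : G ⧸ P i)⟩ := fun z hz => by
    obtain ⟨v, hv, rfl⟩ := h z hz
    obtain ⟨y, hy, rfl⟩ := mem_translateFace.1 hv
    exact D.component_of_mem hσ hy g
  rw [key x hx, key y hy]

lemma component_equivariant {x : Σ _ : ι, D.V} (hx : {x} ∈ D.peripheralComplex.faces) (g : G) :
    D.component (g • x) = g • D.component x := by
  obtain ⟨-, i, τ, ⟨g', σ, hσ, rfl⟩, h⟩ := hx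
  obtain ⟨v, hv, rfl⟩ := h x (Finset.mem_singleton_self _)
  obtain ⟨y, hy, rfl⟩ := mem_translateFace.1 hv
  have h1 : g • (⟨i, g' • y⟩ : Σ _ : ι, D.V) = ⟨i, (g * g') • y⟩ := by
    rw [mul_smul]
    rfl
  rw [h1, D.component_of_mem hσ hy, D.component_of_mem hσ hy]
  rfl

/-- If the simplex was given as lying in `g' E_P`, equality of cosets puts `g⁻¹ g'` in `P i`, and
`E_P` is invariant under it. -/
lemma translate_mem_tuples {n : ℕ} {x : Fin (n + 1) → Σ _ : ι, D.V}
    (hx : x ∈ D.peripheralComplex.tuples (n + 1)) {i : ι} {g : G}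
    (h : ∀ j, D.component (x j) = ⟨i, (g : G ⧸ P i)⟩) :
    (fun j => g⁻¹ • (x j).2) ∈ (D.EP i).tuples (n + 1) ∧ ∀ j, (x j).1 = i := by
  obtain ⟨i', τ, ⟨g', σ, hσ, rfl⟩, hx⟩ := mem_peripheralComplex_tuples.1 hx
  have hx' : ∀ j, ∃ v ∈ σ, x j = ⟨i', g' • v⟩ := fun j => by
    obtain ⟨v, hv, hj⟩ := hx j
    obtain ⟨y, hy, rfl⟩ := mem_translateFace.1 hv
    exact ⟨y, hy, hj⟩
  choose y hy hxy using hx'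
  have h0 := h 0
  rw [hxy 0, D.component_of_mem hσ (hy 0)] at h0
  obtain rfl : i' = i := congrArg Sigma.fst h0
  have h1 : (g' : G ⧸ P i') = g := eq_of_heq (Sigma.mk.inj h0).2
  have h2 : g⁻¹ * g' ∈ P i' := QuotientGroup.eq.1 h1.symm
  refine ⟨⟨_, D.EP_invariant i' _ h2 σ hσ, fun j => mem_translateFace.2 ⟨y j, hy j, ?_⟩⟩,
    fun j => by rw [hxy j]⟩
  change _ = g⁻¹ • (x j).2
  rw [hxy j, mul_smul]

lemma EP_card (i : ι) : ∀ σ ∈ (D.EP i).faces, σ.card ≤ N + 2 := fun σ hσ =>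
  D.EG_dim σ (D.EP_le i hσ)

/-- The component belonging to `gP` is a copy of `E_P`: translate by `g⁻¹`, fill there, and
translate back. -/
lemma exists_bdry_eq_of_component {n : ℕ} (hn : n ≤ N) (c : Σ i, G ⧸ P i)
    (z : OrdChain (Σ _ : ι, D.V) (n + 1))
    (hz : z ∈ OrdChain.inside {x | x ∈ D.peripheralComplex.tuples (n + 1) ∧
      ∀ j, D.component (x j) = c}) (hb : OrdChain.bdry n z = 0) :
    ∃ w ∈ OrdChain.inside (D.peripheralComplex.tuples (n + 2)), OrdChain.bdry (n + 1) w = z := by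
  obtain ⟨i, q⟩ := c
  obtain ⟨g, rfl⟩ := QuotientGroup.mk_surjective q
  let a : (Σ _ : ι, D.V) → D.V := fun x => g⁻¹ • x.2
  let b : D.V → Σ _ : ι, D.V := fun v => ⟨i, g • v⟩
  have hz1 : OrdChain.map a (n + 1) z ∈ OrdChain.inside ((D.EP i).tuples (n + 1)) :=
    OrdChain.map_mem_inside (fun x hx => (D.translate_mem_tuples hx.1 hx.2).1) hz
  have hz2 : OrdChain.map b (n + 1) (OrdChain.map a (n + 1) z) = z := by
    refine OrdChain.eqOn_inside (f := OrdChain.map b (n + 1) ∘ₗ OrdChain.map a (n + 1))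
      (g := LinearMap.id) (fun x hx => ?_) hz
    rw [LinearMap.comp_apply, OrdChain.map_of, OrdChain.map_of, LinearMap.id_apply]
    congr 1
    funext j
    refine Sigma.ext ((D.translate_mem_tuples hx.1 hx.2).2 j).symm (heq_of_eq ?_)
    exact smul_inv_smul g _
  obtain ⟨w, hw, hwb⟩ := PreAbstractSimplicialComplex.exists_bdry_eq_of_isNConnected
    (D.EP_card i) (D.EP_connected i) (n := n + 1) (by omega) hz1
    (by change OrdChain.bdry n _ = 0; rw [← OrdChain.map_bdry, hb, map_zero])
  refine ⟨OrdChain.map b (n + 2) w, OrdChain.map_mem_inside (fun x hx => ?_) hw, ?_⟩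
  · obtain ⟨σ, hσ, hx⟩ := hx
    exact mem_peripheralComplex_tuples.2 ⟨i, _, ⟨g, σ, hσ, rfl⟩, fun j =>
      ⟨g • x j, mem_translateFace.2 ⟨x j, hx j, rfl⟩, rfl⟩⟩
  · rw [← OrdChain.map_bdry, hwb, hz2]

/-! ### The chain modules of the cusped space data -/

/-- Chains of `E_G`. -/
abbrev GChain (n : ℕ) := EquivariantChain D.EG_invariant n

/-- Chains of the peripheral complex. -/
abbrev PChain (n : ℕ) := EquivariantChain D.peripheralComplex_invariant n

lemma GChain_exact {n : ℕ} (hn : n + 2 ≤ N + 1) {c : D.GChain (n + 2)}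
    (hc : EquivariantChain.bdry D.EG_invariant (n + 1) c = 0) :
    ∃ e, EquivariantChain.bdry D.EG_invariant (n + 2) e = c :=
  OrientedChain.exists_bdry_eq (fun _ hz hb =>
    PreAbstractSimplicialComplex.exists_bdry_eq_of_isNConnected D.EG_dim D.EG_connected hn hz hb) hc

lemma PChain_exact {n : ℕ} (hn : n + 2 ≤ N + 1) {c : D.PChain (n + 2)}
    (hc : EquivariantChain.bdry D.peripheralComplex_invariant (n + 1) c = 0) :
    ∃ e, EquivariantChain.bdry D.peripheralComplex_invariant (n + 2) e = c :=
  OrientedChain.exists_bdry_eq (fun _ hz hb =>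
    OrdChain.exists_bdry_eq_of_components D.component D.component_eq
      (fun c z hz hb => D.exists_bdry_eq_of_component (n := n + 1) (by omega) c z hz hb) hz hb) hc

/-- The augmentation of the chains of `E_G`. -/
def augG : D.GChain 1 →ₗ[ℤ] ℤ := OrientedChain.vertexMap fun _ => (1 : ℤ)

lemma augG_bdry (c : D.GChain 2) : D.augG (EquivariantChain.bdry D.EG_invariant 1 c) = 0 :=
  OrientedChain.vertexMap_bdry (fun _ _ _ _ _ _ => rfl) c

/-- Connectedness of `E_G`: each vertex is homologous to the base vertex `v₀`. -/
lemma exists_bdry_eq_of_augG {c : D.GChain 1} (hc : D.augG c = 0) :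
    ∃ e, EquivariantChain.bdry D.EG_invariant 1 e = c := by
  obtain ⟨v₀, hv₀⟩ := D.EG_connected.exists_vertex
  refine OrientedChain.mem_range_bdry_of_vertexMap_eq_zero
    ((smulAddHom ℤ _).flip (OrientedChain.cls D.EG fun _ => v₀)) (fun x hx => ?_) hc
  have h1 : (smulAddHom ℤ _).flip (OrientedChain.cls D.EG fun _ : Fin 1 => v₀) (1 : ℤ) =
      OrientedChain.cls D.EG fun _ => v₀ := one_smul ℤ (OrientedChain.cls D.EG fun _ : Fin 1 => v₀)
  rw [h1]
  obtain ⟨w, hw, hb⟩ := PreAbstractSimplicialComplex.exists_bdry_eq_of_isNConnected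
    D.EG_dim D.EG_connected (n := 1) (by omega)
    (z := OrdChain.of x - OrdChain.of fun _ => v₀)
    (Submodule.sub_mem _ (OrdChain.of_mem_inside hx.mem_tuples)
      (OrdChain.of_mem_inside (isOrderedSimplex_const hv₀).mem_tuples))
    (OrientedChain.bdry_of_sub_of _ _)
  exact OrientedChain.cls_sub_cls_mem_range hw hb

/-- The map from peripheral `0`-chains to `ℤG/𝒫`. -/
def toCosets : D.PChain 1 →ₗ[MonoidAlgebra ℤ G] (RelativeCohomology.cosetRep P).asModule :=
  EquivariantChain.lift (X := (RelativeCohomology.cosetRep P).asModule)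
    (OrientedChain.isCochain_vertexTuple (M := MonoidAlgebra ℤ (Σ i, G ⧸ P i))
      fun v => MonoidAlgebra.single (D.component v) (1 : ℤ)) fun g x => by
    have hsmul : ∀ y : (RelativeCohomology.cosetRep P).asModule,
        MonoidAlgebra.single g (1 : ℤ) • y = RelativeCohomology.cosetRep P g y := fun y => by
      rw [Representation.single_smul, one_smul]
      rfl
    refine Eq.trans ?_ (hsmul _).symm
    by_cases hx : IsOrderedSimplex D.peripheralComplex x
    · have h1 : {x 0} ∈ D.peripheralComplex.faces := by
        obtain ⟨s, hs, h⟩ := hx.mem_tuples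
        exact (D.peripheralComplex.isRelLowerSet_faces hs).2
          (Finset.singleton_subset_iff.2 (h 0)) (Finset.singleton_nonempty _)
      rw [OrientedChain.vertexTuple, OrientedChain.vertexTuple, if_pos hx,
        if_pos ((isOrderedSimplex_smul_iff D.peripheralComplex_invariant g).2 hx),
        Representation.ofMulAction_single, Pi.smul_apply, D.component_equivariant h1]
    · rw [OrientedChain.vertexTuple, OrientedChain.vertexTuple, if_neg hx,
        if_neg (mt (isOrderedSimplex_smul_iff D.peripheralComplex_invariant g).1 hx)]
      exact (map_zero _).symm

lemma toCosets_eq (c : D.PChain 1) : D.toCosets c =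
    OrientedChain.vertexMap (fun v => MonoidAlgebra.single (D.component v) (1 : ℤ)) c := rfl

lemma toCosets_bdry (c : D.PChain 2) :
    D.toCosets (EquivariantChain.bdry D.peripheralComplex_invariant 1 c) = 0 :=
  OrientedChain.vertexMap_bdry
    (fun s hs v hv w hw => by rw [D.component_eq s hs v hv w hw]) c

lemma exists_component_eq (c : Σ i, G ⧸ P i) :
    ∃ x, {x} ∈ D.peripheralComplex.faces ∧ D.component x = c := by
  obtain ⟨i, q⟩ := c
  obtain ⟨g, rfl⟩ := QuotientGroup.mk_surjective q
  obtain ⟨v, hv⟩ := (D.EP_connected i).exists_vertex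
  refine ⟨⟨i, g • v⟩, ⟨Finset.singleton_nonempty _, i, _, ⟨g, _, hv, rfl⟩, fun x hx => ?_⟩,
    D.component_smul hv g⟩
  exact ⟨g • v, mem_translateFace.2 ⟨v, Finset.mem_singleton_self v, rfl⟩,
    Finset.mem_singleton.1 hx⟩

/-- A section of the map from peripheral `0`-chains to `ℤG/𝒫`. -/
def cosetSection : MonoidAlgebra ℤ (Σ i, G ⧸ P i) →ₗ[ℤ] OrientedChain D.peripheralComplex 1 :=
  Finsupp.linearCombination ℤ (fun c => OrientedChain.cls D.peripheralComplex
    fun _ : Fin 1 => (D.exists_component_eq c).choose) ∘ₗ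
      (MonoidAlgebra.coeffLinearEquiv ℤ).toLinearMap

lemma cosetSection_single (c : Σ i, G ⧸ P i) (r : ℤ) :
    D.cosetSection (MonoidAlgebra.single c r) = r • OrientedChain.cls D.peripheralComplex
      fun _ : Fin 1 => (D.exists_component_eq c).choose := by
  simp [cosetSection]

lemma toCosets_surjective : Function.Surjective D.toCosets := fun y => by
  refine ⟨D.cosetSection y, ?_⟩
  induction y using MonoidAlgebra.induction_linear with
  | zero => exact (congrArg _ (map_zero D.cosetSection)).trans (map_zero D.toCosets)
  | add a b ha hb =>
    exact (congrArg _ (map_add D.cosetSection a b)).trans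
      ((map_add D.toCosets (D.cosetSection a) (D.cosetSection b)).trans (congrArg₂ _ ha hb))
  | single c r =>
    obtain ⟨h1, h2⟩ := (D.exists_component_eq c).choose_spec
    refine (toCosets_eq D _).trans ?_
    rw [cosetSection_single, map_zsmul,
      OrientedChain.vertexMap_cls (isOrderedSimplex_const h1), h2]
    exact (MonoidAlgebra.smul_single r c (1 : ℤ)).trans (by rw [smul_eq_mul, mul_one])

/-- Each component `gE_P` is connected, so each vertex is homologous to the chosen vertex of its
coset; hence `H_0` of the peripheral complex is `ℤG/𝒫`. -/
lemma exists_bdry_eq_of_toCosets {c : D.PChain 1} (hc : D.toCosets c = 0) :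
    ∃ e, EquivariantChain.bdry D.peripheralComplex_invariant 1 e = c := by
  refine OrientedChain.mem_range_bdry_of_vertexMap_eq_zero
    D.cosetSection.toAddMonoidHom (fun x hx => ?_) hc
  obtain ⟨h1, h2⟩ := (D.exists_component_eq (D.component (x 0))).choose_spec
  have h3 : D.cosetSection.toAddMonoidHom (MonoidAlgebra.single (D.component (x 0)) (1 : ℤ)) =
      OrientedChain.cls D.peripheralComplex
        fun _ : Fin 1 => (D.exists_component_eq (D.component (x 0))).choose :=
    (D.cosetSection_single _ 1).trans (one_smul ℤ _)
  rw [h3]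
  obtain ⟨w, hw, hb⟩ := D.exists_bdry_eq_of_component (n := 0) (Nat.zero_le _)
    (D.component (x 0)) (OrdChain.of x - OrdChain.of fun _ =>
      (D.exists_component_eq (D.component (x 0))).choose)
    (Submodule.sub_mem _
      (OrdChain.of_mem_inside ⟨hx.mem_tuples, fun j => by rw [Subsingleton.elim (α := Fin 1) j 0]⟩)
      (OrdChain.of_mem_inside ⟨(isOrderedSimplex_const h1).mem_tuples, fun _ => h2⟩))
    (OrientedChain.bdry_of_sub_of _ _)
  exact OrientedChain.cls_sub_cls_mem_range hw hb

/-- The map from peripheral chains to chains of `E_G`. -/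
def inclP (n : ℕ) : D.PChain n →ₗ[MonoidAlgebra ℤ G] D.GChain n :=
  EquivariantChain.map D.peripheralComplex_invariant D.EG_invariant Sigma.snd (fun _ _ => rfl) n

lemma inclP_bdry {n : ℕ} (c : D.PChain (n + 2)) :
    D.inclP (n + 1) (EquivariantChain.bdry D.peripheralComplex_invariant (n + 1) c) =
      EquivariantChain.bdry D.EG_invariant (n + 1) (D.inclP (n + 2) c) :=
  EquivariantChain.map_bdry (fun _ hs => D.exists_mem_faces_of_mem_peripheralComplex hs) c

/-- On `H_0`, the inclusion of the peripheral complex into `E_G` is the augmentation `ℤG/𝒫 → ℤ`.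
This is where `Δ` enters. -/
lemma augmentation_toCosets (c : D.PChain 1) :
    RelativeCohomology.augmentation P (D.toCosets c) = D.augG (D.inclP 1 c) := by
  refine EquivariantChain.addHom_ext
    (f := (RelativeCohomology.augmentation P).toAddMonoidHom.comp D.toCosets.toAddMonoidHom)
    (g := D.augG.toAddMonoidHom.comp (D.inclP 1).toAddMonoidHom) (fun x hx => ?_) c
  have h1 : IsOrderedSimplex D.EG (Sigma.snd ∘ x) := by
    obtain ⟨s, hs, h⟩ := hx.mem_tuples
    obtain ⟨τ, hτ, h'⟩ := D.exists_mem_faces_of_mem_peripheralComplex hs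
    exact isOrderedSimplex_of_mem_tuples_one ⟨τ, hτ, fun j => h' _ (h j)⟩
  change RelativeCohomology.augmentation P (OrientedChain.vertexMap
    (fun v => MonoidAlgebra.single (D.component v) (1 : ℤ))
    (OrientedChain.cls D.peripheralComplex x)) = OrientedChain.vertexMap (fun _ => (1 : ℤ))
      (OrientedChain.map D.EG Sigma.snd 1 (OrientedChain.cls D.peripheralComplex x))
  rw [OrientedChain.vertexMap_cls hx, OrientedChain.map_cls hx, OrientedChain.vertexMap_cls h1,
    RelativeCohomology.augmentation_single]

end CuspedSpaceData

/-! ### Ext groups from partial resolutions -/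

section ExtShift

open Abelian

universe u' v' w'

variable {C : Type u'} [Category.{v'} C] [Abelian C] [HasExt.{w'} C]

/-- Precomposition with `e` shifts `Ext` degrees, bijectively in positive degrees. -/
structure IsExtShift {X K : C} {j : ℕ} (e : Ext X K j) : Prop where
  surj : ∀ {A : C} {m c : ℕ} (h : j + m = c) (y : Ext X A c), ∃ x : Ext K A m, e.comp x h = y
  inj : ∀ {A : C} {m c : ℕ} (h : j + (m + 1) = c) (x : Ext K A (m + 1)), e.comp x h = 0 → x = 0

lemma exists_mk₀_eq {X Y : C} (x : Ext X Y 0) : ∃ f : X ⟶ Y, Ext.mk₀ f = x :=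
  Ext.homEquiv₀.symm.surjective x

variable {S : ShortComplex C}

/-- The long exact sequence: `Ext` out of the projective quotient vanishes in positive degrees. In
degree 0 there is a kernel, described by the next lemma. -/
lemma isExtShift_mk₀ (hS : S.ShortExact) [Projective S.X₃] : IsExtShift (Ext.mk₀ S.f) where
  surj := by
    intro A m c h y
    obtain rfl : m = c := by omega
    exact Ext.contravariant_sequence_exact₁ hS A y (n₁ := m + 1) (by omega)
      (Ext.eq_zero_of_projective _)
  inj := by
    intro A m c h x hx
    obtain rfl : m + 1 = c := by omega
    obtain ⟨x₁, rfl⟩ := Ext.contravariant_sequence_exact₂ hS A x hx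
    rw [Ext.eq_zero_of_projective x₁, Ext.comp_zero]

lemma mk₀_comp_mk₀_eq_zero_iff (hS : S.ShortExact) {A : C} (f : S.X₂ ⟶ A) :
    (Ext.mk₀ S.f).comp (Ext.mk₀ f) (add_zero 0) = 0 ↔ ∃ h : S.X₃ ⟶ A, S.g ≫ h = f := by
  constructor
  · intro h
    obtain ⟨x, hx⟩ := Ext.contravariant_sequence_exact₂ hS A (Ext.mk₀ f) h
    obtain ⟨a, rfl⟩ := exists_mk₀_eq x
    rw [Ext.mk₀_comp_mk₀] at hx
    exact ⟨a, Ext.homEquiv₀.symm.injective hx⟩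
  · rintro ⟨h, rfl⟩
    rw [Ext.mk₀_comp_mk₀, S.zero_assoc, Limits.zero_comp, Ext.mk₀_zero]

variable (hS : S.ShortExact) {X : C} {j : ℕ} {e : Ext X S.X₃ j}

/-- The connecting map is onto because `Ext` out of the projective middle term vanishes in positive
degrees, and it is injective except in degree 0. Composition raises the degree by one, so `e` is
used only where it is bijective or, for surjectivity, onto. -/
lemma IsExtShift.comp_extClass [Projective S.X₂] (he : IsExtShift e) : IsExtShift (e.comp hS.extClass rfl) where
  surj := by
    intro A m c h y
    obtain ⟨x, hx⟩ := he.surj (A := A) (m := m + 1) (by omega) y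
    obtain ⟨x₁, rfl⟩ := Ext.contravariant_sequence_exact₃ hS A x
      (Ext.eq_zero_of_projective _) (n₀ := m) (by omega)
    exact ⟨x₁, (Ext.comp_assoc e hS.extClass x₁ rfl (by omega) h).trans hx⟩
  inj := by
    intro A m c h x hx
    rw [Ext.comp_assoc e hS.extClass x rfl (show 1 + (m + 1) = m + 1 + 1 by omega) h] at hx
    obtain ⟨x₂, rfl⟩ := Ext.contravariant_sequence_exact₁ hS A x _ (he.inj _ _ hx)
    rw [Ext.eq_zero_of_projective x₂, Ext.comp_zero]

/-- Injectivity of `e` in degree 1 removes `e`; a homomorphism killed by the connecting map is one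
that extends to the middle term. -/
lemma IsExtShift.comp_extClass_comp_mk₀_eq_zero_iff (he : IsExtShift e) {A : C} (f : S.X₁ ⟶ A) :
    (e.comp hS.extClass rfl).comp (Ext.mk₀ f) (add_zero (j + 1)) = 0 ↔
      ∃ h : S.X₂ ⟶ A, S.f ≫ h = f := by
  rw [Ext.comp_assoc e hS.extClass (Ext.mk₀ f) rfl (add_zero 1) (by omega)]
  constructor
  · intro h
    obtain ⟨x, hx⟩ := Ext.contravariant_sequence_exact₁ hS A (Ext.mk₀ f) (add_zero 1)
      (he.inj (m := 0) _ _ h)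
    obtain ⟨a, rfl⟩ := exists_mk₀_eq x
    rw [Ext.mk₀_comp_mk₀] at hx
    exact ⟨a, Ext.homEquiv₀.symm.injective hx⟩
  · rintro ⟨h, rfl⟩
    rw [← Ext.mk₀_comp_mk₀, ← Ext.comp_assoc_of_second_deg_zero, hS.extClass_comp, Ext.zero_comp,
      Ext.comp_zero]

end ExtShift

/-! ### Small copies of modules, in the universe where `Ext` is formed. -/

section Resolution

variable {R : Type u} [Ring R]

/-- A small copy of a module. -/
abbrev smallModule (X : Type w) [AddCommGroup X] [Module R X] [Small.{max u v} X] :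
    ModuleCat.{max u v} R := ModuleCat.of R (Shrink.{max u v} X)

universe w₁ w₂ w₃

variable {X : Type w₁} {Y : Type w₂} {Z : Type w₃} [AddCommGroup X] [Module R X] [Small.{max u v} X] [AddCommGroup Y]
  [Module R Y] [Small.{max u v} Y] [AddCommGroup Z] [Module R Z] [Small.{max u v} Z]

/-- The inverse of `ofSmall`. -/
def toSmall (X : Type w) [AddCommGroup X] [Module R X] [Small.{max u v} X] :
    X ≃ₗ[R] smallModule.{u, v} (R := R) X := (Shrink.linearEquiv R X).symm

/-- Maps from the small copy of a module. -/
def fromSmall {A : ModuleCat.{max u v} R} (f : X →ₗ[R] A) : smallModule.{u, v} (R := R) X ⟶ A :=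
  ModuleCat.ofHom (f ∘ₗ (toSmall.{u, v} X).symm.toLinearMap)

lemma fromSmall_toSmall {A : ModuleCat.{max u v} R} (f : X →ₗ[R] A) (x : X) :
    (fromSmall.{u, v} f).hom (toSmall.{u, v} X x) = f x :=
  congrArg f ((toSmall.{u, v} X).symm_apply_apply x)

lemma small_hom_ext {A : ModuleCat.{max u v} R} {f g : smallModule.{u, v} (R := R) X ⟶ A}
    (h : ∀ x, f.hom (toSmall.{u, v} X x) = g.hom (toSmall.{u, v} X x)) : f = g :=
  ModuleCat.hom_ext (LinearMap.ext fun y => by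
    obtain ⟨x, rfl⟩ := (toSmall.{u, v} (R := R) X).surjective y
    exact h x)

instance projective_smallModule [Module.Projective R X] :
    Projective (smallModule.{u, v} (R := R) X) :=
  (IsProjective.iff_projective _).1 (Module.Projective.of_equiv (toSmall.{u, v} X))

/-- The short complex given by two maps of modules. -/
def smallComplex (f : X →ₗ[R] Y) (g : Y →ₗ[R] Z) (h : g ∘ₗ f = 0) :
    ShortComplex (ModuleCat.{max u v} R) :=
  ShortComplex.mk (X₁ := smallModule.{u, v} X) (X₂ := smallModule.{u, v} Y)
    (X₃ := smallModule.{u, v} Z)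
    (fromSmall.{u, v} ((toSmall.{u, v} Y).toLinearMap ∘ₗ f))
    (fromSmall.{u, v} ((toSmall.{u, v} Z).toLinearMap ∘ₗ g)) (small_hom_ext fun x => by
      rw [ModuleCat.comp_apply, fromSmall_toSmall]
      refine (fromSmall_toSmall.{u, v} ((toSmall.{u, v} Z).toLinearMap ∘ₗ g) (f x)).trans ?_
      have h0 : g (f x) = 0 := LinearMap.congr_fun h x
      rw [LinearMap.comp_apply, h0, map_zero]
      rfl)

lemma smallComplex_shortExact {f : X →ₗ[R] Y} {g : Y →ₗ[R] Z} (h : g ∘ₗ f = 0)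
    (hf : Function.Injective f) (hg : Function.Surjective g) (hfg : Function.Exact f g) :
    (smallComplex.{u, v} f g h).ShortExact where
  exact := by
    rw [ShortComplex.moduleCat_exact_iff]
    intro y hy
    obtain ⟨y, rfl⟩ := (toSmall.{u, v} (R := R) Y).surjective y
    have hy' := (fromSmall_toSmall.{u, v} ((toSmall.{u, v} Z).toLinearMap ∘ₗ g) y).symm.trans hy
    obtain ⟨x, rfl⟩ := (hfg y).1 ((toSmall.{u, v} Z).map_eq_zero_iff.1 hy')
    exact ⟨toSmall.{u, v} X x, fromSmall_toSmall.{u, v} _ x⟩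
  mono_f := (ModuleCat.mono_iff_injective _).2 fun x x' hx => by
    obtain ⟨x, rfl⟩ := (toSmall.{u, v} (R := R) X).surjective x
    obtain ⟨x', rfl⟩ := (toSmall.{u, v} (R := R) X).surjective x'
    have h1 := (fromSmall_toSmall.{u, v} ((toSmall.{u, v} Y).toLinearMap ∘ₗ f) x).symm.trans
      (hx.trans (fromSmall_toSmall.{u, v} ((toSmall.{u, v} Y).toLinearMap ∘ₗ f) x'))
    exact congrArg _ (hf ((toSmall.{u, v} Y).injective h1))
  epi_g := (ModuleCat.epi_iff_surjective _).2 fun z => by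
    obtain ⟨z, rfl⟩ := (toSmall.{u, v} (R := R) Z).surjective z
    obtain ⟨y, rfl⟩ := hg z
    exact ⟨toSmall.{u, v} Y y, fromSmall_toSmall.{u, v} _ y⟩

end Resolution

/-! ### Dimension shifting along a complex of projectives. -/

section Resolution

open Abelian

universe w₁ w₂ w₃

variable {R : Type u} [Ring R]

lemma exists_fromSmall_comp_iff {X : Type w₁} {Y : Type w₂} [AddCommGroup X] [Module R X]
    [Small.{max u v} X] [AddCommGroup Y] [Module R Y] [Small.{max u v} Y]
    {A : ModuleCat.{max u v} R} (f : X →ₗ[R] Y) (φ : smallModule.{u, v} (R := R) X ⟶ A) :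
    (∃ h : smallModule.{u, v} (R := R) Y ⟶ A,
      fromSmall.{u, v} ((toSmall.{u, v} Y).toLinearMap ∘ₗ f) ≫ h = φ) ↔
      ∃ h : Y →ₗ[R] A, ∀ x, h (f x) = φ.hom (toSmall.{u, v} X x) := by
  constructor
  · rintro ⟨h, rfl⟩
    refine ⟨h.hom ∘ₗ (toSmall.{u, v} Y).toLinearMap, fun x => ?_⟩
    rw [ModuleCat.comp_apply, fromSmall_toSmall]
    rfl
  · rintro ⟨h, hh⟩
    refine ⟨fromSmall.{u, v} h, small_hom_ext fun x => ?_⟩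
    rw [ModuleCat.comp_apply, fromSmall_toSmall, ← hh]
    exact fromSmall_toSmall.{u, v} h (f x)

variable {M : ℕ → Type w} [∀ n, AddCommGroup (M n)] [∀ n, Module R (M n)] (d : ∀ n, M (n + 1) →ₗ[R] M n)

/-- The cokernels of the differentials of a complex. -/
abbrev complexCoker (k : ℕ) := M k ⧸ LinearMap.range (d k)

instance small_complexCoker [∀ n, Small.{max u v} (M n)] (k : ℕ) : Small.{max u v} (complexCoker d k) :=
  small_of_surjective (Submodule.mkQ_surjective _)

variable {d} (hdd : ∀ n x, d n (d (n + 1) x) = 0)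

/-- The maps induced by the differentials of a complex on their cokernels. -/
def cokerMap (k : ℕ) : complexCoker d (k + 1) →ₗ[R] M k :=
  (LinearMap.range (d (k + 1))).liftQ (d k) (by
    rintro _ ⟨x, rfl⟩
    exact hdd k x)

/-- Exactness of the complex is needed only for injectivity on the left; the rest holds for any
complex. -/
lemma cokerMap_shortExact [∀ n, Small.{max u v} (M n)] {k : ℕ} (hex : ∀ x, d k x = 0 → x ∈ LinearMap.range (d (k + 1))) :
    (smallComplex.{u, v} (cokerMap hdd k) (LinearMap.range (d k)).mkQ (by
      refine LinearMap.ext fun y => ?_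
      obtain ⟨x, rfl⟩ := Submodule.mkQ_surjective _ y
      exact (Submodule.Quotient.mk_eq_zero _).2 ⟨x, rfl⟩)).ShortExact := by
  refine smallComplex_shortExact _ ?_ (Submodule.mkQ_surjective _) fun y => ?_
  · refine (injective_iff_map_eq_zero _).2 fun y hy => ?_
    obtain ⟨x, rfl⟩ := Submodule.mkQ_surjective _ y
    exact (Submodule.Quotient.mk_eq_zero _).2 (hex x hy)
  · rw [Submodule.mkQ_apply, Submodule.Quotient.mk_eq_zero]
    constructor
    · rintro ⟨x, rfl⟩
      exact ⟨Submodule.Quotient.mk x, rfl⟩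
    · rintro ⟨z, rfl⟩
      obtain ⟨x, rfl⟩ := Submodule.mkQ_surjective _ z
      exact ⟨x, rfl⟩

/-- The inclusion of the first homology of a complex into a cokernel. -/
lemma exists_homology_inclusion {Δ : Type w₁} [AddCommGroup Δ] [Module R Δ]
    (hd : Function.Surjective (d 0))
    (q : LinearMap.ker (d 0) →ₗ[R] Δ) (hq : Function.Surjective q)
    (hqk : ∀ z, q z = 0 ↔ (z : M 1) ∈ LinearMap.range (d 1)) :
    ∃ i : Δ →ₗ[R] complexCoker d 1, Function.Injective i ∧ Function.Exact i (cokerMap hdd 0) ∧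
      Function.Surjective (cokerMap hdd 0) := by
  let p : LinearMap.ker (d 0) →ₗ[R] complexCoker d 1 :=
    (LinearMap.range (d 1)).mkQ ∘ₗ (LinearMap.ker (d 0)).subtype
  have hp : ∀ z, p z = 0 ↔ q z = 0 := fun z =>
    (Submodule.Quotient.mk_eq_zero _).trans (hqk z).symm
  let i : Δ →ₗ[R] complexCoker d 1 := (LinearMap.ker q).liftQ p (fun z hz => (hp z).2 hz) ∘ₗ
    (q.quotKerEquivOfSurjective hq).symm.toLinearMap
  have hi : ∀ z, i (q z) = p z := fun z => by
    have : (q.quotKerEquivOfSurjective hq).symm (q z) = Submodule.Quotient.mk z :=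
      (LinearEquiv.symm_apply_eq _).2 rfl
    rw [LinearMap.comp_apply, LinearEquiv.coe_coe, this]
    rfl
  refine ⟨i, (injective_iff_map_eq_zero _).2 fun y hy => ?_, fun y => ⟨fun hy => ?_, ?_⟩,
    fun y => ?_⟩
  · obtain ⟨z, rfl⟩ := hq y
    rwa [hi, hp] at hy
  · obtain ⟨x, rfl⟩ := Submodule.mkQ_surjective _ y
    exact ⟨q ⟨x, hy⟩, hi _⟩
  · rintro ⟨δ, rfl⟩
    obtain ⟨z, rfl⟩ := hq δ
    rw [hi]
    exact z.2
  · obtain ⟨x, rfl⟩ := hd y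
    exact ⟨Submodule.Quotient.mk x, rfl⟩

variable [∀ n, Small.{max u v} (M n)] [∀ n, Module.Projective R (M n)] {Δ : ModuleCat.{max u v} R}

/-- The start is `0 → Δ → coker (d 1) → M 0 → 0`, which exists because the homology is zero at `M 0`
and `Δ` at `M 1`. Each further step splices on `0 → coker (d (k + 2)) → M (k + 1) → coker (d (k +
1)) → 0`, whose injectivity is exactness at `M (k + 2)`. -/
lemma exists_isExtShift (hd : Function.Surjective (d 0))
    (q : LinearMap.ker (d 0) →ₗ[R] Δ) (hq : Function.Surjective q)
    (hqk : ∀ z, q z = 0 ↔ (z : M 1) ∈ LinearMap.range (d 1)) {N : ℕ}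
    (hex : ∀ n, n + 2 ≤ N → ∀ x, d (n + 1) x = 0 → x ∈ LinearMap.range (d (n + 2))) :
    ∀ k, k + 1 ≤ N → ∃ e : Ext.{max u v} Δ (smallModule.{u, v} (complexCoker d (k + 1))) k,
      IsExtShift e ∧ ∀ (A : ModuleCat.{max u v} R)
        (f : smallModule.{u, v} (complexCoker d (k + 1)) ⟶ A),
        e.comp (Ext.mk₀ f) (add_zero k) = 0 ↔
          ∃ h : M k →ₗ[R] A, ∀ x, h (cokerMap hdd k x) = f.hom (toSmall.{u, v} _ x) := by
  intro k
  induction k with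
  | zero =>
    intro _
    obtain ⟨i, hi, hex, hs⟩ := exists_homology_inclusion hdd hd q hq hqk
    let S : ShortComplex (ModuleCat.{max u v} R) := ShortComplex.mk (X₁ := Δ)
      (X₂ := smallModule.{u, v} (complexCoker d 1)) (X₃ := smallModule.{u, v} (M 0))
      (ModuleCat.ofHom ((toSmall.{u, v} _).toLinearMap ∘ₗ i))
      (fromSmall.{u, v} ((toSmall.{u, v} _).toLinearMap ∘ₗ cokerMap hdd 0))
      (ModuleCat.hom_ext (LinearMap.ext fun x => by
        refine (fromSmall_toSmall.{u, v}
          ((toSmall.{u, v} _).toLinearMap ∘ₗ cokerMap hdd 0) (i x)).trans ?_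
        rw [LinearMap.comp_apply, hex.apply_apply_eq_zero, map_zero]
        rfl))
    have hS : S.ShortExact := {
      exact := by
        rw [ShortComplex.moduleCat_exact_iff]
        intro y hy
        obtain ⟨y, rfl⟩ := (toSmall.{u, v} (R := R) (complexCoker d 1)).surjective y
        have hy' := (fromSmall_toSmall.{u, v}
          ((toSmall.{u, v} _).toLinearMap ∘ₗ cokerMap hdd 0) y).symm.trans hy
        obtain ⟨x, rfl⟩ := (hex y).1 ((toSmall.{u, v} (M 0)).map_eq_zero_iff.1 hy')
        exact ⟨x, rfl⟩
      mono_f := (ModuleCat.mono_iff_injective _).2 ((toSmall.{u, v} _).injective.comp hi)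
      epi_g := (ModuleCat.epi_iff_surjective _).2 fun z => by
        obtain ⟨z, rfl⟩ := (toSmall.{u, v} (R := R) (M 0)).surjective z
        obtain ⟨y, rfl⟩ := hs z
        exact ⟨toSmall.{u, v} _ y, fromSmall_toSmall.{u, v} _ y⟩ }
    have : Projective S.X₃ := projective_smallModule (X := M 0)
    exact ⟨Ext.mk₀ S.f, isExtShift_mk₀ hS, fun A f =>
      (mk₀_comp_mk₀_eq_zero_iff hS f).trans (exists_fromSmall_comp_iff _ _)⟩
  | succ k ih =>
    intro hk
    obtain ⟨e, he, -⟩ := ih (by omega)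
    have hS := cokerMap_shortExact.{u, v} hdd (hex k (by omega))
    refine ⟨_, @IsExtShift.comp_extClass _ _ _ _ _ hS _ _ _
      (projective_smallModule (X := M (k + 1))) he, fun A f =>
      (IsExtShift.comp_extClass_comp_mk₀_eq_zero_iff hS he f).trans
        (exists_fromSmall_comp_iff _ _)⟩

/-- The maps from a complex that vanish on boundaries. -/
def homCocycles {X Y : Type w} [AddCommGroup X] [Module R X] [AddCommGroup Y] [Module R Y]
    (d : X →ₗ[R] Y) (A : ModuleCat.{max u v} R) : AddSubgroup (Y →ₗ[R] A) where
  carrier := {f | f ∘ₗ d = 0}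
  zero_mem' := LinearMap.zero_comp d
  add_mem' := by
    intro f g hf hg
    change (f + g) ∘ₗ d = 0
    rw [LinearMap.add_comp, show f ∘ₗ d = 0 from hf, show g ∘ₗ d = 0 from hg, add_zero]
  neg_mem' := by
    intro f hf
    change (-f) ∘ₗ d = 0
    rw [LinearMap.neg_comp, show f ∘ₗ d = 0 from hf, neg_zero]

/-- `Ext` groups from a partial projective resolution. -/
theorem exists_ext_presentation (hd : Function.Surjective (d 0))
    (q : LinearMap.ker (d 0) →ₗ[R] Δ) (hq : Function.Surjective q)
    (hqk : ∀ z, q z = 0 ↔ (z : M 1) ∈ LinearMap.range (d 1)) {N : ℕ}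
    (hex : ∀ n, n + 2 ≤ N → ∀ x, d (n + 1) x = 0 → x ∈ LinearMap.range (d (n + 2)))
    (hdd : ∀ n x, d n (d (n + 1) x) = 0) {k : ℕ} (hk : k + 1 ≤ N) :
    ∃ T : ∀ A : ModuleCat.{max u v} R,
        homCocycles (d (k + 1)) A →+ Ext.{max u v} Δ A k,
      (∀ A, Function.Surjective (T A)) ∧
      (∀ A f, T A f = 0 ↔ ∃ h : M k →ₗ[R] A, h ∘ₗ d k = f) ∧
      ∀ (A A' : ModuleCat.{max u v} R) (φ : A ⟶ A') (f : homCocycles (d (k + 1)) A)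
        (f' : homCocycles (d (k + 1)) A'), (f' : M (k + 1) →ₗ[R] A') = φ.hom ∘ₗ f →
        T A' f' = (T A f).comp (Ext.mk₀ φ) (add_zero k) := by
  obtain ⟨e, he, hker⟩ := exists_isExtShift.{u, v} hdd hd q hq hqk hex k hk
  -- A cocycle is the same as a homomorphism from the cokernel, where the class `e` starts to act.
  let L : ∀ A : ModuleCat.{max u v} R, homCocycles (d (k + 1)) A →
      (complexCoker d (k + 1) →ₗ[R] A) := fun A f =>
    (LinearMap.range (d (k + 1))).liftQ f.1 (by
      rintro _ ⟨x, rfl⟩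
      exact LinearMap.congr_fun f.2 x)
  have hL : ∀ A f x, L A f (Submodule.Quotient.mk x) = f.1 x := fun A f x => rfl
  have hLadd : ∀ A f f', fromSmall.{u, v} (L A (f + f')) =
      fromSmall.{u, v} (L A f) + fromSmall.{u, v} (L A f') := fun A f f' =>
    small_hom_ext fun y => by
      rw [ModuleCat.hom_add, LinearMap.add_apply, fromSmall_toSmall, fromSmall_toSmall,
        fromSmall_toSmall]
      obtain ⟨x, rfl⟩ := Submodule.mkQ_surjective _ y
      rfl
  refine ⟨fun A => AddMonoidHom.mk' (fun f => e.comp (Ext.mk₀ (fromSmall.{u, v} (L A f)))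
    (add_zero k)) fun f f' => ?_, fun A y => ?_, fun A f => ?_, ?_⟩
  · rw [hLadd, Ext.mk₀_add, Ext.comp_add]
  · obtain ⟨x, hx⟩ := he.surj (add_zero k) y
    obtain ⟨a, rfl⟩ := exists_mk₀_eq x
    let f : M (k + 1) →ₗ[R] A :=
      (a.hom ∘ₗ (toSmall.{u, v} _).toLinearMap) ∘ₗ (LinearMap.range (d (k + 1))).mkQ
    have hf : f ∈ homCocycles (d (k + 1)) A := LinearMap.ext fun x => by
      have : (LinearMap.range (d (k + 1))).mkQ (d (k + 1) x) = 0 :=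
        (Submodule.Quotient.mk_eq_zero _).2 ⟨x, rfl⟩
      change (a.hom ∘ₗ (toSmall.{u, v} _).toLinearMap)
        ((LinearMap.range (d (k + 1))).mkQ (d (k + 1) x)) = 0
      rw [this, map_zero]
    refine ⟨⟨f, hf⟩, ?_⟩
    have : fromSmall.{u, v} (L A ⟨f, hf⟩) = a := small_hom_ext fun y => by
      rw [fromSmall_toSmall]
      obtain ⟨x, rfl⟩ := Submodule.mkQ_surjective _ y
      rfl
    rw [← hx, ← this]
    rfl
  · refine (hker A _).trans (exists_congr fun h => ?_)
    constructor
    · intro hh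
      refine LinearMap.ext fun x => ?_
      have := hh (Submodule.Quotient.mk x)
      rw [fromSmall_toSmall, hL] at this
      exact this
    · intro hh y
      obtain ⟨x, rfl⟩ := Submodule.mkQ_surjective _ y
      rw [fromSmall_toSmall, Submodule.mkQ_apply, hL, ← hh]
      rfl
  · intro A A' φ f f' hff
    have : fromSmall.{u, v} (L A' f') = fromSmall.{u, v} (L A f) ≫ φ := small_hom_ext fun y => by
      rw [ModuleCat.comp_apply, fromSmall_toSmall, fromSmall_toSmall]
      obtain ⟨x, rfl⟩ := Submodule.mkQ_surjective _ y
      exact LinearMap.congr_fun hff x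
    change e.comp (Ext.mk₀ (fromSmall.{u, v} (L A' f'))) (add_zero k) =
      (e.comp (Ext.mk₀ (fromSmall.{u, v} (L A f))) (add_zero k)).comp (Ext.mk₀ φ) (add_zero k)
    rw [this, ← Ext.mk₀_comp_mk₀, Ext.comp_assoc_of_third_deg_zero]

end Resolution

/-! ### The relative chain complex -/

open CompactCohomology

/-- The vertices of `E_G` may live in an unrelated universe; finite generation brings the chain
modules into that of the group ring and the coefficients. -/
lemma small_of_finite_module {R : Type u} [Ring R] (X : Type w) [AddCommGroup X] [Module R X]
    [Module.Finite R X] : Small.{max u v} X := by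
  obtain ⟨n, f, hf⟩ := Module.Finite.exists_fin' R X
  exact small_of_surjective hf

namespace CuspedSpaceData

variable {G : Type u} [Group G] {ι : Type} {P : ι → Subgroup G} {N : ℕ}
  (D : CuspedSpaceData.{u, w} P N)

/-- The relative chains: the mapping cone of the peripheral chains. -/
abbrev RelChain (n : ℕ) := D.GChain (n + 1) × D.PChain n

/-- The differential of the relative chains. -/
def relBdry (n : ℕ) : D.RelChain (n + 1) →ₗ[MonoidAlgebra ℤ G] D.RelChain n :=
  (EquivariantChain.bdry D.EG_invariant (n + 1) ∘ₗ LinearMap.fst _ _ _ +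
    D.inclP (n + 1) ∘ₗ LinearMap.snd _ _ _).prod
    (-(EquivariantChain.bdry D.peripheralComplex_invariant n ∘ₗ LinearMap.snd _ _ _))

lemma relBdry_apply {n : ℕ} (c : D.RelChain (n + 1)) : D.relBdry n c =
    (EquivariantChain.bdry D.EG_invariant (n + 1) c.1 + D.inclP (n + 1) c.2,
      -EquivariantChain.bdry D.peripheralComplex_invariant n c.2) := rfl

lemma relBdry_relBdry (n : ℕ) (c : D.RelChain (n + 2)) : D.relBdry n (D.relBdry (n + 1) c) = 0 := by
  rw [relBdry_apply, relBdry_apply]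
  refine Prod.ext ?_ ?_
  · simp only [map_add, map_neg, EquivariantChain.bdry_bdry, inclP_bdry, zero_add, Prod.fst_zero]
    exact add_neg_cancel _
  · simp only [map_neg, EquivariantChain.bdry_bdry, neg_zero, Prod.snd_zero]

instance relChain_projective (n : ℕ) : Module.Projective (MonoidAlgebra ℤ G) (D.RelChain n) :=
  have := EquivariantChain.projective D.EG_invariant D.EG_free (n + 1)
  have := EquivariantChain.projective D.peripheralComplex_invariant D.peripheralComplex_free n
  inferInstance

instance relChain_small [Finite ι] (n : ℕ) : Small.{max u v} (D.RelChain n) := by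
  obtain ⟨T, hTf, hT⟩ := D.EG_finite
  obtain ⟨T', hTf', hT'⟩ := D.peripheralComplex_finite
  have := EquivariantChain.moduleFinite D.EG_invariant hTf hT (n + 1)
  have := EquivariantChain.moduleFinite D.peripheralComplex_invariant hTf' hT' n
  exact small_of_finite_module.{u, v} (R := MonoidAlgebra ℤ G) _

/-- The mapping cone chase: once the peripheral part is filled by `b'`, the sum `a + inclP b'` is a
cycle of `E_G` in dimension `n + 1 ≤ N`, and a filling of it completes the chain. -/
lemma exists_relBdry_eq {n : ℕ} (hn : n + 2 ≤ N + 1) {a : D.GChain (n + 2)} {b : D.PChain (n + 1)}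
    {b' : D.PChain (n + 2)} (hb : EquivariantChain.bdry D.peripheralComplex_invariant (n + 1) b' = b)
    (hab : EquivariantChain.bdry D.EG_invariant (n + 1) a + D.inclP (n + 1) b = 0) :
    ∃ c, D.relBdry (n + 1) c = (a, b) := by
  subst hb
  obtain ⟨a', ha'⟩ := D.GChain_exact hn (c := a + D.inclP (n + 2) b') (by
    rw [map_add, ← inclP_bdry, hab])
  refine ⟨(a', -b'), ?_⟩
  rw [relBdry_apply]
  refine Prod.ext ?_ ?_
  · simp only [ha', map_neg]
    exact add_neg_cancel_right _ _
  · simp only [map_neg, neg_neg]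

lemma relBdry_exact {n : ℕ} (hn : n + 2 ≤ N) (c : D.RelChain (n + 2))
    (hc : D.relBdry (n + 1) c = 0) : c ∈ LinearMap.range (D.relBdry (n + 2)) := by
  obtain ⟨a, b⟩ := c
  rw [relBdry_apply, Prod.mk_eq_zero, neg_eq_zero] at hc
  obtain ⟨b', hb'⟩ := D.PChain_exact (n := n) (by omega) hc.2
  exact D.exists_relBdry_eq (by omega) hb' hc.1

/-- A suitable multiple of a peripheral 0-chain of augmentation one corrects `a` to augmentation
zero, after which `a` bounds. This needs a peripheral subgroup to exist. In degree 0 the peripheral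
summand is zero. -/
lemma relBdry_zero_surjective [Nonempty ι] : Function.Surjective (D.relBdry 0) := by
  rintro ⟨a, b⟩
  obtain ⟨i⟩ := ‹Nonempty ι›
  obtain ⟨b₁, hb₁⟩ := D.toCosets_surjective
    (MonoidAlgebra.single (⟨i, ((1 : G) : G ⧸ P i)⟩ : Σ i, G ⧸ P i) (1 : ℤ) :
      MonoidAlgebra ℤ (Σ i, G ⧸ P i))
  have h1 : D.augG (D.inclP 1 b₁) = 1 := by
    rw [← augmentation_toCosets, hb₁]
    exact RelativeCohomology.augmentation_single P _ _
  obtain ⟨e, he⟩ := D.exists_bdry_eq_of_augG (c := a - D.augG a • D.inclP 1 b₁) (by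
    rw [map_sub, map_zsmul, h1, smul_eq_mul, mul_one, sub_self])
  refine ⟨(e, D.augG a • b₁), Prod.ext ?_ (Subsingleton.elim (α := OrientedChain _ 0) _ _)⟩
  rw [relBdry_apply]
  simp only [he, map_zsmul]
  exact sub_add_cancel _ _

lemma mem_Delta_iff (x : (RelativeCohomology.cosetRep P).asModule) :
    x ∈ RelativeCohomology.Delta P ↔ RelativeCohomology.augmentation P x = 0 := Iff.rfl

/-- The projection from relative cycles to `Δ`. -/
def relProj : LinearMap.ker (D.relBdry 0) →ₗ[MonoidAlgebra ℤ G]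
    RelativeCohomology.deltaModule.{u, v} P :=
  ULift.moduleEquiv.symm.toLinearMap ∘ₗ
    (D.toCosets ∘ₗ LinearMap.snd _ _ _ ∘ₗ (LinearMap.ker (D.relBdry 0)).subtype).codRestrict
      (RelativeCohomology.Delta P) fun z => by
        rw [mem_Delta_iff]
        refine (D.augmentation_toCosets _).trans ?_
        have h := congrArg Prod.fst (LinearMap.mem_ker.1 z.2)
        rw [relBdry_apply] at h
        have h2 : D.augG (EquivariantChain.bdry D.EG_invariant 1 z.1.1 + D.inclP 1 z.1.2) = 0 :=
          (congrArg D.augG h).trans (map_zero _)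
        rwa [map_add, augG_bdry, zero_add] at h2

lemma relProj_eq_zero_iff (z : LinearMap.ker (D.relBdry 0)) :
    relProj.{u, v} D z = 0 ↔ D.toCosets z.1.2 = 0 := by
  constructor
  · intro h
    exact congrArg (fun y => (ULift.down y : RelativeCohomology.Delta P).1) h
  · intro h
    exact congrArg ULift.up (Subtype.ext h)

lemma relProj_surjective : Function.Surjective (relProj.{u, v} D) := by
  rintro ⟨⟨y, hy⟩⟩
  obtain ⟨b, rfl⟩ := D.toCosets_surjective y
  rw [mem_Delta_iff] at hy
  have hy' := (D.augmentation_toCosets b).symm.trans hy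
  obtain ⟨a, ha⟩ := D.exists_bdry_eq_of_augG (c := -D.inclP 1 b) (by rw [map_neg, hy', neg_zero])
  refine ⟨⟨(a, b), LinearMap.mem_ker.2
    (Prod.ext ?_ (Subsingleton.elim (α := OrientedChain _ 0) _ _))⟩, rfl⟩
  rw [relBdry_apply]
  simp only [ha]
  exact neg_add_cancel _

/-- If the class in `ℤG/𝒫` is zero, the peripheral 0-chain bounds, and the remaining 1-cycle of
`E_G` bounds because `N ≥ 1`. -/
lemma relProj_eq_zero_iff_mem_range (hN : 1 ≤ N) (z : LinearMap.ker (D.relBdry 0)) :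
    relProj.{u, v} D z = 0 ↔ (z : D.RelChain 1) ∈ LinearMap.range (D.relBdry 1) := by
  rw [relProj_eq_zero_iff]
  constructor
  · intro h
    obtain ⟨b', hb'⟩ := D.exists_bdry_eq_of_toCosets h
    have hz := congrArg Prod.fst (LinearMap.mem_ker.1 z.2)
    exact D.exists_relBdry_eq (n := 0) (by omega) hb' hz
  · rintro ⟨c, hc⟩
    rw [← hc, relBdry_apply]
    exact (map_neg D.toCosets _).trans (by rw [toCosets_bdry, neg_zero])

variable (A : Type v) [Ring A]

open RelativeCohomology in
/-- Relative cohomology in terms of the relative chains. -/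
theorem exists_relative_presentation [Finite ι] [Nonempty ι] {k : ℕ} (hk : k + 1 ≤ N) :
    ∃ T : homCocycles.{u, v} (D.relBdry (k + 1)) (coefficients G A) →+
        H.{u, v} P (coefficients G A) (k + 1),
      Function.Surjective T ∧
      (∀ f, T f = 0 ↔ ∃ h : D.RelChain k →ₗ[MonoidAlgebra ℤ G] coefficients G A,
        h ∘ₗ D.relBdry k = f) ∧
      ∀ (b : MonoidAlgebra A G) (f f' : homCocycles.{u, v} (D.relBdry (k + 1)) (coefficients G A)),
        (f' : D.RelChain (k + 1) →ₗ[MonoidAlgebra ℤ G] coefficients G A) =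
          (rightMul G b).hom ∘ₗ f.1 → T f' = mapH (rightMul G b) (k + 1) (T f) := by
  have hq := relProj_surjective.{u, v} D
  have hqk := relProj_eq_zero_iff_mem_range.{u, v} D (by omega)
  obtain ⟨T, h1, h2, h3⟩ := @exists_ext_presentation.{u, v, w} (MonoidAlgebra ℤ G) _ D.RelChain
    (fun _ => inferInstance) (fun _ => inferInstance) D.relBdry D.relChain_small.{u, v}
    D.relChain_projective (deltaModule.{u, v} P) D.relBdry_zero_surjective (relProj.{u, v} D) hq hqk N
    (fun n hn => D.relBdry_exact hn) D.relBdry_relBdry k hk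
  exact ⟨T _, h1 _, h2 _, fun b f f' hf => h3 _ _ (rightMul G b) f f' hf⟩

end CuspedSpaceData

/-! ### Compactly supported cohomology of horoballs -/

open CompactCohomology

section Alternating

variable {W M : Type*} [AddCommGroup M]

/-- Moving the front entry into position `p` is a cycle of sign `(-1)^p`. -/
lemma IsAlternating.update {n : ℕ} {φ : (Fin (n + 1) → W) → M} (h : IsAlternating φ)
    (w : Fin (n + 1) → W) (p : Fin (n + 1)) (a : W) :
    ((-1 : ℤ) ^ (p : ℕ)) • φ (Fin.cons a (w ∘ p.succAbove)) = φ (Function.update w p a) := by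
  have h1 : (Fin.cons a (w ∘ p.succAbove) : Fin (n + 1) → W) =
      Function.update w p a ∘ p.cycleRange.symm := by
    rw [← Fin.cons_removeNth_eq_comp_cycleRange_symm]
    congr 1
    · simp
    · funext i
      simp [Fin.removeNth]
  rw [neg_one_pow_smul_eq_sign, h1, h.perm, smul_smul, ← Units.val_mul, Int.units_mul_self]
  simp

lemma IsAlternating.cons_perm {n : ℕ} {φ : (Fin (n + 1) → W) → M} (h : IsAlternating φ)
    (w : Fin n → W) (a : W) (π : Equiv.Perm (Fin n)) :
    φ (Fin.cons a (w ∘ π)) = (Equiv.Perm.sign π : ℤ) • φ (Fin.cons a w) := by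
  have h1 : (Fin.cons a (w ∘ π) : Fin (n + 1) → W) =
      (Fin.cons a w : Fin (n + 1) → W) ∘ Equiv.Perm.decomposeFin.symm (0, π) := by
    funext i
    cases i using Fin.cases <;> simp
  rw [h1, h.perm, Equiv.Perm.decomposeFin.symm_sign]
  simp

/-- A telescoping sum over initial segments, proved by adding maximal elements one at a time. -/
lemma sum_sub_eq_of_isStrictTotalOrder {α : Type*} [Fintype α] (R : α → α → Prop)
    [IsStrictTotalOrder α R] (F : Set α → M) :
    ∑ j, (F {l | l = j ∨ R l j} - F {l | R l j}) = F Set.univ - F ∅ := by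
  classical
  let _ : LinearOrder α := linearOrderOfSTO R
  have key : ∀ s : Finset α, ∑ j ∈ s, (F {l | l ∈ s ∧ l ≤ j} - F {l | l ∈ s ∧ l < j}) =
      F s - F ∅ := fun s => by
    induction s using Finset.induction_on_max with
    | empty => simp
    | insert a s ha ih =>
      have ha' : a ∉ s := fun h => lt_irrefl a (ha a h)
      rw [Finset.sum_insert ha']
      have h1 : {l | l ∈ insert a s ∧ l ≤ a} = (insert a s : Finset α) := by
        ext l
        simp only [Set.mem_ofPred_eq, Finset.mem_coe, and_iff_left_iff_imp, Finset.mem_insert]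
        rintro (rfl | h)
        exacts [le_rfl, (ha l h).le]
      have h2 : {l | l ∈ insert a s ∧ l < a} = (s : Set α) := by
        ext l
        simp only [Set.mem_ofPred_eq, Finset.mem_coe, Finset.mem_insert]
        exact ⟨fun h => h.1.resolve_left h.2.ne, fun h => ⟨Or.inr h, ha l h⟩⟩
      have h3 : ∀ j ∈ s, (F {l | l ∈ insert a s ∧ l ≤ j} - F {l | l ∈ insert a s ∧ l < j}) =
          F {l | l ∈ s ∧ l ≤ j} - F {l | l ∈ s ∧ l < j} := fun j hj => by
        have h4 : {l | l ∈ insert a s ∧ l ≤ j} = {l | l ∈ s ∧ l ≤ j} := by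
          ext l
          simp only [Set.mem_ofPred_eq, Finset.mem_insert]
          exact ⟨fun h => ⟨h.1.resolve_left fun hl => ((ha j hj).trans_le (hl ▸ h.2)).false, h.2⟩,
            fun h => ⟨Or.inr h.1, h.2⟩⟩
        have h5 : {l | l ∈ insert a s ∧ l < j} = {l | l ∈ s ∧ l < j} := by
          ext l
          simp only [Set.mem_ofPred_eq, Finset.mem_insert]
          exact ⟨fun h => ⟨h.1.resolve_left fun hl => ((ha j hj).trans (hl ▸ h.2)).false, h.2⟩,
            fun h => ⟨Or.inr h.1, h.2⟩⟩
        rw [h4, h5]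
      rw [Finset.sum_congr rfl h3, ih, h1, h2]
      abel
  have h := key Finset.univ
  simp only [Finset.mem_univ, true_and, Finset.coe_univ] at h
  rw [← h]
  refine Finset.sum_congr rfl fun j _ => ?_
  have h1 : {l | l = j ∨ R l j} = {l | l ≤ j} := Set.ext fun l => (le_iff_eq_or_lt (a := l)).symm
  rw [h1]
  rfl

end Alternating

/-! ### Pushing cochains on horoballs towards infinity. -/

section Horoball

variable {U M : Type*} [AddCommGroup M] {Y : PreAbstractSimplicialComplex U} {r : U → U → Prop}

/-- The product of `[0, ∞)` with `Y`, subdivided by means of an ordering of the simplices of `Y`. -/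
def horoballComplex (Y : PreAbstractSimplicialComplex U) (r : U → U → Prop) :
    PreAbstractSimplicialComplex (ℕ × U) where
  faces := {s | s.Nonempty ∧ ∃ n, ∃ τ ∈ Y.faces,
    (∀ x ∈ s, x.2 ∈ τ ∧ (x.1 = n ∨ x.1 = n + 1)) ∧
    ∀ x ∈ s, ∀ y ∈ s, x.1 = n → y.1 = n + 1 → x.2 = y.2 ∨ r x.2 y.2}
  isRelLowerSet_faces := by
    rintro s ⟨hs, n, τ, hτ, h1, h2⟩
    exact ⟨hs, fun t hts ht => ⟨ht, n, τ, hτ, fun x hx => h1 x (hts hx),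
      fun x hx y hy => h2 x (hts hx) y (hts hy)⟩⟩

lemma mem_horoballComplex_tuples {k : ℕ} {x : Fin (k + 1) → ℕ × U} :
    x ∈ (horoballComplex Y r).tuples (k + 1) ↔ ∃ n, ∃ τ ∈ Y.faces,
      (∀ j, (x j).2 ∈ τ ∧ ((x j).1 = n ∨ (x j).1 = n + 1)) ∧
      ∀ j l, (x j).1 = n → (x l).1 = n + 1 → (x j).2 = (x l).2 ∨ r (x j).2 (x l).2 := by
  classical
  constructor
  · rintro ⟨s, ⟨-, n, τ, hτ, h1, h2⟩, hx⟩
    exact ⟨n, τ, hτ, fun j => h1 _ (hx j), fun j l => h2 _ (hx j) _ (hx l)⟩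
  · rintro ⟨n, τ, hτ, h1, h2⟩
    refine ⟨Finset.univ.image x, ⟨Finset.univ_nonempty.image x, n, τ, hτ, ?_, ?_⟩,
      fun j => Finset.mem_image_of_mem _ (Finset.mem_univ j)⟩
    · intro y hy
      obtain ⟨j, -, rfl⟩ := Finset.mem_image.1 hy
      exact h1 j
    · intro y hy z hz
      obtain ⟨j, -, rfl⟩ := Finset.mem_image.1 hy
      obtain ⟨l, -, rfl⟩ := Finset.mem_image.1 hz
      exact h2 j l

/-- `r` orders the vertices of each simplex. -/
structure IsFaceOrder (Y : PreAbstractSimplicialComplex U) (r : U → U → Prop) : Prop where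
  irrefl : ∀ σ ∈ Y.faces, ∀ a ∈ σ, ¬ r a a
  trans : ∀ σ ∈ Y.faces, ∀ a ∈ σ, ∀ b ∈ σ, ∀ c ∈ σ, r a b → r b c → r a c
  total : ∀ σ ∈ Y.faces, ∀ a ∈ σ, ∀ b ∈ σ, a = b ∨ r a b ∨ r b a

namespace Horoball

/-- Push a point of a horoball to depth at least `m`. -/
def push (m : ℕ) (x : ℕ × U) : ℕ × U := (max x.1 m, x.2)

/-- Push some of the entries of a tuple to depth `m` and the others to depth `m + 1`. -/
def partialPush {n : ℕ} (m : ℕ) (x : Fin n → ℕ × U) (S : Set (Fin n)) : Fin n → ℕ × U :=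
  open Classical in fun l => if l ∈ S then push m (x l) else push (m + 1) (x l)

/-- The ordering of the vertices of a simplex of a horoball. -/
def vertexLe (r : U → U → Prop) (y z : ℕ × U) : Prop := r y.2 z.2 ∨ (y.2 = z.2 ∧ y.1 ≤ z.1)

/-- A simplex of the prism between depths `m` and `m + 1`, without its initial vertex. -/
def prismTuple {n : ℕ} (r : U → U → Prop) (m : ℕ) (x : Fin n → ℕ × U) (y : ℕ × U) :
    Fin n → ℕ × U :=
  partialPush m x {l | vertexLe r (x l) y}

/-- If the simplex already lies at depth at least `m + 1`, pushing changes nothing and the tuple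
repeats a vertex. Otherwise all depths become `m` or `m + 1`. A vertex left at depth `m` precedes `x
j`, and one moved to `m + 1` follows it, as the subdivision demands; the exception, a vertex already
at depth `m + 1`, is covered by the ordering within the original simplex. -/
lemma cons_prismTuple_mem_tuples (hr : IsFaceOrder Y r) (m : ℕ) {k : ℕ} {x : Fin (k + 1) → ℕ × U}
    (hx : x ∈ (horoballComplex Y r).tuples (k + 1)) (j : Fin (k + 1)) :
    (Fin.cons (push (m + 1) (x j)) (prismTuple r m x (x j)) : Fin (k + 2) → ℕ × U) ∈
      (horoballComplex Y r).tuples (k + 2) := by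
  classical
  obtain ⟨n, τ, hτ, h1, h2⟩ := mem_horoballComplex_tuples.1 hx
  rcases Nat.lt_or_ge m n with hmn | hmn
  · have h3 : ∀ m' ≤ m + 1, ∀ l, push m' (x l) = x l := fun m' hm' l => by
      have : m' ≤ (x l).1 := by rcases (h1 l).2 with h | h <;> omega
      rw [push, max_eq_left this]
    have h4 : (Fin.cons (push (m + 1) (x j)) (prismTuple r m x (x j)) : Fin (k + 2) → ℕ × U) =
        x ∘ (Fin.cons j id : Fin (k + 2) → Fin (k + 1)) := by
      funext i
      cases i using Fin.cases with
      | zero => exact h3 _ le_rfl j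
      | succ l =>
        simp only [Fin.cons_succ, Function.comp_apply, id, prismTuple, partialPush]
        split_ifs
        exacts [h3 _ (Nat.le_succ m) l, h3 _ le_rfl l]
    rw [h4]
    exact PreAbstractSimplicialComplex.comp_mem_tuples hx _
  · have hdepth : ∀ l, (x l).1 ≤ m + 1 := fun l => by rcases (h1 l).2 with h | h <;> omega
    have hpush : ∀ l, push (m + 1) (x l) = (m + 1, (x l).2) := fun l => by
      rw [push, max_eq_right (hdepth l)]
    have hsnd : ∀ l, (prismTuple r m x (x j) l).2 = (x l).2 := fun l => by
      simp only [prismTuple, partialPush]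
      split_ifs <;> rfl
    have hneg : ∀ l, ¬ vertexLe r (x l) (x j) → prismTuple r m x (x j) l = (m + 1, (x l).2) :=
      fun l hl => by rw [← hpush]; exact if_neg hl
    have hpos : ∀ l, vertexLe r (x l) (x j) → prismTuple r m x (x j) l = (max (x l).1 m, (x l).2) :=
      fun l hl => if_pos hl
    have hbelow : ∀ l, (prismTuple r m x (x j) l).1 = m →
        ((x l).2 = (x j).2 ∨ r (x l).2 (x j).2) ∧ (x l).1 ≤ m := fun l hl => by
      by_cases hv : vertexLe r (x l) (x j)
      · rw [hpos l hv] at hl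
        exact ⟨hv.elim Or.inr fun h => Or.inl h.1, by simpa using hl⟩
      · rw [hneg l hv] at hl
        simp at hl
    refine mem_horoballComplex_tuples.2 ⟨m, τ, hτ, fun i => ?_, fun a b => ?_⟩
    · cases i using Fin.cases with
      | zero => exact ⟨(h1 j).1, Or.inr (by rw [Fin.cons_zero, hpush])⟩
      | succ l =>
        rw [Fin.cons_succ, hsnd]
        refine ⟨(h1 l).1, ?_⟩
        by_cases hv : vertexLe r (x l) (x j)
        · rw [hpos l hv]
          have := hdepth l
          dsimp only
          omega
        · rw [hneg l hv]
          exact Or.inr rfl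
    · cases a using Fin.cases with
      | zero =>
        intro h
        rw [Fin.cons_zero, hpush] at h
        simp at h
      | succ l =>
        rw [Fin.cons_succ]
        intro hl
        obtain ⟨hlj, hlm⟩ := hbelow l hl
        cases b using Fin.cases with
        | zero =>
          intro _
          rw [hsnd, Fin.cons_zero]
          exact hlj
        | succ p =>
          rw [Fin.cons_succ, hsnd, hsnd]
          intro hp
          by_cases hv : vertexLe r (x p) (x j)
          · rw [hpos p hv] at hp
            have h3 : (x p).1 = m + 1 := by
              dsimp only at hp
              omega
            have h4 : n = m := by rcases (h1 p).2 with h | h <;> omega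
            have h5 : (x l).1 = n := by rcases (h1 l).2 with h | h <;> omega
            exact h2 l p h5 (by rw [h4]; exact h3)
          · rcases hr.total τ hτ _ (h1 p).1 _ (h1 j).1 with h | h | h
            · rwa [h]
            · exact (hv (Or.inl h)).elim
            · rcases hlj with h' | h'
              · exact Or.inr (h' ▸ h)
              · exact Or.inr (hr.trans τ hτ _ (h1 l).1 _ (h1 j).1 _ (h1 p).1 h' h)

/-- The order is lexicographic: first by the vertex of the base simplex, then by depth, since a
simplex may contain two vertices over the same point. -/
lemma isStrictTotalOrder (hr : IsFaceOrder Y r) {n : ℕ} {x : Fin n → ℕ × U}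
    (hx : IsOrderedSimplex (horoballComplex Y r) x) :
    IsStrictTotalOrder (Fin n) fun l j => vertexLe r (x l) (x j) ∧ l ≠ j := by
  obtain ⟨hi, s, ⟨-, m, τ, hτ, h1, -⟩, hs⟩ := hx
  have hτx : ∀ j, (x j).2 ∈ τ := fun j => (h1 (x j) (by rw [← Finset.mem_coe, ← hs]; exact ⟨j, rfl⟩)).1
  have hanti : ∀ l j, vertexLe r (x l) (x j) → vertexLe r (x j) (x l) → l = j := by
    rintro l j (h | ⟨h, h'⟩) (g | ⟨g, g'⟩)
    · exact (hr.irrefl τ hτ _ (hτx l) (hr.trans τ hτ _ (hτx l) _ (hτx j) _ (hτx l) h g)).elim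
    · rw [g] at h
      exact (hr.irrefl τ hτ _ (hτx l) h).elim
    · rw [h] at g
      exact (hr.irrefl τ hτ _ (hτx j) g).elim
    · exact hi (Prod.ext (le_antisymm h' g') h)
  have htrans : ∀ l j p, vertexLe r (x l) (x j) → vertexLe r (x j) (x p) →
      vertexLe r (x l) (x p) := by
    rintro l j p (h | ⟨h, h'⟩) (g | ⟨g, g'⟩)
    · exact Or.inl (hr.trans τ hτ _ (hτx l) _ (hτx j) _ (hτx p) h g)
    · exact Or.inl (g ▸ h)
    · exact Or.inl (h ▸ g)
    · exact Or.inr ⟨h.trans g, h'.trans g'⟩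
  exact
    { trichotomous := fun l j h g => by
        by_contra hlj
        rcases hr.total τ hτ _ (hτx l) _ (hτx j) with h' | h' | h'
        · rcases le_total (x l).1 (x j).1 with h'' | h''
          · exact h ⟨Or.inr ⟨h', h''⟩, hlj⟩
          · exact g ⟨Or.inr ⟨h'.symm, h''⟩, Ne.symm hlj⟩
        · exact h ⟨Or.inl h', hlj⟩
        · exact g ⟨Or.inl h', Ne.symm hlj⟩
      irrefl := fun l h => h.2 rfl
      trans := fun l j p h g => ⟨htrans l j p h.1 g.1, by
        rintro rfl
        exact h.2 (hanti l j h.1 g.1)⟩ }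

/-- The sum over the simplices of the prism between depths `m` and `m + 1`. -/
def prismSum {n : ℕ} (r : U → U → Prop) (m : ℕ) (φ : (Fin (n + 1) → ℕ × U) → M)
    (x : Fin n → ℕ × U) : M :=
  ∑ j, φ (Fin.cons (push (m + 1) (x j)) (prismTuple r m x (x j)))

/-- The prism is cut according to an order on the vertices and not on the positions, so permuting a
tuple only permutes the summands and their entries. -/
lemma prismSum_perm {n : ℕ} (m : ℕ) {φ : (Fin (n + 1) → ℕ × U) → M} (hφ : IsAlternating φ)
    (x : Fin n → ℕ × U) (π : Equiv.Perm (Fin n)) :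
    prismSum r m φ (x ∘ π) = (Equiv.Perm.sign π : ℤ) • prismSum r m φ x := by
  rw [prismSum, prismSum, Finset.smul_sum]
  refine Eq.trans ?_ (Equiv.sum_comp π _)
  refine Finset.sum_congr rfl fun j _ => ?_
  rw [← hφ.cons_perm]
  rfl

/-- The prism operator is a homotopy between pushing to depth `m` and pushing to depth `m + 1`. -/
lemma faceSum_prismSum (hr : IsFaceOrder Y r) {n : ℕ} (m : ℕ) {φ : (Fin (n + 1) → ℕ × U) → M}
    (hφ : IsCochain (horoballComplex Y r) φ)
    (hd : simplicialCoboundary (horoballComplex Y r) (n + 1) φ = 0) {x : Fin (n + 1) → ℕ × U}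
    (hx : IsOrderedSimplex (horoballComplex Y r) x) :
    faceSum n (prismSum r m φ) x = φ (push m ∘ x) - φ (push (m + 1) ∘ x) := by
  let R : Fin (n + 1) → Fin (n + 1) → Prop := fun l j => vertexLe r (x l) (x j) ∧ l ≠ j
  have : IsStrictTotalOrder (Fin (n + 1)) R := isStrictTotalOrder hr hx
  let g : Fin (n + 1) → Fin (n + 1) → M := fun p j =>
    φ (Fin.cons (push (m + 1) (x j)) (prismTuple r m x (x j) ∘ p.succAbove))
  -- The prism over the face omitting `p` has no term with apex `x p`; completing the sum creates
  -- the diagonal corrections `g p p`.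
  have h1 : ∀ p : Fin (n + 1), prismSum r m φ (x ∘ p.succAbove) = ∑ j, g p j - g p p := fun p => by
    rw [Fin.sum_univ_succAbove _ p, add_sub_cancel_left]
    rfl
  -- The cocycle condition on the prism simplex: the face omitting the front vertex equals the sum
  -- over the other faces.
  have h2 : ∀ j, ∑ p : Fin (n + 1), ((-1 : ℤ) ^ (p : ℕ)) • g p j = φ (prismTuple r m x (x j)) :=
    fun j => by
    have h3 := hφ.coboundary_of_mem_tuples (cons_prismTuple_mem_tuples hr m hx.mem_tuples j)
    rw [hd, faceSum_cons, Pi.zero_apply, eq_comm, sub_eq_zero] at h3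
    exact h3.symm
  have h4 : ∀ j, prismTuple r m x (x j) = partialPush m x {l | l = j ∨ R l j} := fun j => by
    rw [prismTuple]
    congr 1
    ext l
    constructor
    · intro h
      exact or_iff_not_imp_left.2 fun h' => ⟨h, h'⟩
    · rintro (rfl | h)
      · exact Or.inr ⟨rfl, le_rfl⟩
      · exact h.1
  -- In the diagonal terms the apex takes the place of `x j`. The result differs from the full prism
  -- tuple only in that `x j` has moved to depth `m + 1`, so it belongs to the next smaller initial
  -- segment.
  have h5 : ∀ j, Function.update (prismTuple r m x (x j)) j (push (m + 1) (x j)) =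
      partialPush m x {l | R l j} := fun j => by
    funext l
    by_cases hl : l = j
    · subst hl
      rw [Function.update_self]
      exact (if_neg fun h => h.2 rfl).symm
    · rw [Function.update_of_ne hl, h4]
      have h6 : l ∈ {l | l = j ∨ R l j} ↔ l ∈ {l | R l j} := or_iff_right hl
      rw [partialPush, partialPush]
      by_cases h : l ∈ {l | R l j}
      · rw [if_pos (h6.2 h), if_pos h]
      · rw [if_neg (mt h6.1 h), if_neg h]
  calc faceSum n (prismSum r m φ) x
      = ∑ p : Fin (n + 1), ((-1 : ℤ) ^ (p : ℕ)) • (∑ j, g p j - g p p) := by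
        rw [faceSum_apply]
        simp only [h1]
    _ = ∑ j, (φ (partialPush m x {l | l = j ∨ R l j}) - φ (partialPush m x {l | R l j})) := by
        simp only [smul_sub, Finset.sum_sub_distrib, Finset.smul_sum]
        rw [Finset.sum_comm]
        congr 1
        · exact Finset.sum_congr rfl fun j _ => by rw [h2, h4]
        · exact Finset.sum_congr rfl fun j _ => by rw [hφ.isAlternating.update, h5]
    _ = φ (push m ∘ x) - φ (push (m + 1) ∘ x) := by
        rw [sum_sub_eq_of_isStrictTotalOrder R fun S => φ (partialPush m x S)]
        have h6 : partialPush m x Set.univ = push m ∘ x := funext fun l => if_pos trivial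
        have h7 : partialPush m x ∅ = push (m + 1) ∘ x := funext fun l => if_neg id
        rw [h6, h7]

end Horoball

open Horoball in
/-- The cohomology with compact support of horoballs vanishes. -/
theorem exists_coboundary_eq_of_horoball (hr : IsFaceOrder Y r) {n : ℕ}
    {φ : (Fin (n + 1) → ℕ × U) → M} (hφ : IsCochain (horoballComplex Y r) φ)
    (hfin : φ.support.Finite)
    (hd : simplicialCoboundary (horoballComplex Y r) (n + 1) φ = 0) :
    ∃ η : (Fin n → ℕ × U) → M, IsCochain (horoballComplex Y r) η ∧ η.support.Finite ∧
      simplicialCoboundary (horoballComplex Y r) n η = φ := by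
  classical
  let Z : Set (ℕ × U) := ⋃ y ∈ φ.support, Set.range y
  have hZ : Z.Finite := hfin.biUnion fun y _ => Set.finite_range y
  -- `L` lies deeper than the support of `φ`, so `φ` is zero after pushing to depth `L`.
  obtain ⟨L, hL⟩ : ∃ L, ∀ z ∈ Z, z.1 < L := by
    obtain ⟨L, hL⟩ := (hZ.image Prod.fst).bddAbove
    exact ⟨L + 1, fun z hz => Nat.lt_succ_of_le (hL ⟨z, hz, rfl⟩)⟩
  have hzero : ∀ x : Fin (n + 1) → ℕ × U, φ x ≠ 0 → ∀ j, x j ∈ Z := fun x hx j =>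
    Set.mem_biUnion hx ⟨j, rfl⟩
  let η : (Fin n → ℕ × U) → M := fun x => if IsOrderedSimplex (horoballComplex Y r) x then
    ∑ m ∈ Finset.range L, prismSum r m φ x else 0
  refine ⟨η, ⟨fun x hx => if_neg hx, fun x π => ?_⟩, ?_, ?_⟩
  · simp only [η]
    by_cases hx : IsOrderedSimplex (horoballComplex Y r) x
    · rw [if_pos hx, if_pos ((isOrderedSimplex_perm π).2 hx), Finset.smul_sum]
      exact Finset.sum_congr rfl fun m _ => prismSum_perm m hφ.isAlternating x π
    · rw [if_neg hx, if_neg (mt (isOrderedSimplex_perm π).1 hx), smul_zero]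
  · let Z' : Set (ℕ × U) := (Set.Iio L) ×ˢ (Prod.snd '' Z)
    have hZ' : Z'.Finite := (Set.finite_Iio L).prod (hZ.image _)
    refine (Set.Finite.pi fun _ : Fin n => hZ').subset fun x hx l _ => ?_
    have hx' : ∑ m ∈ Finset.range L, prismSum r m φ x ≠ 0 := fun h => hx (by
      simp only [η, h, ite_self])
    obtain ⟨m, -, hm⟩ := Finset.exists_ne_zero_of_sum_ne_zero hx'
    obtain ⟨j, -, hj⟩ := Finset.exists_ne_zero_of_sum_ne_zero hm
    have h1 := hzero _ hj l.succ
    rw [Fin.cons_succ] at h1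
    -- Pushing only increases the depth and keeps the point below, so the support of `φ` bounds that
    -- of `η`.
    have h2 : (x l).1 ≤ (prismTuple r m x (x j) l).1 ∧ (prismTuple r m x (x j) l).2 = (x l).2 := by
      simp only [prismTuple, partialPush]
      split_ifs <;> exact ⟨le_max_left _ _, rfl⟩
    exact ⟨h2.1.trans_lt (hL _ h1), _, h1, h2.2⟩
  · funext x
    by_cases hx : IsOrderedSimplex (horoballComplex Y r) x
    · rw [simplicialCoboundary_of_isOrderedSimplex _ hx]
      have h1 : faceSum n η x = ∑ m ∈ Finset.range L, faceSum n (prismSum r m φ) x := by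
        simp only [faceSum_apply]
        rw [Finset.sum_comm]
        refine Finset.sum_congr rfl fun j _ => ?_
        rw [← Finset.smul_sum]
        congr 1
        -- For the empty tuple `η` is zero by definition, and the prism sum is an empty sum.
        cases n with
        | zero => simp [η, prismSum]
        | succ n => exact if_pos (hx.face j)
      have h2 : ∀ m ∈ Finset.range L, faceSum n (prismSum r m φ) x =
          φ (push m ∘ x) - φ (push (m + 1) ∘ x) := fun m _ => faceSum_prismSum hr m hφ hd hx
      have h3 : φ (push L ∘ x) = 0 := by
        by_contra h
        exact absurd (hL _ (hzero _ h 0)) (not_lt.2 (le_max_right _ _))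
      have h4 : push 0 ∘ x = x := funext fun j => Prod.ext (Nat.max_zero _) rfl
      rw [h1, Finset.sum_congr rfl h2, Finset.sum_range_sub' (fun m => φ (push m ∘ x)), h3, h4,
        sub_zero]
    · rw [simplicialCoboundary_of_not _ hx, hφ.eq_zero x hx]

end Horoball

/-! ### Cochains of the cusped space -/

open CompactCohomology

/-! ### Sums and pullbacks of cochains, and local finiteness. -/

section Pullback

variable {W W' M : Type*} [AddCommGroup M] {K : PreAbstractSimplicialComplex W}
  {K' : PreAbstractSimplicialComplex W'}

lemma mem_cochains_iff {A : Type*} [AddCommGroup A] {k : ℕ} {φ : (Fin (k + 1) → W) → A} :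
    φ ∈ cochains K A k ↔ IsCochain K φ ∧ φ.support.Finite :=
  ⟨fun h => ⟨⟨h.1, h.2.1⟩, h.2.2⟩, fun h => ⟨h.1.1, h.1.2, h.2⟩⟩

lemma IsCochain.add {n : ℕ} {φ ψ : (Fin n → W) → M} (hφ : IsCochain K φ) (hψ : IsCochain K ψ) :
    IsCochain K (φ + ψ) :=
  ⟨fun x hx => by rw [Pi.add_apply, hφ.eq_zero x hx, hψ.eq_zero x hx, add_zero],
    fun x π => by rw [Pi.add_apply, hφ.perm, hψ.perm, Pi.add_apply, smul_add]⟩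

lemma IsCochain.neg {n : ℕ} {φ : (Fin n → W) → M} (hφ : IsCochain K φ) : IsCochain K (-φ) :=
  ⟨fun x hx => by rw [Pi.neg_apply, hφ.eq_zero x hx, neg_zero],
    fun x π => by rw [Pi.neg_apply, hφ.perm, Pi.neg_apply, smul_neg]⟩

lemma IsCochain.sub {n : ℕ} {φ ψ : (Fin n → W) → M} (hφ : IsCochain K φ) (hψ : IsCochain K ψ) :
    IsCochain K (φ - ψ) := by
  rw [sub_eq_add_neg]
  exact hφ.add hψ.neg

lemma IsCochain.zero {n : ℕ} : IsCochain K (0 : (Fin n → W) → M) :=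
  ⟨fun _ _ => rfl, fun _ _ => (smul_zero _).symm⟩

lemma simplicialCoboundary_add {n : ℕ} (φ ψ : (Fin n → W) → M) :
    simplicialCoboundary K n (φ + ψ) = simplicialCoboundary K n φ + simplicialCoboundary K n ψ := by
  funext x
  by_cases hx : IsOrderedSimplex K x
  · rw [Pi.add_apply, simplicialCoboundary_of_isOrderedSimplex _ hx,
      simplicialCoboundary_of_isOrderedSimplex _ hx,
      simplicialCoboundary_of_isOrderedSimplex _ hx, map_add, Pi.add_apply]
  · rw [Pi.add_apply, simplicialCoboundary_of_not _ hx, simplicialCoboundary_of_not _ hx,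
      simplicialCoboundary_of_not _ hx, add_zero]

lemma simplicialCoboundary_neg {n : ℕ} (φ : (Fin n → W) → M) :
    simplicialCoboundary K n (-φ) = -simplicialCoboundary K n φ := by
  have h0 : simplicialCoboundary K n (0 : (Fin n → W) → M) = 0 := by
    have := simplicialCoboundary_add (K := K) (0 : (Fin n → W) → M) 0
    rwa [add_zero, left_eq_add] at this
  rw [eq_neg_iff_add_eq_zero, ← simplicialCoboundary_add, neg_add_cancel, h0]

lemma simplicialCoboundary_sub {n : ℕ} (φ ψ : (Fin n → W) → M) :
    simplicialCoboundary K n (φ - ψ) = simplicialCoboundary K n φ - simplicialCoboundary K n ψ := by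
  rw [sub_eq_add_neg, simplicialCoboundary_add, simplicialCoboundary_neg, sub_eq_add_neg]

variable (K) in
open Classical in
/-- The pullback of cochains along a simplicial map that is injective on simplices. -/
def pullback (f : W → W') {n : ℕ} (φ : (Fin n → W') → M) (x : Fin n → W) : M :=
  if IsOrderedSimplex K x then φ (f ∘ x) else 0

lemma pullback_apply {f : W → W'} {n : ℕ} (φ : (Fin n → W') → M) {x : Fin n → W}
    (hx : IsOrderedSimplex K x) : pullback K f φ x = φ (f ∘ x) := if_pos hx

lemma pullback_of_not {f : W → W'} {n : ℕ} (φ : (Fin n → W') → M) {x : Fin n → W}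
    (hx : ¬ IsOrderedSimplex K x) : pullback K f φ x = 0 := if_neg hx

lemma pullback_eq {f : W → W'} {n : ℕ} {φ : (Fin n → W') → M} {ψ : (Fin n → W) → M}
    (hψ : IsCochain K ψ) (h : ∀ x, IsOrderedSimplex K x → φ (f ∘ x) = ψ x) :
    pullback K f φ = ψ := by
  funext x
  by_cases hx : IsOrderedSimplex K x
  · rw [pullback_apply φ hx, h x hx]
  · rw [pullback_of_not φ hx, hψ.eq_zero x hx]

lemma pullback_add {f : W → W'} {n : ℕ} (φ ψ : (Fin n → W') → M) :
    pullback K f (φ + ψ) = pullback K f φ + pullback K f ψ := by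
  funext x
  by_cases hx : IsOrderedSimplex K x
  · simp only [Pi.add_apply, pullback_apply _ hx]
  · simp only [Pi.add_apply, pullback_of_not _ hx, add_zero]

lemma pullback_sub {f : W → W'} {n : ℕ} (φ ψ : (Fin n → W') → M) :
    pullback K f (φ - ψ) = pullback K f φ - pullback K f ψ := by
  funext x
  by_cases hx : IsOrderedSimplex K x
  · simp only [Pi.sub_apply, pullback_apply _ hx]
  · simp only [Pi.sub_apply, pullback_of_not _ hx, sub_zero]

lemma IsCochain.pullback {f : W → W'} {n : ℕ} {φ : (Fin n → W') → M} (hφ : IsCochain K' φ) :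
    IsCochain K (pullback K f φ) where
  eq_zero _ hx := if_neg hx
  perm x π := by
    by_cases hx : IsOrderedSimplex K x
    · rw [pullback_apply φ hx, pullback_apply φ ((isOrderedSimplex_perm π).2 hx), ← hφ.perm]
      rfl
    · rw [pullback_of_not φ hx, pullback_of_not φ (mt (isOrderedSimplex_perm π).1 hx), smul_zero]

lemma pullback_coboundary {f : W → W'}
    (hf : ∀ {n} {x : Fin n → W}, IsOrderedSimplex K x → IsOrderedSimplex K' (f ∘ x)) {n : ℕ}
    {φ : (Fin n → W') → M} (hφ : IsCochain K' φ) :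
    pullback K f (simplicialCoboundary K' n φ) = simplicialCoboundary K n (pullback K f φ) := by
  refine pullback_eq hφ.pullback.coboundary fun x hx => ?_
  rw [simplicialCoboundary_of_isOrderedSimplex _ hx,
    simplicialCoboundary_of_isOrderedSimplex _ (hf hx), faceSum_apply, faceSum_apply]
  refine Finset.sum_congr rfl fun j _ => ?_
  cases n with
  | zero =>
    rw [(hφ.pullback (K := K) (f := f)).of_isEmpty, hφ.of_isEmpty]
    rfl
  | succ n => rw [pullback_apply φ (hx.face j)]; rfl

lemma finite_support_pullback {f : W → W'} (hf : ∀ w, (f ⁻¹' {w}).Finite) {n : ℕ}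
    {φ : (Fin n → W') → M} (hφ : φ.support.Finite) : (pullback K f φ).support.Finite := by
  have h : ((fun x : Fin n → W => f ∘ x) ⁻¹' φ.support).Finite := by
    refine hφ.preimage' fun y _ => ?_
    refine (Set.Finite.pi fun j => hf (y j)).subset fun x hx j _ => ?_
    exact congrFun (Set.mem_singleton_iff.1 hx) j
  refine h.subset fun x hx => ?_
  by_cases hx' : IsOrderedSimplex K x
  · rwa [Function.mem_support, pullback_apply φ hx'] at hx
  · exact (hx (pullback_of_not φ hx')).elim

/-- Each vertex lies in only finitely many simplices. -/
def IsLocallyFinite (K : PreAbstractSimplicialComplex W) : Prop :=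
  ∀ v, {w | ∃ σ ∈ K.faces, v ∈ σ ∧ w ∈ σ}.Finite

lemma IsLocallyFinite.finite_support_coboundary (hK : IsLocallyFinite K) {n : ℕ}
    {φ : (Fin n → W) → M} (hφ : IsCochain K φ) (hfin : φ.support.Finite) :
    (simplicialCoboundary K n φ).support.Finite := by
  let Z : Set W := ⋃ y ∈ φ.support, Set.range y
  have hZ : Z.Finite := hfin.biUnion fun y _ => Set.finite_range y
  let Z' : Set W := ⋃ v ∈ Z, {w | ∃ σ ∈ K.faces, v ∈ σ ∧ w ∈ σ}
  have hZ' : Z'.Finite := hZ.biUnion fun v _ => hK v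
  refine (Set.Finite.pi fun _ : Fin (n + 1) => hZ').subset fun x hx l _ => ?_
  have hx' : IsOrderedSimplex K x := by
    by_contra h
    exact hx (simplicialCoboundary_of_not φ h)
  rw [Function.mem_support, simplicialCoboundary_of_isOrderedSimplex _ hx', faceSum_apply] at hx
  obtain ⟨p, -, hp⟩ := Finset.exists_ne_zero_of_sum_ne_zero hx
  have hp' : φ (x ∘ p.succAbove) ≠ 0 := fun h => hp (by rw [h, smul_zero])
  cases n with
  | zero => exact (hp' (congrFun hφ.of_isEmpty _)).elim
  | succ n =>
    obtain ⟨σ, hσ, h⟩ := hx'.mem_tuples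
    exact Set.mem_biUnion (Set.mem_biUnion hp' ⟨0, rfl⟩) ⟨σ, hσ, h (p.succAbove 0), h l⟩

/-- By freeness, a translate of `τ` containing `v` is determined by the vertex of `τ` that is moved
to `v`, so finitely many orbits leave finitely many simplices at `v`. -/
lemma isLocallyFinite_of_free {G : Type*} [Group G] [MulAction G W]
    (hfree : ∀ g : G, ∀ σ ∈ K.faces, translateFace g σ = σ → g = 1)
    (hfin : ∃ T : Set (Finset W), T.Finite ∧
      ∀ σ ∈ K.faces, ∃ g : G, ∃ τ ∈ T, σ = translateFace g τ) : IsLocallyFinite K := by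
  intro v
  obtain ⟨T, hT, h⟩ := hfin
  have h1 : {σ | σ ∈ K.faces ∧ v ∈ σ}.Finite := by
    refine (hT.biUnion (t := fun τ => ⋃ t ∈ (τ : Set W),
      {σ | σ ∈ K.faces ∧ ∃ g : G, σ = translateFace g τ ∧ g • t = v}) fun τ _ =>
        τ.finite_toSet.biUnion fun t ht => Set.Subsingleton.finite ?_).subset ?_
    · rintro _ ⟨hσ, g, rfl, hg⟩ _ ⟨-, g', rfl, hg'⟩
      have hv : {v} ∈ K.faces := (K.isRelLowerSet_faces hσ).2
        (Finset.singleton_subset_iff.2 (mem_translateFace.2 ⟨t, ht, hg⟩))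
        (Finset.singleton_nonempty v)
      have h2 : (g' * g⁻¹) • v = v := by
        rw [mul_smul, inv_smul_eq_iff.2 hg.symm, hg']
      have h3 : g' * g⁻¹ = 1 := hfree _ _ hv (by
        ext w
        rw [mem_translateFace, Finset.mem_singleton]
        constructor
        · rintro ⟨w', hw', rfl⟩
          rw [Finset.mem_singleton.1 hw', h2]
        · rintro rfl
          exact ⟨w, Finset.mem_singleton_self w, h2⟩)
      rw [mul_inv_eq_one.1 h3]
    · rintro σ ⟨hσ, hv⟩
      obtain ⟨g, τ, hτ, rfl⟩ := h σ hσ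
      obtain ⟨t, ht, hg⟩ := mem_translateFace.1 hv
      exact Set.mem_biUnion hτ (Set.mem_biUnion ht ⟨hσ, g, rfl, hg⟩)
  refine (h1.biUnion (t := fun σ => (σ : Set W)) fun σ _ => σ.finite_toSet).subset ?_
  rintro w ⟨σ, hσ, hv, hw⟩
  exact Set.mem_biUnion (show σ ∈ {σ | σ ∈ K.faces ∧ v ∈ σ} from ⟨hσ, hv⟩) hw

lemma isLocallyFinite_horoballComplex {U : Type*} {Y : PreAbstractSimplicialComplex U}
    {r : U → U → Prop} (hY : IsLocallyFinite Y) : IsLocallyFinite (horoballComplex Y r) := by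
  rintro ⟨m, v⟩
  refine ((Set.finite_Iic (m + 1)).prod (hY v)).subset ?_
  rintro ⟨m', w⟩ ⟨s, ⟨-, n, τ, hτ, h1, -⟩, hv, hw⟩
  have h2 := h1 _ hv
  have h3 := h1 _ hw
  refine ⟨?_, τ, hτ, h2.1, h3.1⟩
  have h4 := h2.2
  have h5 := h3.2
  dsimp only at h4 h5
  exact Set.mem_Iic.2 (by omega)

end Pullback

namespace CuspVertex

variable {ι : Type} {V : Type w}

lemma at_depth_eq_base {i : ι} {n : ℕ} {v w : V} : at_depth i n v = base w ↔ n = 0 ∧ v = w := by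
  cases n with
  | zero => simp [at_depth]
  | succ n => simp [at_depth]

lemma at_depth_inj {i i' : ι} {n n' : ℕ} {v v' : V} (h : at_depth i n v = at_depth i' n' v') :
    n = n' ∧ v = v' ∧ (n ≠ 0 → i = i') := by
  cases n <;> cases n' <;> simp [at_depth] at h ⊢ <;> simp [h]

lemma base_injective : Function.Injective (base : V → CuspVertex ι V) := fun _ _ h => by
  injection h

end CuspVertex

/-! ### Simplices of the cusped space in terms of `E_G` and the horoballs. -/

namespace CuspedSpaceData

variable {G : Type u} [Group G] {ι : Type} {P : ι → Subgroup G} {N : ℕ}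
  (D : CuspedSpaceData.{u, w} P N)

/-- The ordering of the vertices of the simplices of the peripheral complex. -/
def peripheralLt (x y : Σ _ : ι, D.V) : Prop := D.lt x.1 x.2 y.2

lemma isFaceOrder_peripheralLt : IsFaceOrder D.peripheralComplex D.peripheralLt := by
  have key : ∀ s ∈ D.peripheralComplex.faces, ∃ i, ∃ σ ∈ (D.EP i).faces, ∃ g : G,
      ∀ x ∈ s, ∃ v ∈ σ, x = ⟨i, g • v⟩ := by
    rintro s ⟨-, i, τ, ⟨g, σ, hσ, rfl⟩, h⟩
    refine ⟨i, σ, hσ, g, fun x hx => ?_⟩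
    obtain ⟨v, hv, rfl⟩ := h x hx
    obtain ⟨y, hy, rfl⟩ := mem_translateFace.1 hv
    exact ⟨y, hy, rfl⟩
  have hlt : ∀ i (g : G) v w, D.lt i (g • v) (g • w) ↔ D.lt i v w := fun i g v w =>
    ⟨fun h => by simpa using D.lt_invariant i g⁻¹ _ _ h, D.lt_invariant i g v w⟩
  refine ⟨fun s hs a ha => ?_, fun s hs a ha b hb c hc => ?_, fun s hs a ha b hb => ?_⟩
  all_goals obtain ⟨i, σ, hσ, g, h⟩ := key s hs
  all_goals obtain ⟨a, ha', rfl⟩ := h _ ha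
  · exact fun h' => D.lt_irrefl i σ hσ a ha' ((hlt i g a a).1 h')
  · obtain ⟨b, hb', rfl⟩ := h _ hb
    obtain ⟨c, hc', rfl⟩ := h _ hc
    exact fun h1 h2 => (hlt i g a c).2
      (D.lt_trans i σ hσ a ha' b hb' c hc' ((hlt i g a b).1 h1) ((hlt i g b c).1 h2))
  · obtain ⟨b, hb', rfl⟩ := h _ hb
    rcases D.lt_total i σ hσ a ha' b hb' with rfl | h' | h'
    · exact Or.inl rfl
    · exact Or.inr (Or.inl ((hlt i g a b).2 h'))
    · exact Or.inr (Or.inr ((hlt i g b a).2 h'))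

/-- The disjoint union of the horoballs. -/
abbrev horoballs : PreAbstractSimplicialComplex (ℕ × Σ _ : ι, D.V) :=
  horoballComplex D.peripheralComplex D.peripheralLt

/-- The map from horoballs to the cusped space. -/
def horoVertex (x : ℕ × Σ _ : ι, D.V) : CuspVertex ι D.V := .at_depth x.2.1 x.1 x.2.2

variable {D}

lemma mem_cuspedSpace_tuples {n : ℕ} {x : Fin (n + 1) → CuspVertex ι D.V} :
    x ∈ D.cuspedSpace.tuples (n + 1) ↔
      (∃ σ ∈ D.EG.faces, ∀ j, ∃ v ∈ σ, x j = .base v) ∨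
      ∃ i m, ∃ τ ∈ D.peripheralFaces i,
        (∀ j, ∃ v ∈ τ, x j = .at_depth i m v ∨ x j = .at_depth i (m + 1) v) ∧
        ∀ j l a b, x j = .at_depth i m a → x l = .at_depth i (m + 1) b → a = b ∨ D.lt i a b := by
  classical
  constructor
  · rintro ⟨s, ⟨-, ⟨σ, hσ, h⟩ | ⟨i, m, τ, hτ, h1, h2⟩⟩, hx⟩
    · exact Or.inl ⟨σ, hσ, fun j => h _ (hx j)⟩
    · exact Or.inr ⟨i, m, τ, hτ, fun j => h1 _ (hx j),
        fun j l a b hj hl => h2 a b (hj ▸ hx j) (hl ▸ hx l)⟩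
  · intro h
    refine ⟨Finset.univ.image x, ⟨Finset.univ_nonempty.image x, ?_⟩,
      fun j => Finset.mem_image_of_mem _ (Finset.mem_univ j)⟩
    have hm : ∀ y, y ∈ Finset.univ.image x ↔ ∃ j, x j = y := fun y => by simp
    rcases h with ⟨σ, hσ, h⟩ | ⟨i, m, τ, hτ, h1, h2⟩
    · refine Or.inl ⟨σ, hσ, fun y hy => ?_⟩
      obtain ⟨j, rfl⟩ := (hm y).1 hy
      exact h j
    · refine Or.inr ⟨i, m, τ, hτ, fun y hy => ?_, fun a b ha hb => ?_⟩
      · obtain ⟨j, rfl⟩ := (hm y).1 hy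
        exact h1 j
      · obtain ⟨j, hj⟩ := (hm _).1 ha
        obtain ⟨l, hl⟩ := (hm _).1 hb
        exact h2 j l a b hj hl

lemma exists_fst_eq_of_isOrderedSimplex {n : ℕ} {y : Fin n → ℕ × Σ _ : ι, D.V}
    (hy : IsOrderedSimplex D.horoballs y) : ∃ i, ∀ j, (y j).2.1 = i := by
  obtain ⟨s, ⟨-, m, t, ⟨-, i, τ, hτ, h⟩, h1, -⟩, hy⟩ := hy.mem_tuples
  refine ⟨i, fun j => ?_⟩
  obtain ⟨v, -, hv⟩ := h _ (h1 _ (hy j)).1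
  rw [hv]

lemma isOrderedSimplex_base {n : ℕ} {v : Fin n → D.V} (hv : IsOrderedSimplex D.EG v) :
    IsOrderedSimplex D.cuspedSpace (CuspVertex.base ∘ v) := by
  obtain ⟨m, rfl⟩ := Nat.exists_eq_succ_of_ne_zero hv.pos.ne'
  obtain ⟨σ, hσ, h⟩ := hv.mem_tuples
  exact isOrderedSimplex_of_mem_tuples
    (mem_cuspedSpace_tuples.2 (Or.inl ⟨σ, hσ, fun j => ⟨v j, h j, rfl⟩⟩))
    (CuspVertex.base_injective.comp hv.1)

lemma isOrderedSimplex_horoVertex {n : ℕ} {y : Fin n → ℕ × Σ _ : ι, D.V}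
    (hy : IsOrderedSimplex D.horoballs y) : IsOrderedSimplex D.cuspedSpace (D.horoVertex ∘ y) := by
  obtain ⟨m, rfl⟩ := Nat.exists_eq_succ_of_ne_zero hy.pos.ne'
  obtain ⟨i₀, hi₀⟩ := exists_fst_eq_of_isOrderedSimplex hy
  refine isOrderedSimplex_of_mem_tuples (mem_cuspedSpace_tuples.2 (Or.inr ?_)) fun j l h => ?_
  · obtain ⟨m, t, ⟨-, i, τ, hτ, h⟩, h1, h2⟩ := mem_horoballComplex_tuples.1 hy.mem_tuples
    have h3 : ∀ j, ∃ v ∈ τ, (y j).2 = ⟨i, v⟩ := fun j => h _ (h1 j).1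
    choose v hv hyv using h3
    have h4 : ∀ j, (D.horoVertex ∘ y) j = .at_depth i (y j).1 (v j) := fun j => by
      rw [Function.comp_apply, horoVertex, hyv j]
    refine ⟨i, m, τ, hτ, fun j => ⟨v j, hv j, ?_⟩, fun j l a b hj hl => ?_⟩
    · rw [h4]
      rcases (h1 j).2 with h | h <;> rw [h]
      · exact Or.inl rfl
      · exact Or.inr rfl
    · rw [h4] at hj hl
      obtain ⟨hj1, rfl, -⟩ := CuspVertex.at_depth_inj hj
      obtain ⟨hl1, rfl, -⟩ := CuspVertex.at_depth_inj hl
      have := h2 j l hj1 hl1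
      rw [hyv j, hyv l] at this
      exact this.imp (fun h => by simpa using h) id
  · obtain ⟨h1, h2, -⟩ := CuspVertex.at_depth_inj h
    exact hy.1 (Prod.ext h1 (Sigma.ext ((hi₀ j).trans (hi₀ l).symm) (heq_of_eq h2)))

lemma isOrderedSimplex_cuspedSpace_cases {n : ℕ} {x : Fin n → CuspVertex ι D.V}
    (hx : IsOrderedSimplex D.cuspedSpace x) :
    (∃ v, IsOrderedSimplex D.EG v ∧ CuspVertex.base ∘ v = x) ∨
      ∃ y, IsOrderedSimplex D.horoballs y ∧ D.horoVertex ∘ y = x := by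
  obtain ⟨m, rfl⟩ := Nat.exists_eq_succ_of_ne_zero hx.pos.ne'
  rcases mem_cuspedSpace_tuples.1 hx.mem_tuples with ⟨σ, hσ, h⟩ | ⟨i, d, τ, hτ, h1, h2⟩
  · choose v hv hxv using h
    obtain rfl : x = CuspVertex.base ∘ v := funext hxv
    exact Or.inl ⟨v, isOrderedSimplex_of_mem_tuples ⟨σ, hσ, hv⟩ hx.1.of_comp, rfl⟩
  · have h3 : ∀ j, ∃ (d' : ℕ) (v : D.V), v ∈ τ ∧ (d' = d ∨ d' = d + 1) ∧
        x j = .at_depth i d' v := fun j => by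
      obtain ⟨v, hv, h | h⟩ := h1 j
      · exact ⟨d, v, hv, Or.inl rfl, h⟩
      · exact ⟨d + 1, v, hv, Or.inr rfl, h⟩
    choose d' v hv hd' hxv using h3
    obtain rfl : x = D.horoVertex ∘ fun j => (d' j, ⟨i, v j⟩) := funext hxv
    refine Or.inr ⟨_, isOrderedSimplex_of_mem_tuples (mem_horoballComplex_tuples.2 ?_)
      hx.1.of_comp, rfl⟩
    obtain ⟨s, hs, hs'⟩ : (fun j => (⟨i, v j⟩ : Σ _ : ι, D.V)) ∈ D.peripheralComplex.tuples _ :=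
      mem_peripheralComplex_tuples.2 ⟨i, τ, hτ, fun j => ⟨v j, hv j, rfl⟩⟩
    refine ⟨d, s, hs, fun j => ⟨hs' j, hd' j⟩, fun j l hj hl => ?_⟩
    dsimp only at hj hl
    refine (h2 j l (v j) (v l) ?_ ?_).imp (fun h => by dsimp only; rw [h]) id
    · rw [hxv, hj]
    · rw [hxv, hl]

lemma isOrderedSimplex_snd {n : ℕ} {z : Fin n → Σ _ : ι, D.V}
    (hz : IsOrderedSimplex D.peripheralComplex z) : IsOrderedSimplex D.EG (Sigma.snd ∘ z) := by
  obtain ⟨m, rfl⟩ := Nat.exists_eq_succ_of_ne_zero hz.pos.ne'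
  obtain ⟨i, τ, hτ, h⟩ := mem_peripheralComplex_tuples.1 hz.mem_tuples
  choose v hv hzv using h
  obtain rfl : z = fun j => ⟨i, v j⟩ := funext hzv
  refine isOrderedSimplex_of_mem_tuples ⟨τ, peripheralFaces_subset hτ, hv⟩ fun j l h => hz.1 ?_
  exact Sigma.ext rfl (heq_of_eq h)

/-- The inclusion of the peripheral complex as the boundary of the horoballs. -/
abbrev boundaryVertex (x : Σ _ : ι, D.V) : ℕ × Σ _ : ι, D.V := (0, x)

lemma isOrderedSimplex_boundaryVertex {n : ℕ} {z : Fin n → Σ _ : ι, D.V} :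
    IsOrderedSimplex D.horoballs (boundaryVertex ∘ z) ↔
      IsOrderedSimplex D.peripheralComplex z := by
  constructor
  · intro h
    obtain ⟨m, rfl⟩ := Nat.exists_eq_succ_of_ne_zero h.pos.ne'
    obtain ⟨m, t, ht, h1, -⟩ := mem_horoballComplex_tuples.1 h.mem_tuples
    exact isOrderedSimplex_of_mem_tuples ⟨t, ht, fun j => (h1 j).1⟩ h.1.of_comp
  · intro h
    obtain ⟨m, rfl⟩ := Nat.exists_eq_succ_of_ne_zero h.pos.ne'
    obtain ⟨t, ht, hz⟩ := h.mem_tuples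
    refine isOrderedSimplex_of_mem_tuples (mem_horoballComplex_tuples.2
      ⟨0, t, ht, fun j => ⟨hz j, Or.inl rfl⟩, fun j l _ hl => ?_⟩)
      ((Prod.mk_right_injective 0).comp h.1)
    exact absurd hl (by simp)

/-- The overlap of the two pieces consists of simplices all of whose vertices have depth 0, so
compatibility need only be tested on the peripheral complex. -/
lemma exists_boundary_of_horoVertex_eq_base {n : ℕ} {y : Fin n → ℕ × Σ _ : ι, D.V}
    (hy : IsOrderedSimplex D.horoballs y) {v : Fin n → D.V}
    (h : D.horoVertex ∘ y = CuspVertex.base ∘ v) :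
    ∃ z, IsOrderedSimplex D.peripheralComplex z ∧ y = boundaryVertex ∘ z ∧ v = Sigma.snd ∘ z := by
  have h1 : ∀ j, (y j).1 = 0 ∧ (y j).2.2 = v j := fun j =>
    CuspVertex.at_depth_eq_base.1 (congrFun h j)
  have h2 : y = boundaryVertex ∘ fun j => (y j).2 := funext fun j => Prod.ext (h1 j).1 rfl
  rw [h2] at hy
  exact ⟨_, isOrderedSimplex_boundaryVertex.1 hy, h2, funext fun j => (h1 j).2.symm⟩

/-- The index of a horoball is forgotten only at depth 0. A simplex outside `E_G` has a deeper
vertex, which determines the index for all its vertices. -/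
lemma horoVertex_comp_injective {n : ℕ} {y y' : Fin n → ℕ × Σ _ : ι, D.V}
    (hy : IsOrderedSimplex D.horoballs y) (hy' : IsOrderedSimplex D.horoballs y')
    (hv : ¬ ∃ v, IsOrderedSimplex D.EG v ∧ CuspVertex.base ∘ v = D.horoVertex ∘ y)
    (h : D.horoVertex ∘ y = D.horoVertex ∘ y') : y = y' := by
  obtain ⟨i, hi⟩ := exists_fst_eq_of_isOrderedSimplex hy
  obtain ⟨i', hi'⟩ := exists_fst_eq_of_isOrderedSimplex hy'
  have h1 := fun j => CuspVertex.at_depth_inj (congrFun h j)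
  have h2 : ∃ j, (y j).1 ≠ 0 := by
    by_contra! h0
    have h3 : y = boundaryVertex ∘ fun j => (y j).2 := funext fun j => Prod.ext (h0 j) rfl
    have hz := hy
    rw [h3] at hz
    refine hv ⟨_, isOrderedSimplex_snd (isOrderedSimplex_boundaryVertex.1 hz), funext fun j => ?_⟩
    exact (CuspVertex.at_depth_eq_base.2 ⟨h0 j, rfl⟩).symm
  obtain ⟨j, hj⟩ := h2
  have h4 : i = i' := (hi j).symm.trans (((h1 j).2.2 hj).trans (hi' j))
  exact funext fun l => Prod.ext (h1 l).1
    (Sigma.ext ((hi l).trans (h4.trans (hi' l).symm)) (heq_of_eq (h1 l).2.1))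

/-! ### Gluing cochains on `E_G` to cochains on the horoballs. -/

section Glue

variable {M : Type*} [AddCommGroup M] {n : ℕ}

open Classical in
/-- The cochain on the cusped space given by cochains on `E_G` and on the horoballs. -/
def glue (α : (Fin n → D.V) → M) (b : (Fin n → ℕ × Σ _ : ι, D.V) → M)
    (x : Fin n → CuspVertex ι D.V) : M :=
  if h : ∃ v, IsOrderedSimplex D.EG v ∧ CuspVertex.base ∘ v = x then α h.choose
  else if h : ∃ y, IsOrderedSimplex D.horoballs y ∧ D.horoVertex ∘ y = x then b h.choose else 0

/-- The two cochains agree on the boundary of the horoballs. -/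
def Compatible (α : (Fin n → D.V) → M) (b : (Fin n → ℕ × Σ _ : ι, D.V) → M) : Prop :=
  ∀ z, IsOrderedSimplex D.peripheralComplex z → α (Sigma.snd ∘ z) = b (boundaryVertex ∘ z)

lemma glue_add (α α' : (Fin n → D.V) → M) (b b' : (Fin n → ℕ × Σ _ : ι, D.V) → M) :
    glue (α + α') (b + b') = glue α b + glue α' b' := by
  funext x
  simp only [glue, Pi.add_apply]
  split_ifs <;> simp

lemma glue_base (α : (Fin n → D.V) → M) (b : (Fin n → ℕ × Σ _ : ι, D.V) → M) {v : Fin n → D.V}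
    (hv : IsOrderedSimplex D.EG v) : glue α b (CuspVertex.base ∘ v) = α v := by
  have h : ∃ v', IsOrderedSimplex D.EG v' ∧
      (CuspVertex.base ∘ v' : Fin n → CuspVertex ι D.V) = CuspVertex.base ∘ v := ⟨v, hv, rfl⟩
  rw [glue, dif_pos h]
  exact congrArg α (CuspVertex.base_injective.comp_left h.choose_spec.2)

lemma glue_horoVertex {α : (Fin n → D.V) → M} {b : (Fin n → ℕ × Σ _ : ι, D.V) → M}
    (hc : Compatible α b) {y : Fin n → ℕ × Σ _ : ι, D.V} (hy : IsOrderedSimplex D.horoballs y) :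
    glue α b (D.horoVertex ∘ y) = b y := by
  by_cases hv : ∃ v, IsOrderedSimplex D.EG v ∧ CuspVertex.base ∘ v = D.horoVertex ∘ y
  · obtain ⟨v, hv, h⟩ := hv
    obtain ⟨z, hz, rfl, rfl⟩ := exists_boundary_of_horoVertex_eq_base hy h.symm
    rw [← h, glue_base α b hv, hc z hz]
  · have h : ∃ y', IsOrderedSimplex D.horoballs y' ∧ D.horoVertex ∘ y' = D.horoVertex ∘ y :=
      ⟨y, hy, rfl⟩
    rw [glue, dif_neg hv, dif_pos h]
    exact congrArg b (horoVertex_comp_injective hy h.choose_spec.1 hv h.choose_spec.2.symm).symm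

lemma isCochain_glue {α : (Fin n → D.V) → M} {b : (Fin n → ℕ × Σ _ : ι, D.V) → M}
    (hα : IsCochain D.EG α) (hb : IsCochain D.horoballs b) (hc : Compatible α b) :
    IsCochain D.cuspedSpace (glue α b) := by
  have h0 : ∀ x, ¬ IsOrderedSimplex D.cuspedSpace x → glue α b x = 0 := fun x hx => by
    rw [glue, dif_neg, dif_neg]
    · rintro ⟨y, hy, rfl⟩
      exact hx (isOrderedSimplex_horoVertex hy)
    · rintro ⟨v, hv, rfl⟩
      exact hx (isOrderedSimplex_base hv)
  refine ⟨h0, fun x π => ?_⟩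
  by_cases hx : IsOrderedSimplex D.cuspedSpace x
  · rcases isOrderedSimplex_cuspedSpace_cases hx with ⟨v, hv, rfl⟩ | ⟨y, hy, rfl⟩
    · rw [Function.comp_assoc, glue_base α b hv, glue_base α b ((isOrderedSimplex_perm π).2 hv),
        hα.perm]
    · rw [Function.comp_assoc, glue_horoVertex hc hy,
        glue_horoVertex hc ((isOrderedSimplex_perm π).2 hy), hb.perm]
  · rw [h0 x hx, h0 _ (mt (isOrderedSimplex_perm π).1 hx), smul_zero]

lemma finite_support_glue {α : (Fin n → D.V) → M} {b : (Fin n → ℕ × Σ _ : ι, D.V) → M}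
    (hα : α.support.Finite) (hb : b.support.Finite) : (glue α b).support.Finite := by
  refine ((hα.image fun v => CuspVertex.base ∘ v).union
    (hb.image fun y => D.horoVertex ∘ y)).subset fun x hx => ?_
  rw [Function.mem_support, glue] at hx
  split_ifs at hx with h1 h2
  · exact Or.inl ⟨_, hx, h1.choose_spec.2⟩
  · exact Or.inr ⟨_, hx, h2.choose_spec.2⟩
  · exact (hx rfl).elim

lemma cuspedSpace_cochain_ext {φ ψ : (Fin n → CuspVertex ι D.V) → M}
    (hφ : IsCochain D.cuspedSpace φ) (hψ : IsCochain D.cuspedSpace ψ)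
    (h1 : ∀ v, IsOrderedSimplex D.EG v → φ (CuspVertex.base ∘ v) = ψ (CuspVertex.base ∘ v))
    (h2 : ∀ y, IsOrderedSimplex D.horoballs y → φ (D.horoVertex ∘ y) = ψ (D.horoVertex ∘ y)) :
    φ = ψ := by
  funext x
  by_cases hx : IsOrderedSimplex D.cuspedSpace x
  · rcases isOrderedSimplex_cuspedSpace_cases hx with ⟨v, hv, rfl⟩ | ⟨y, hy, rfl⟩
    exacts [h1 v hv, h2 y hy]
  · rw [hφ.eq_zero x hx, hψ.eq_zero x hx]

/-- Coboundaries commute with the restrictions to both pieces, and a cochain is determined by these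
restrictions. -/
lemma coboundary_glue {α : (Fin n → D.V) → M} {b : (Fin n → ℕ × Σ _ : ι, D.V) → M}
    (hα : IsCochain D.EG α) (hb : IsCochain D.horoballs b) (hc : Compatible α b) :
    simplicialCoboundary D.cuspedSpace n (glue α b) =
      glue (simplicialCoboundary D.EG n α) (simplicialCoboundary D.horoballs n b) := by
  have hg := isCochain_glue hα hb hc
  have h1 : pullback D.EG CuspVertex.base (glue α b) = α :=
    pullback_eq hα fun v hv => glue_base α b hv
  have h2 : pullback D.horoballs D.horoVertex (glue α b) = b :=
    pullback_eq hb fun y hy => glue_horoVertex hc hy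
  have h3 := pullback_coboundary (fun hx => isOrderedSimplex_base hx) hg
  have h4 := pullback_coboundary (fun hx => isOrderedSimplex_horoVertex hx) hg
  rw [h1] at h3
  rw [h2] at h4
  have hc' : Compatible (simplicialCoboundary D.EG n α) (simplicialCoboundary D.horoballs n b) :=
    fun z hz => by
      rw [← h3, ← h4, pullback_apply _ (isOrderedSimplex_snd hz),
        pullback_apply _ (isOrderedSimplex_boundaryVertex.2 hz)]
      rfl
  refine cuspedSpace_cochain_ext hg.coboundary (isCochain_glue hα.coboundary hb.coboundary hc')
    (fun v hv => ?_) fun y hy => ?_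
  · rw [glue_base _ _ hv, ← h3, pullback_apply _ hv]
  · rw [glue_horoVertex hc' hy, ← h4, pullback_apply _ hy]

open Classical in
/-- Extension of a cochain from the boundary of the horoballs. -/
def extendBoundary (β : (Fin n → Σ _ : ι, D.V) → M) (y : Fin n → ℕ × Σ _ : ι, D.V) : M :=
  if ∀ j, (y j).1 = 0 then β fun j => (y j).2 else 0

lemma extendBoundary_boundaryVertex (β : (Fin n → Σ _ : ι, D.V) → M) (z : Fin n → Σ _ : ι, D.V) :
    extendBoundary β (boundaryVertex ∘ z) = β z := if_pos fun _ => rfl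

lemma extendBoundary_add (β β' : (Fin n → Σ _ : ι, D.V) → M) :
    extendBoundary (β + β') = extendBoundary β + extendBoundary β' := by
  funext y
  simp only [extendBoundary, Pi.add_apply]
  split_ifs <;> simp

lemma isCochain_extendBoundary {β : (Fin n → Σ _ : ι, D.V) → M}
    (hβ : IsCochain D.peripheralComplex β) : IsCochain D.horoballs (extendBoundary β) := by
  refine ⟨fun y hy => ?_, fun y π => ?_⟩
  · rw [extendBoundary]
    split_ifs with h
    · refine hβ.eq_zero _ fun hz => hy ?_
      have h3 : y = boundaryVertex ∘ fun j => (y j).2 := funext fun j => Prod.ext (h j) rfl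
      rw [h3]
      exact isOrderedSimplex_boundaryVertex.2 hz
    · rfl
  · have : (∀ j, ((y ∘ π) j).1 = 0) ↔ ∀ j, (y j).1 = 0 :=
      π.forall_congr_left (p := fun j => ((y ∘ π) j).1 = 0) |>.trans (by simp)
    by_cases h : ∀ j, (y j).1 = 0
    · rw [extendBoundary, extendBoundary, if_pos h, if_pos (this.2 h), ← hβ.perm]
      rfl
    · rw [extendBoundary, extendBoundary, if_neg h, if_neg (mt this.1 h), smul_zero]

lemma finite_support_extendBoundary {β : (Fin n → Σ _ : ι, D.V) → M} (hβ : β.support.Finite) :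
    (extendBoundary β).support.Finite := by
  refine (hβ.image fun z => boundaryVertex ∘ z).subset fun y hy => ?_
  rw [Function.mem_support, extendBoundary] at hy
  split_ifs at hy with h
  · exact ⟨_, hy, funext fun j => Prod.ext (h j).symm rfl⟩
  · exact (hy rfl).elim

end Glue

end CuspedSpaceData

/-! ### Relative cocycles and cocycles of the cusped space -/

open CompactCohomology

namespace CuspedSpaceData

variable {G : Type u} [Group G] {ι : Type} {P : ι → Subgroup G} {N : ℕ}
  {D : CuspedSpaceData.{u, w} P N}

section Cochains

variable {M : Type*} [AddCommGroup M] {n : ℕ}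

lemma simplicialCoboundary_zero_cochain {W : Type*} {K : PreAbstractSimplicialComplex W} :
    simplicialCoboundary K n (0 : (Fin n → W) → M) = 0 := by
  rw [← sub_self (0 : (Fin n → W) → M), simplicialCoboundary_sub, sub_self]

lemma isLocallyFinite_horoballs [Finite ι] : IsLocallyFinite D.horoballs :=
  isLocallyFinite_horoballComplex
    (isLocallyFinite_of_free D.peripheralComplex_free D.peripheralComplex_finite)

lemma finite_preimage_horoVertex [Finite ι] (x : CuspVertex ι D.V) :
    (D.horoVertex ⁻¹' {x}).Finite := by
  by_cases h : ∃ y, D.horoVertex y = x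
  · obtain ⟨y, rfl⟩ := h
    refine (Set.finite_range fun i : ι => ((y.1, ⟨i, y.2.2⟩) : ℕ × Σ _ : ι, D.V)).subset
      fun z hz => ?_
    obtain ⟨h1, h2, -⟩ := CuspVertex.at_depth_inj (Set.mem_singleton_iff.1 hz)
    exact ⟨z.2.1, Prod.ext h1.symm (Sigma.ext rfl (heq_of_eq h2.symm))⟩
  · convert Set.finite_empty
    exact Set.eq_empty_iff_forall_notMem.2 fun y hy => h ⟨y, hy⟩

lemma finite_preimage_of_injective {W W' : Type*} {f : W → W'} (hf : Function.Injective f) (w : W') :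
    (f ⁻¹' {w}).Finite := (Set.finite_singleton w).preimage hf.injOn

lemma boundaryVertex_injective : Function.Injective (boundaryVertex (D := D)) :=
  Prod.mk_right_injective 0

lemma finite_preimage_snd [Finite ι] (v : D.V) :
    ((Sigma.snd : (Σ _ : ι, D.V) → D.V) ⁻¹' {v}).Finite :=
  (Set.finite_range fun i : ι => (⟨i, v⟩ : Σ _ : ι, D.V)).subset fun z hz =>
    ⟨z.1, Sigma.ext rfl (heq_of_eq (Set.mem_singleton_iff.1 hz).symm)⟩

lemma pullback_boundaryVertex_extendBoundary {β : (Fin n → Σ _ : ι, D.V) → M}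
    (hβ : IsCochain D.peripheralComplex β) :
    pullback D.peripheralComplex boundaryVertex (extendBoundary β) = β :=
  pullback_eq hβ fun z _ => extendBoundary_boundaryVertex β z

lemma pullback_boundaryVertex_coboundary {b : (Fin n → ℕ × Σ _ : ι, D.V) → M}
    (hb : IsCochain D.horoballs b) :
    pullback D.peripheralComplex boundaryVertex (simplicialCoboundary D.horoballs n b) =
      simplicialCoboundary D.peripheralComplex n (pullback D.peripheralComplex boundaryVertex b) :=
  pullback_coboundary (fun hx => isOrderedSimplex_boundaryVertex.2 hx) hb

lemma compatible_of_pullback_eq {α : (Fin n → D.V) → M} {b : (Fin n → ℕ × Σ _ : ι, D.V) → M}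
    (h : pullback D.peripheralComplex Sigma.snd α =
      pullback D.peripheralComplex boundaryVertex b) : Compatible α b := fun z hz => by
  have := congrFun h z
  rwa [pullback_apply _ hz, pullback_apply _ hz] at this

lemma glue_pullback {ψ : (Fin n → CuspVertex ι D.V) → M} (hψ : IsCochain D.cuspedSpace ψ) :
    glue (pullback D.EG CuspVertex.base ψ) (pullback D.horoballs D.horoVertex ψ) = ψ := by
  have hc : Compatible (pullback D.EG CuspVertex.base ψ) (pullback D.horoballs D.horoVertex ψ) :=
    fun z hz => by
      rw [pullback_apply _ (isOrderedSimplex_snd hz),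
        pullback_apply _ (isOrderedSimplex_boundaryVertex.2 hz)]
      rfl
  refine cuspedSpace_cochain_ext (isCochain_glue hψ.pullback hψ.pullback hc) hψ (fun v hv => ?_)
    fun y hy => ?_
  · rw [glue_base _ _ hv, pullback_apply _ hv]
  · rw [glue_horoVertex hc hy, pullback_apply _ hy]

lemma pullback_snd_pullback_base (ψ : (Fin n → CuspVertex ι D.V) → M) :
    pullback D.peripheralComplex Sigma.snd (pullback D.EG CuspVertex.base ψ) =
      pullback D.peripheralComplex boundaryVertex (pullback D.horoballs D.horoVertex ψ) := by
  funext z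
  by_cases hz : IsOrderedSimplex D.peripheralComplex z
  · rw [pullback_apply _ hz, pullback_apply _ hz, pullback_apply _ (isOrderedSimplex_snd hz),
      pullback_apply _ (isOrderedSimplex_boundaryVertex.2 hz)]
    rfl
  · rw [pullback_of_not _ hz, pullback_of_not _ hz]

/-- The cochain on the cusped space given by a relative cochain. -/
def relGlue (α : (Fin (n + 1) → D.V) → M) (β : (Fin n → Σ _ : ι, D.V) → M) :
    (Fin (n + 1) → CuspVertex ι D.V) → M :=
  glue α (simplicialCoboundary D.horoballs n (extendBoundary β))

lemma relGlue_add (α α' : (Fin (n + 1) → D.V) → M) (β β' : (Fin n → Σ _ : ι, D.V) → M) :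
    relGlue (α + α') (β + β') = relGlue α β + relGlue α' β' := by
  rw [relGlue, extendBoundary_add, simplicialCoboundary_add, glue_add]
  rfl

section

variable {α : (Fin (n + 1) → D.V) → M} {β : (Fin n → Σ _ : ι, D.V) → M}

lemma compatible_coboundary_extendBoundary (hβ : IsCochain D.peripheralComplex β)
    (h : pullback D.peripheralComplex Sigma.snd α = simplicialCoboundary D.peripheralComplex n β) :
    Compatible α (simplicialCoboundary D.horoballs n (extendBoundary β)) :=
  compatible_of_pullback_eq (by
    rw [h, pullback_boundaryVertex_coboundary (isCochain_extendBoundary hβ),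
      pullback_boundaryVertex_extendBoundary hβ])

lemma isCochain_relGlue (hα : IsCochain D.EG α) (hβ : IsCochain D.peripheralComplex β)
    (h : pullback D.peripheralComplex Sigma.snd α = simplicialCoboundary D.peripheralComplex n β) :
    IsCochain D.cuspedSpace (relGlue α β) :=
  isCochain_glue hα (isCochain_extendBoundary hβ).coboundary
    (compatible_coboundary_extendBoundary hβ h)

lemma finite_support_relGlue [Finite ι] (hα : α.support.Finite)
    (hβ : IsCochain D.peripheralComplex β) (hβ' : β.support.Finite) :
    (relGlue α β).support.Finite :=
  finite_support_glue hα (isLocallyFinite_horoballs.finite_support_coboundary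
    (isCochain_extendBoundary hβ) (finite_support_extendBoundary hβ'))

lemma glue_zero : glue (0 : (Fin n → D.V) → M) 0 = 0 := by
  funext x
  simp only [glue, Pi.zero_apply]
  split_ifs <;> rfl

lemma coboundary_relGlue (hα : IsCochain D.EG α) (hβ : IsCochain D.peripheralComplex β)
    (h : pullback D.peripheralComplex Sigma.snd α = simplicialCoboundary D.peripheralComplex n β)
    (hd : simplicialCoboundary D.EG (n + 1) α = 0) :
    simplicialCoboundary D.cuspedSpace (n + 1) (relGlue α β) = 0 := by
  rw [relGlue, coboundary_glue hα (isCochain_extendBoundary hβ).coboundary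
    (compatible_coboundary_extendBoundary hβ h), hd, simplicialCoboundary_simplicialCoboundary,
    glue_zero]

end

/-- On the horoballs `ψ` is a coboundary `δη`. Take `α` to be the restriction of `ψ` to `E_G` and
`β` that of `η` to the boundary. Then `η` minus the extension of `β` by zero vanishes on the
boundary, so it glues with `0` to give `θ`. -/
lemma exists_relGlue_add_coboundary_eq [Finite ι] {ψ : (Fin (n + 1) → CuspVertex ι D.V) → M}
    (hψ : IsCochain D.cuspedSpace ψ) (hfin : ψ.support.Finite)
    (hd : simplicialCoboundary D.cuspedSpace (n + 1) ψ = 0) :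
    ∃ (α : (Fin (n + 1) → D.V) → M) (β : (Fin n → Σ _ : ι, D.V) → M)
      (θ : (Fin n → CuspVertex ι D.V) → M),
      (IsCochain D.EG α ∧ α.support.Finite) ∧
      (IsCochain D.peripheralComplex β ∧ β.support.Finite) ∧
      (IsCochain D.cuspedSpace θ ∧ θ.support.Finite) ∧
      simplicialCoboundary D.EG (n + 1) α = 0 ∧
      pullback D.peripheralComplex Sigma.snd α = simplicialCoboundary D.peripheralComplex n β ∧
      relGlue α β + simplicialCoboundary D.cuspedSpace n θ = ψ := by
  obtain ⟨η, hη, hηf, hηd⟩ := exists_coboundary_eq_of_horoball D.isFaceOrder_peripheralLt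
    (hψ.pullback (K := D.horoballs) (f := D.horoVertex))
    (finite_support_pullback finite_preimage_horoVertex hfin) (by
      rw [← pullback_coboundary (fun hx => isOrderedSimplex_horoVertex hx) hψ, hd]
      exact pullback_eq IsCochain.zero fun _ _ => rfl)
  have hβ : IsCochain D.peripheralComplex (pullback D.peripheralComplex boundaryVertex η) :=
    hη.pullback
  have hβf : (pullback D.peripheralComplex boundaryVertex η).support.Finite :=
    finite_support_pullback (finite_preimage_of_injective boundaryVertex_injective) hηf
  have hb : IsCochain D.horoballs
      (η - extendBoundary (pullback D.peripheralComplex boundaryVertex η)) :=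
    hη.sub (isCochain_extendBoundary hβ)
  have hc : Compatible (0 : (Fin n → D.V) → M)
      (η - extendBoundary (pullback D.peripheralComplex boundaryVertex η)) := fun z hz => by
    rw [Pi.sub_apply, extendBoundary_boundaryVertex, pullback_apply _ hz, sub_self]
    rfl
  refine ⟨pullback D.EG CuspVertex.base ψ, pullback D.peripheralComplex boundaryVertex η, glue 0
      (η - extendBoundary (pullback D.peripheralComplex boundaryVertex η)),
    ⟨hψ.pullback, finite_support_pullback
      (finite_preimage_of_injective CuspVertex.base_injective) hfin⟩,
    ⟨hβ, hβf⟩, ⟨isCochain_glue IsCochain.zero hb hc, finite_support_glue ?_ ?_⟩, ?_, ?_, ?_⟩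
  · rw [Function.support_zero]
    exact Set.finite_empty
  · rw [sub_eq_add_neg]
    refine (hηf.union ?_).subset (Function.support_add _ _)
    rw [Function.support_neg]
    exact finite_support_extendBoundary hβf
  · rw [← pullback_coboundary (fun hx => isOrderedSimplex_base hx) hψ, hd]
    exact pullback_eq IsCochain.zero fun _ _ => rfl
  · rw [pullback_snd_pullback_base, ← hηd, pullback_boundaryVertex_coboundary hη]
  · rw [coboundary_glue IsCochain.zero hb hc, simplicialCoboundary_zero_cochain, relGlue, ← glue_add,
      add_zero, simplicialCoboundary_sub, add_sub_cancel, hηd, glue_pullback hψ]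

/-- On the horoballs `θ` and the extension of `β` have the same coboundary, so they differ by some
`δη`. The restrictions of `θ` to `E_G` and of `η` to the boundary form the relative primitive. -/
lemma exists_relative_coboundary [Finite ι] {α : (Fin (n + 2) → D.V) → M}
    {β : (Fin (n + 1) → Σ _ : ι, D.V) → M} (hα : IsCochain D.EG α)
    (hβ : IsCochain D.peripheralComplex β) (hβf : β.support.Finite)
    (h : pullback D.peripheralComplex Sigma.snd α =
      simplicialCoboundary D.peripheralComplex (n + 1) β)
    {θ : (Fin (n + 1) → CuspVertex ι D.V) → M} (hθ : IsCochain D.cuspedSpace θ)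
    (hθf : θ.support.Finite) (hd : simplicialCoboundary D.cuspedSpace (n + 1) θ = relGlue α β) :
    ∃ (α' : (Fin (n + 1) → D.V) → M) (β' : (Fin n → Σ _ : ι, D.V) → M),
      (IsCochain D.EG α' ∧ α'.support.Finite) ∧
      (IsCochain D.peripheralComplex β' ∧ β'.support.Finite) ∧
      simplicialCoboundary D.EG (n + 1) α' = α ∧
      pullback D.peripheralComplex Sigma.snd α' -
        simplicialCoboundary D.peripheralComplex n β' = β := by
  have hc := compatible_coboundary_extendBoundary hβ h
  have hθH : (pullback D.horoballs D.horoVertex θ).support.Finite :=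
    finite_support_pullback finite_preimage_horoVertex hθf
  obtain ⟨η, hη, hηf, hηd⟩ := exists_coboundary_eq_of_horoball D.isFaceOrder_peripheralLt
    ((hθ.pullback (K := D.horoballs) (f := D.horoVertex)).sub (isCochain_extendBoundary hβ))
    (by
      rw [sub_eq_add_neg]
      refine (hθH.union ?_).subset (Function.support_add _ _)
      rw [Function.support_neg]
      exact finite_support_extendBoundary hβf) (by
      rw [simplicialCoboundary_sub,
        ← pullback_coboundary (fun hx => isOrderedSimplex_horoVertex hx) hθ, hd, sub_eq_zero]
      exact pullback_eq (isCochain_extendBoundary hβ).coboundary fun y hy => glue_horoVertex hc hy)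
  refine ⟨pullback D.EG CuspVertex.base θ, pullback D.peripheralComplex boundaryVertex η,
    ⟨hθ.pullback, finite_support_pullback
      (finite_preimage_of_injective CuspVertex.base_injective) hθf⟩,
    ⟨hη.pullback, finite_support_pullback
      (finite_preimage_of_injective boundaryVertex_injective) hηf⟩, ?_, ?_⟩
  · rw [← pullback_coboundary (fun hx => isOrderedSimplex_base hx) hθ, hd]
    exact pullback_eq hα fun v hv => glue_base _ _ hv
  · rw [← pullback_boundaryVertex_coboundary hη, hηd, pullback_sub,
      pullback_boundaryVertex_extendBoundary hβ, pullback_snd_pullback_base, sub_sub_cancel]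

/-- Writing `γ` for the peripheral part of the relative coboundary, `α` restricts to `γ + δβ` on the
boundary. It therefore glues to the extension of `γ` plus the coboundary of the extension of `β`,
and the latter dies under `δ`. -/
lemma exists_coboundary_eq_relGlue [Finite ι] {α : (Fin (n + 1) → D.V) → M}
    {β : (Fin n → Σ _ : ι, D.V) → M} (hα : IsCochain D.EG α) (hαf : α.support.Finite)
    (hβ : IsCochain D.peripheralComplex β) (hβf : β.support.Finite) :
    ∃ θ : (Fin (n + 1) → CuspVertex ι D.V) → M,
      (IsCochain D.cuspedSpace θ ∧ θ.support.Finite) ∧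
      simplicialCoboundary D.cuspedSpace (n + 1) θ =
        relGlue (simplicialCoboundary D.EG (n + 1) α)
          (pullback D.peripheralComplex Sigma.snd α -
            simplicialCoboundary D.peripheralComplex n β) := by
  set γ := pullback D.peripheralComplex Sigma.snd α -
    simplicialCoboundary D.peripheralComplex n β with hγ_def
  have hγ : IsCochain D.peripheralComplex γ := hα.pullback.sub hβ.coboundary
  have hγf : γ.support.Finite := by
    rw [hγ_def, sub_eq_add_neg]
    refine ((finite_support_pullback finite_preimage_snd hαf).union ?_).subset
      (Function.support_add _ _)
    rw [Function.support_neg]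
    exact (isLocallyFinite_of_free D.peripheralComplex_free
      D.peripheralComplex_finite).finite_support_coboundary hβ hβf
  have hb : IsCochain D.horoballs
      (extendBoundary γ + simplicialCoboundary D.horoballs n (extendBoundary β)) :=
    (isCochain_extendBoundary hγ).add (isCochain_extendBoundary hβ).coboundary
  have hc : Compatible α
      (extendBoundary γ + simplicialCoboundary D.horoballs n (extendBoundary β)) :=
    compatible_of_pullback_eq (by
      rw [pullback_add, pullback_boundaryVertex_extendBoundary hγ,
        pullback_boundaryVertex_coboundary (isCochain_extendBoundary hβ),
        pullback_boundaryVertex_extendBoundary hβ, sub_add_cancel])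
  refine ⟨glue α (extendBoundary γ + simplicialCoboundary D.horoballs n (extendBoundary β)),
    ⟨isCochain_glue hα hb hc, finite_support_glue hαf
      (((finite_support_extendBoundary hγf).union
        (isLocallyFinite_horoballs.finite_support_coboundary (isCochain_extendBoundary hβ)
          (finite_support_extendBoundary hβf))).subset (Function.support_add _ _))⟩, ?_⟩
  rw [coboundary_glue hα hb hc, simplicialCoboundary_add, simplicialCoboundary_simplicialCoboundary,
    add_zero]
  rfl

end Cochains

/-! ### Compatibility of the gluing with the right action. -/

section Action

variable {A : Type v} [Ring A] {n : ℕ}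

lemma isOrderedSimplex_translate (g : G) {y : Fin n → ℕ × Σ _ : ι, D.V} :
    IsOrderedSimplex D.horoballs (fun j => ((y j).1, g • (y j).2)) ↔
      IsOrderedSimplex D.horoballs y := by
  have key : ∀ (g : G) {y : Fin n → ℕ × Σ _ : ι, D.V}, IsOrderedSimplex D.horoballs y →
      IsOrderedSimplex D.horoballs (fun j => ((y j).1, g • (y j).2)) := fun g y hy => by
    obtain ⟨m, rfl⟩ := Nat.exists_eq_succ_of_ne_zero hy.pos.ne'
    obtain ⟨m, t, ht, h1, h2⟩ := mem_horoballComplex_tuples.1 hy.mem_tuples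
    refine isOrderedSimplex_of_mem_tuples (mem_horoballComplex_tuples.2
      ⟨m, translateFace g t, D.peripheralComplex_invariant g t ht,
        fun j => ⟨mem_translateFace.2 ⟨_, (h1 j).1, rfl⟩, (h1 j).2⟩, fun j l hj hl => ?_⟩)
      fun j l h => hy.1 ?_
    · exact (h2 j l hj hl).imp (congrArg (g • ·)) (D.lt_invariant _ g _ _)
    · exact Prod.ext (Prod.mk.inj h).1 (MulAction.injective g (Prod.mk.inj h).2)
  refine ⟨fun h => ?_, key g⟩
  have := key g⁻¹ h
  simpa using this

/-- Translation acts on a horoball without changing depth, so it preserves extension by zero. -/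
lemma coboundary_extendBoundary_actCochain (g : G) (a : A) (β : (Fin n → Σ _ : ι, D.V) → A)
    (y : Fin (n + 1) → ℕ × Σ _ : ι, D.V) :
    simplicialCoboundary D.horoballs n (extendBoundary (actCochain g a n β)) y =
      simplicialCoboundary D.horoballs n (extendBoundary β) (fun j => ((y j).1, g • (y j).2)) * a := by
  by_cases hy : IsOrderedSimplex D.horoballs y
  · rw [simplicialCoboundary_of_isOrderedSimplex _ hy,
      simplicialCoboundary_of_isOrderedSimplex _ ((isOrderedSimplex_translate g).2 hy),
      faceSum_apply, faceSum_apply, Finset.sum_mul]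
    refine Finset.sum_congr rfl fun j _ => ?_
    rw [smul_mul_assoc]
    congr 1
    by_cases h : ∀ l, (y (j.succAbove l)).1 = 0
    · exact (if_pos h).trans (congrArg (· * a) (if_pos h).symm)
    · exact (if_neg h).trans ((zero_mul a).symm.trans (congrArg (· * a) (if_neg h).symm))
  · rw [simplicialCoboundary_of_not _ hy,
      simplicialCoboundary_of_not _ (mt (isOrderedSimplex_translate g).1 hy), zero_mul]

lemma isCochain_actCochain {W : Type*} [MulAction G W] {K : PreAbstractSimplicialComplex W}
    (hK : K.IsInvariant G) (g : G) (a : A) {φ : (Fin n → W) → A} (hφ : IsCochain K φ) :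
    IsCochain K (actCochain g a n φ) where
  eq_zero x hx := by
    change φ (g • x) * a = 0
    rw [hφ.eq_zero _ (mt (isOrderedSimplex_smul_iff hK g).1 hx), zero_mul]
  perm x π := by
    change φ ((g • x) ∘ π) * a = _ • (φ (g • x) * a)
    rw [hφ.perm, smul_mul_assoc]

lemma relGlue_actCochain (g : G) (a : A) {α : (Fin (n + 1) → D.V) → A}
    {β : (Fin n → Σ _ : ι, D.V) → A} (hα : IsCochain D.EG α)
    (hβ : IsCochain D.peripheralComplex β)
    (h : pullback D.peripheralComplex Sigma.snd α = simplicialCoboundary D.peripheralComplex n β)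
    (h' : pullback D.peripheralComplex Sigma.snd (actCochain g a (n + 1) α) =
      simplicialCoboundary D.peripheralComplex n (actCochain g a n β)) :
    relGlue (actCochain g a (n + 1) α) (actCochain g a n β) =
      actCochain g a (n + 1) (relGlue α β) := by
  have hα' := isCochain_actCochain D.EG_invariant g a hα
  have hβ' := isCochain_actCochain D.peripheralComplex_invariant g a hβ
  refine cuspedSpace_cochain_ext (isCochain_relGlue hα' hβ' h')
    (isCochain_actCochain D.cuspedSpace_invariant g a (isCochain_relGlue hα hβ h))
    (fun v hv => ?_) fun y hy => ?_
  · exact (glue_base _ _ hv).trans (congrArg (· * a)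
      (glue_base _ _ ((isOrderedSimplex_smul_iff D.EG_invariant g).2 hv)).symm)
  · refine (glue_horoVertex (compatible_coboundary_extendBoundary hβ' h') hy).trans ?_
    rw [coboundary_extendBoundary_actCochain]
    refine congrArg (· * a) ?_
    rw [← glue_horoVertex (compatible_coboundary_extendBoundary hβ h)
      ((isOrderedSimplex_translate g).2 hy)]
    exact congrArg (relGlue α β) (funext fun j => (CuspVertex.smul_at_depth g _ _ _).symm)

end Action

/-- In degree 0 the peripheral cochain `β` lives on the empty tuple and is zero, so `α` vanishes at
the peripheral vertices. A cocycle in degree 0 is constant on the connected `E_G`, and a peripheral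
vertex exists. -/
lemma eq_zero_of_coboundary_eq_zero [Finite ι] [Nonempty ι] {M : Type*} [AddCommGroup M]
    {ψ : (Fin 1 → CuspVertex ι D.V) → M} (hψ : IsCochain D.cuspedSpace ψ) (hfin : ψ.support.Finite)
    (hd : simplicialCoboundary D.cuspedSpace 1 ψ = 0) : ψ = 0 := by
  obtain ⟨α, β, θ, ⟨hα, -⟩, ⟨hβ, -⟩, ⟨hθ, -⟩, hα0, hαβ, rfl⟩ :=
    exists_relGlue_add_coboundary_eq hψ hfin hd
  rw [hβ.of_isEmpty, simplicialCoboundary_zero_cochain] at hαβ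
  have hα' : α = 0 := by
    have hb : ∀ c : OrientedChain D.EG 2,
        OrientedChain.lift hα (OrientedChain.bdry D.EG 1 c) = 0 := fun c =>
      OrientedChain.addHom_ext (f := OrientedChain.lift hα ∘ₗ OrientedChain.bdry D.EG 1)
        (g := (0 : OrientedChain D.EG 2 →ₗ[ℤ] M)) (fun x hx => by
        have h1 := OrientedChain.map_bdry_cls (f := OrientedChain.lift hα) x
        have h2 : (fun y => OrientedChain.lift hα (OrientedChain.cls D.EG y)) = α :=
          funext fun y => OrientedChain.lift_cls hα y
        rw [h2, hα0] at h1
        exact h1) c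
    obtain ⟨i⟩ := ‹Nonempty ι›
    obtain ⟨v₀, hv₀⟩ := (D.EP_connected i).exists_vertex
    have hv₀' := isOrderedSimplex_const (D.EP_le i hv₀)
    have h0 : α (fun _ => v₀) = 0 := by
      have hz : IsOrderedSimplex D.peripheralComplex fun _ : Fin 1 => (⟨i, v₀⟩ : Σ _ : ι, D.V) :=
        isOrderedSimplex_of_mem_tuples_one (mem_peripheralComplex_tuples.2
          ⟨i, {v₀}, ⟨1, {v₀}, hv₀, by ext; simp [mem_translateFace, eq_comm]⟩,
            fun _ => ⟨v₀, Finset.mem_singleton_self v₀, rfl⟩⟩)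
      have := congrFun hαβ fun _ => ⟨i, v₀⟩
      rwa [pullback_apply _ hz] at this
    funext x
    by_cases hx : IsOrderedSimplex D.EG x
    · obtain ⟨e, he⟩ := D.exists_bdry_eq_of_augG
        (c := EquivariantChain.cls D.EG_invariant x - EquivariantChain.cls D.EG_invariant fun _ => v₀)
        (by
          have h1 : D.augG (EquivariantChain.cls D.EG_invariant x) = 1 :=
            OrientedChain.vertexMap_cls hx
          have h2 : D.augG (EquivariantChain.cls D.EG_invariant fun _ => v₀) = 1 :=
            OrientedChain.vertexMap_cls hv₀'
          rw [map_sub, h1, h2, sub_self])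
      have h1 : OrientedChain.bdry D.EG 1 e = OrientedChain.cls D.EG x -
        OrientedChain.cls D.EG fun _ => v₀ := he
      have h2 := hb e
      rw [h1, map_sub, OrientedChain.lift_cls, OrientedChain.lift_cls, h0, sub_zero] at h2
      exact h2
    · exact hα.eq_zero x hx
  have h1 : extendBoundary (0 : (Fin 0 → Σ _ : ι, D.V) → M) = 0 := by
    funext y
    simp [extendBoundary]
  rw [hα', hβ.of_isEmpty, hθ.of_isEmpty, simplicialCoboundary_zero_cochain, relGlue, h1,
    simplicialCoboundary_zero_cochain, glue_zero, add_zero]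

end CuspedSpaceData

/-! ### The comparison map -/

open CompactCohomology RelativeCohomology

namespace CuspedSpaceData

variable {G : Type u} [Group G] {ι : Type} {P : ι → Subgroup G} {N : ℕ}
  (D : CuspedSpaceData.{u, w} P N) {A : Type v} [Ring A] {n : ℕ}

variable {D}

/-- The component on `E_G` of the compactly supported cochain of a relative cochain. -/
def innerCochain (f : D.RelChain n →ₗ[MonoidAlgebra ℤ G] coefficients G A) :
    (Fin (n + 1) → D.V) → A := EquivariantChain.toCochain (f ∘ₗ LinearMap.inl _ _ _)

/-- The peripheral component of the compactly supported cochain of a relative cochain. -/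
def outerCochain (f : D.RelChain n →ₗ[MonoidAlgebra ℤ G] coefficients G A) :
    (Fin n → Σ _ : ι, D.V) → A := EquivariantChain.toCochain (f ∘ₗ LinearMap.inr _ _ _)

lemma isCochain_innerCochain (f : D.RelChain n →ₗ[MonoidAlgebra ℤ G] coefficients G A) :
    IsCochain D.EG (innerCochain f) := EquivariantChain.isCochain_toCochain _

lemma isCochain_outerCochain (f : D.RelChain n →ₗ[MonoidAlgebra ℤ G] coefficients G A) :
    IsCochain D.peripheralComplex (outerCochain f) := EquivariantChain.isCochain_toCochain _

lemma finite_support_innerCochain (f : D.RelChain n →ₗ[MonoidAlgebra ℤ G] coefficients G A) :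
    (innerCochain f).support.Finite := by
  obtain ⟨T, hT, h⟩ := D.EG_finite
  exact EquivariantChain.finite_support_toCochain hT h _

lemma finite_support_outerCochain [Finite ι]
    (f : D.RelChain n →ₗ[MonoidAlgebra ℤ G] coefficients G A) :
    (outerCochain f).support.Finite := by
  obtain ⟨T, hT, h⟩ := D.peripheralComplex_finite
  exact EquivariantChain.finite_support_toCochain hT h _

lemma innerCochain_add (f f' : D.RelChain n →ₗ[MonoidAlgebra ℤ G] coefficients G A) :
    innerCochain (f + f') = innerCochain f + innerCochain f' := by
  rw [innerCochain, LinearMap.add_comp, EquivariantChain.toCochain_add]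
  rfl

lemma outerCochain_add (f f' : D.RelChain n →ₗ[MonoidAlgebra ℤ G] coefficients G A) :
    outerCochain (f + f') = outerCochain f + outerCochain f' := by
  rw [outerCochain, LinearMap.add_comp, EquivariantChain.toCochain_add]
  rfl

lemma relHom_ext {f f' : D.RelChain n →ₗ[MonoidAlgebra ℤ G] coefficients G A}
    (h1 : innerCochain f = innerCochain f') (h2 : outerCochain f = outerCochain f') : f = f' :=
  LinearMap.prod_ext (EquivariantChain.toCochain_injective h1)
    (EquivariantChain.toCochain_injective h2)

lemma exists_relHom {α : (Fin (n + 1) → D.V) → A} {β : (Fin n → Σ _ : ι, D.V) → A}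
    (hα : IsCochain D.EG α) (hαf : α.support.Finite) (hβ : IsCochain D.peripheralComplex β)
    (hβf : β.support.Finite) : ∃ f : D.RelChain n →ₗ[MonoidAlgebra ℤ G] coefficients G A,
      innerCochain f = α ∧ outerCochain f = β := by
  obtain ⟨a, rfl⟩ := EquivariantChain.exists_toCochain_eq D.EG_invariant D.EG_free hα hαf
  obtain ⟨b, rfl⟩ := EquivariantChain.exists_toCochain_eq D.peripheralComplex_invariant
    D.peripheralComplex_free hβ hβf
  refine ⟨a.coprod b, ?_, ?_⟩
  · rw [innerCochain, LinearMap.coprod_inl]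
  · rw [outerCochain, LinearMap.coprod_inr]

lemma innerCochain_comp_relBdry (f : D.RelChain n →ₗ[MonoidAlgebra ℤ G] coefficients G A) :
    innerCochain (f ∘ₗ D.relBdry n) = simplicialCoboundary D.EG (n + 1) (innerCochain f) := by
  rw [innerCochain, innerCochain, ← EquivariantChain.toCochain_comp_bdry]
  congr 1
  refine LinearMap.ext fun c => congrArg f ?_
  refine Prod.ext ?_ ?_
  · exact (congrArg (_ + ·) (map_zero (D.inclP (n + 1)))).trans (add_zero _)
  · exact (congrArg (- ·) (map_zero (EquivariantChain.bdry _ n))).trans neg_zero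

lemma outerCochain_comp_relBdry (f : D.RelChain n →ₗ[MonoidAlgebra ℤ G] coefficients G A) :
    outerCochain (f ∘ₗ D.relBdry n) = pullback D.peripheralComplex Sigma.snd (innerCochain f) -
      simplicialCoboundary D.peripheralComplex n (outerCochain f) := by
  symm
  have h : pullback D.peripheralComplex Sigma.snd (innerCochain f) =
      EquivariantChain.toCochain ((f ∘ₗ LinearMap.inl _ _ _) ∘ₗ D.inclP (n + 1)) :=
    pullback_eq (EquivariantChain.isCochain_toCochain _) fun x hx =>
      (EquivariantChain.toCochain_comp_map _ hx).symm
  rw [h, sub_eq_iff_eq_add, outerCochain, outerCochain, ← EquivariantChain.toCochain_comp_bdry,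
    ← EquivariantChain.toCochain_add]
  congr 1
  refine LinearMap.ext fun c => ?_
  change f _ = f _ + f _
  rw [← map_add]
  refine congrArg f (Prod.ext ?_ ?_)
  · change D.inclP (n + 1) c = EquivariantChain.bdry _ _ 0 + D.inclP (n + 1) c + 0
    rw [map_zero, zero_add, add_zero]
  · exact (neg_add_cancel _).symm

section Cocycle

variable {f : D.RelChain n →ₗ[MonoidAlgebra ℤ G] coefficients G A}

/-- Dualizing the mapping cone differential turns `(α, β)` into `(δα, α| - δβ)`. -/
lemma comp_relBdry_eq_zero_iff : f ∘ₗ D.relBdry n = 0 ↔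
    simplicialCoboundary D.EG (n + 1) (innerCochain f) = 0 ∧
      pullback D.peripheralComplex Sigma.snd (innerCochain f) =
        simplicialCoboundary D.peripheralComplex n (outerCochain f) := by
  have h1 : innerCochain (0 : D.RelChain (n + 1) →ₗ[MonoidAlgebra ℤ G] coefficients G A) = 0 :=
    EquivariantChain.toCochain_zero
  have h2 : outerCochain (0 : D.RelChain (n + 1) →ₗ[MonoidAlgebra ℤ G] coefficients G A) = 0 :=
    EquivariantChain.toCochain_zero
  rw [← innerCochain_comp_relBdry, ← sub_eq_zero (a := pullback _ _ _), ← outerCochain_comp_relBdry]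
  exact ⟨fun h => by rw [h]; exact ⟨h1, h2⟩,
    fun h => relHom_ext (h.1.trans h1.symm) (h.2.trans h2.symm)⟩

lemma relGlue_mem_cocycles [Finite ι] (hf : f ∘ₗ D.relBdry n = 0) :
    relGlue (innerCochain f) (outerCochain f) ∈ cocycles D.cuspedSpace A n := by
  obtain ⟨h1, h2⟩ := comp_relBdry_eq_zero_iff.1 hf
  exact ⟨mem_cochains_iff.2 ⟨isCochain_relGlue (isCochain_innerCochain f) (isCochain_outerCochain f)
    h2, finite_support_relGlue (finite_support_innerCochain f) (isCochain_outerCochain f)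
      (finite_support_outerCochain f)⟩,
    coboundary_relGlue (isCochain_innerCochain f) (isCochain_outerCochain f) h2 h1⟩

end Cocycle

variable (D A) in
/-- The map from relative cocycles to the compactly supported cohomology of the cusped space. -/
def comparison [Finite ι] (n : ℕ) :
    homCocycles.{u, v} (D.relBdry n) (coefficients G A) →+ Hc D.cuspedSpace A n where
  toFun f := QuotientAddGroup.mk ⟨_, relGlue_mem_cocycles f.2⟩
  map_zero' := by
    refine (QuotientAddGroup.eq_zero_iff _).2 ?_
    have : (⟨_, relGlue_mem_cocycles (0 : homCocycles.{u, v} (D.relBdry n) (coefficients G A)).2⟩ :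
        cocycles D.cuspedSpace A n) = 0 := Subtype.ext (by
      have h := relGlue_add (D := D) (innerCochain
        (0 : D.RelChain n →ₗ[MonoidAlgebra ℤ G] coefficients G A)) (innerCochain 0)
        (outerCochain 0) (outerCochain 0)
      rw [← innerCochain_add, ← outerCochain_add, add_zero, left_eq_add] at h
      exact h)
    rw [this]
    exact zero_mem _
  map_add' f f' := by
    rw [← QuotientAddGroup.mk_add]
    refine congrArg QuotientAddGroup.mk (Subtype.ext ?_)
    change relGlue (innerCochain (f.1 + f'.1)) (outerCochain (f.1 + f'.1)) =
      relGlue (innerCochain f.1) (outerCochain f.1) + relGlue (innerCochain f'.1) (outerCochain f'.1)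
    rw [innerCochain_add, outerCochain_add, relGlue_add]

lemma comparison_surjective [Finite ι] : Function.Surjective (D.comparison A (n + 1)) := by
  intro x
  obtain ⟨⟨ψ, hψ, hd⟩, rfl⟩ := QuotientAddGroup.mk_surjective x
  obtain ⟨hψ1, hψ2⟩ := mem_cochains_iff.1 hψ
  obtain ⟨α, β, θ, ⟨hα, hαf⟩, ⟨hβ, hβf⟩, ⟨hθ, hθf⟩, h1, h2, rfl⟩ :=
    exists_relGlue_add_coboundary_eq hψ1 hψ2 hd
  obtain ⟨f, rfl, rfl⟩ := exists_relHom hα hαf hβ hβf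
  refine ⟨⟨f, comp_relBdry_eq_zero_iff.2 ⟨h1, h2⟩⟩, QuotientAddGroup.eq.2 ?_⟩
  refine ⟨θ, mem_cochains_iff.2 ⟨hθ, hθf⟩, ?_⟩
  exact (neg_add_cancel_left _ _).symm

/-- Primitives are exchanged in both directions; freeness and finiteness make the primitives on the
two sides correspond to equivariant homomorphisms. -/
lemma relGlue_mem_coboundaries_iff [Finite ι]
    {f : D.RelChain (n + 1) →ₗ[MonoidAlgebra ℤ G] coefficients G A}
    (hf : f ∘ₗ D.relBdry (n + 1) = 0) :
    relGlue (innerCochain f) (outerCochain f) ∈ coboundaries D.cuspedSpace A (n + 1) ↔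
      ∃ h : D.RelChain n →ₗ[MonoidAlgebra ℤ G] coefficients G A, h ∘ₗ D.relBdry n = f := by
  constructor
  · rintro ⟨θ, hθ, h⟩
    obtain ⟨hθ1, hθ2⟩ := mem_cochains_iff.1 hθ
    obtain ⟨α, β, ⟨hα, hαf⟩, ⟨hβ, hβf⟩, h3, h4⟩ := exists_relative_coboundary
      (isCochain_innerCochain f) (isCochain_outerCochain f) (finite_support_outerCochain f)
      (comp_relBdry_eq_zero_iff.1 hf).2 hθ1 hθ2 h
    obtain ⟨g, rfl, rfl⟩ := exists_relHom hα hαf hβ hβf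
    exact ⟨g, relHom_ext ((innerCochain_comp_relBdry g).trans h3)
      ((outerCochain_comp_relBdry g).trans h4)⟩
  · rintro ⟨g, hg⟩
    obtain ⟨θ, ⟨hθ, hθf⟩, h⟩ := exists_coboundary_eq_relGlue (isCochain_innerCochain g)
      (finite_support_innerCochain g) (isCochain_outerCochain g) (finite_support_outerCochain g)
    rw [← innerCochain_comp_relBdry, ← outerCochain_comp_relBdry, hg] at h
    exact ⟨θ, mem_cochains_iff.2 ⟨hθ, hθf⟩, h⟩

lemma comparison_eq_zero_iff [Finite ι]
    (f : homCocycles.{u, v} (D.relBdry (n + 1)) (coefficients G A)) :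
    D.comparison A (n + 1) f = 0 ↔
      ∃ h : D.RelChain n →ₗ[MonoidAlgebra ℤ G] coefficients G A, h ∘ₗ D.relBdry n = f :=
  (QuotientAddGroup.eq_zero_iff _).trans (relGlue_mem_coboundaries_iff f.2)

lemma innerCochain_rightMul (f : D.RelChain n →ₗ[MonoidAlgebra ℤ G] coefficients G A) (g : G)
    (a : A) : innerCochain ((rightMul G (MonoidAlgebra.single g a)).hom ∘ₗ f) =
      actCochain g a (n + 1) (innerCochain f) := by
  rw [innerCochain, LinearMap.comp_assoc, EquivariantChain.toCochain_rightMul]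
  rfl

lemma outerCochain_rightMul (f : D.RelChain n →ₗ[MonoidAlgebra ℤ G] coefficients G A) (g : G)
    (a : A) : outerCochain ((rightMul G (MonoidAlgebra.single g a)).hom ∘ₗ f) =
      actCochain g a n (outerCochain f) := by
  rw [outerCochain, LinearMap.comp_assoc, EquivariantChain.toCochain_rightMul]
  rfl

lemma comparison_rightMul [Finite ι] (g : G) (a : A)
    {f f' : homCocycles.{u, v} (D.relBdry n) (coefficients G A)}
    (h : (f' : D.RelChain n →ₗ[MonoidAlgebra ℤ G] coefficients G A) =
      (rightMul G (MonoidAlgebra.single g a)).hom ∘ₗ f.1) :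
    D.comparison A n f' = actHc D.cuspedSpace_invariant g a n (D.comparison A n f) := by
  refine congrArg QuotientAddGroup.mk (Subtype.ext ?_)
  have h1 : innerCochain f'.1 = actCochain g a (n + 1) (innerCochain f.1) :=
    (congrArg innerCochain h).trans (innerCochain_rightMul f.1 g a)
  have h2 : outerCochain f'.1 = actCochain g a n (outerCochain f.1) :=
    (congrArg outerCochain h).trans (outerCochain_rightMul f.1 g a)
  have h3 := (comp_relBdry_eq_zero_iff.1 f'.2).2
  change relGlue (innerCochain f'.1) (outerCochain f'.1) = _
  rw [h1, h2] at h3 ⊢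
  exact relGlue_actCochain g a (isCochain_innerCochain _) (isCochain_outerCochain _)
    (comp_relBdry_eq_zero_iff.1 f.2).2 h3

lemma subsingleton_Hc_zero [Finite ι] [Nonempty ι] : Subsingleton (Hc D.cuspedSpace A 0) := by
  refine subsingleton_of_forall_eq 0 fun x => ?_
  obtain ⟨⟨ψ, hψ, hd⟩, rfl⟩ := QuotientAddGroup.mk_surjective x
  obtain ⟨hψ1, hψ2⟩ := mem_cochains_iff.1 hψ
  refine (QuotientAddGroup.eq_zero_iff _).2 ?_
  exact eq_zero_of_coboundary_eq_zero hψ1 hψ2 hd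

end CuspedSpaceData

/-- Two surjections with the same kernel have isomorphic targets. -/
lemma exists_addEquiv_of_surjective {X Y Z : Type*} [AddCommGroup X] [AddCommGroup Y]
    [AddCommGroup Z] {S : X →+ Y} {T : X →+ Z} (hS : Function.Surjective S)
    (hT : Function.Surjective T) (h : ∀ x, S x = 0 ↔ T x = 0) :
    ∃ Φ : Y ≃+ Z, ∀ x, Φ (S x) = T x := by
  have hker : S.ker = T.ker := AddSubgroup.ext h
  refine ⟨((QuotientAddGroup.quotientKerEquivOfSurjective S hS).symm.trans
    (QuotientAddGroup.quotientAddEquivOfEq hker)).trans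
    (QuotientAddGroup.quotientKerEquivOfSurjective T hT), fun x => ?_⟩
  have : (QuotientAddGroup.quotientKerEquivOfSurjective S hS).symm (S x) =
      QuotientAddGroup.mk x := by
    rw [AddEquiv.symm_apply_eq]
    rfl
  rw [AddEquiv.trans_apply, AddEquiv.trans_apply, this]
  rfl

end

theorem mainTheorem9 {G : Type u} [Group G] {ι : Type} [Finite ι] [Nonempty ι]
    (P : ι → Subgroup G) (N : ℕ) (D : CuspedSpaceData.{u, w} P N)
    (A : Type v) [Ring A] (k : ℕ) (hk : k ≤ N) :
    ∃ Φ : RelativeCohomology.H.{u, v} P (RelativeCohomology.coefficients G A) k ≃+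
        CompactCohomology.Hc D.cuspedSpace A k,
      ∀ (g : G) (a : A) (x : RelativeCohomology.H.{u, v} P (RelativeCohomology.coefficients G A) k),
        Φ (RelativeCohomology.mapH (RelativeCohomology.rightMul G (MonoidAlgebra.single g a)) k x) =
          CompactCohomology.actHc D.cuspedSpace_invariant g a k (Φ x) := by
  cases k with
  | zero =>
    -- In degree 0 the left side is zero by definition and the right side by connectedness of `E_G`.
    have := D.subsingleton_Hc_zero (A := A)
    have : Subsingleton (RelativeCohomology.H.{u, v} P (RelativeCohomology.coefficients G A) 0) :=
      inferInstanceAs (Subsingleton PUnit)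
    exact ⟨⟨⟨fun _ => 0, fun _ => 0, fun _ => Subsingleton.elim _ _, fun _ => Subsingleton.elim _ _⟩,
      fun _ _ => Subsingleton.elim _ _⟩, fun _ _ _ => Subsingleton.elim _ _⟩
  | succ k =>
    -- Both groups are quotients of the group of relative cocycles, by the same subgroup of relative
    -- coboundaries.
    obtain ⟨T, hT, hT0, hTmul⟩ := D.exists_relative_presentation A hk
    obtain ⟨Φ, hΦ⟩ := exists_addEquiv_of_surjective hT
      (D.comparison_surjective (A := A) (n := k))
      fun f => (hT0 f).trans (D.comparison_eq_zero_iff f).symm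
    refine ⟨Φ, fun g a x => ?_⟩
    obtain ⟨f, rfl⟩ := hT x
    -- Right multiplication already acts on representing cocycles, and both surjections are
    -- compatible with it.
    let f' : homCocycles.{u, v} (D.relBdry (k + 1)) (RelativeCohomology.coefficients G A) :=
      ⟨(RelativeCohomology.rightMul G (MonoidAlgebra.single g a)).hom ∘ₗ f.1, by
        refine (LinearMap.comp_assoc _ _ _).trans ?_
        rw [show f.1 ∘ₗ D.relBdry (k + 1) = 0 from f.2, LinearMap.comp_zero]⟩
    rw [← hTmul _ f f' rfl, hΦ, hΦ]
    exact CuspedSpaceData.comparison_rightMul g a rfl
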